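/- Let $n,l,m,d_\varphi,d_\eta\in\mathbb N$ and $T>0$, let $U\subset\mathbb R^l$ and $V\subset\mathbb R^m$ be open, and let $f_i:\mathbb R^{n+l}\to\mathbb R^n$ ($0\le i\le m$), $\varphi_i:\mathbb R^{2n}\to\mathbb R$ ($0\le i\le d_\varphi$) and $\eta_j:\mathbb R^{2n}\to\mathbb R$ ($1\le j\le d_\eta$) be functions with Lipschitz-continuous second order derivatives. Put $F(x,u,v):=f_0(x,u)+\sum_{i=1}^m v_if_i(x,u)$. Consider the problem (P) of minimizing $\varphi_0(x(0),x(T))$ over the feasible trajectories, i.e. over all $w=(x,u,v)\in\mathcal W:=W^{1,\infty}(0,T;\mathbb R^n)\times L^\infty(0,T;\mathbb R^l)\times L^\infty(0,T;\mathbb R^m)$ such that $$\dot x=F(x,u,v)\ \text{ a.e. on }[0,T],\qquad \eta_j(x(0),x(T))=0\ (1\le j\le d_\eta),\qquad \varphi_i(x(0),x(T))\le 0\ (1\le i\le d_\varphi),$$ and $u(t)\in U$, $v(t)\in V$ for a.e. $t\in[0,T]$. A feasible trajectory $\hat w=(\hat x,\hat u,\hat v)$ is a weak minimum if there is $\varepsilon>0$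 such that $\varphi_0(\hat x(0),\hat x(T))\le\varphi_0(x(0),x(T))$ for every feasible trajectory $(x,u,v)$ with $\|x-\hat x\|_\infty<\varepsilon$, $\|u-\hat u\|_\infty<\varepsilon$ and $\|v-\hat v\|_\infty<\varepsilon$. Fix a feasible trajectory $\hat w=(\hat x,\hat u,\hat v)$ with $\varphi_i(\hat x(0),\hat x(T))=0$ for $1\le i\le d_\varphi$, and suppose that for some $\delta>0$ the closed ball of radius $\delta$ around $(\hat u(t),\hat v(t))$ in $\mathbb R^{l+m}$ is contained in $U\times V$ for a.e. $t\in[0,T]$. For $\lambda=(\alpha,\beta,p)\in\mathbb R^{d_\varphi+1}\times\mathbb R^{d_\eta}\times W^{1,\infty}(0,T;\mathbb R^{n,*})$, where $\mathbb R^{n,*}$ is the space of row vectors, put $H[\lambda](x,u,v,t):=p(t)F(x,u,v)$ and $\ell[\lambda](x_0,x_T):=\sum_{i=0}^{d_\varphi}\alpha_i\varphi_i(x_0,x_T)+\sum_{j=1}^{d_\eta}\beta_j\eta_j(x_0,x_T)$. Below, derivatives of $F$ and $H[\lambda]$ are evaluated along $\hat w$ and those of $\ell[\lambda],\varphi_i,\eta_j$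 at $(\hat x(0),\hat x(T))$. Let $\Lambda$ be the set of Lagrange multipliers associated with $\hat w$, i.e. of those $\lambda$ for which $$\sum_{i=0}^{d_\varphi}|\alpha_i|+\sum_{j=1}^{d_\eta}|\beta_j|=1,\qquad \alpha_i\ge 0\ (0\le i\le d_\varphi),\qquad -\dot p=H_x[\lambda]\ \text{ a.e. on }[0,T],$$ $$p(0)=-D_{x_0}\ell[\lambda],\qquad p(T)=D_{x_T}\ell[\lambda],\qquad H_u[\lambda]=0\ \text{ and }\ H_v[\lambda]=0\ \text{ a.e. on }[0,T].$$ Let $\mathcal C_2$ be the set of all $\bar w=(\bar x,\bar u,\bar v)\in\mathcal W_2:=W^{1,2}(0,T;\mathbb R^n)\times L^2(0,T;\mathbb R^l)\times L^2(0,T;\mathbb R^m)$ such that $\dot{\bar x}=F_x\bar x+F_u\bar u+F_v\bar v$ a.e. on $[0,T]$, $D\eta_j(\bar x(0),\bar x(T))=0$ for $1\le j\le d_\eta$ and $D\varphi_i(\bar x(0),\bar x(T))\le 0$ for $0\le i\le d_\varphi$, and let $\mathcal C:=\mathcal C_2\cap\mathcal W$. For $\bar w\in\mathcal W_2$ put $$\Omega[\lambda](\bar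 x,\bar u,\bar v):=\tfrac12 D^2\ell[\lambda]\,(\bar x(0),\bar x(T))^2+\int_0^T\Big(\tfrac12\bar x^\top H_{xx}[\lambda]\bar x+\bar u^\top H_{ux}[\lambda]\bar x+\bar v^\top H_{vx}[\lambda]\bar x+\tfrac12\bar u^\top H_{uu}[\lambda]\bar u+\bar v^\top H_{vu}[\lambda]\bar u\Big)\,dt .$$ Theorem. If $\hat w$ is a weak minimum of (P), then $$\max_{\lambda\in\Lambda}\Omega[\lambda](\bar x,\bar u,\bar v)\ge 0\qquad\text{for all }(\bar x,\bar u,\bar v)\in\mathcal C,$$ and the same holds for all $(\bar x,\bar u,\bar v)\in\mathcal C_2$; in both cases the maximum is attained. -/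

import Mathlib

open MeasureTheory

noncomputable section

/-- The Euclidean space of column vectors of dimension `k`. -/
abbrev Vec (k : ℕ) : Type := EuclideanSpace ℝ (Fin k)

/-- Lebesgue measure on the interval `[0, T]`. -/
def timeMeasure (T : ℝ) : Measure ℝ := volume.restrict (Set.Icc 0 T)

/-- `MemW1 p T x`: the function `x`, restricted to `[0, T]`, is (the continuous representative of)
an element of the Sobolev space `W^{1,p}(0,T;E)`, that is, `x` and its derivative `g` are in `L^p`
and `x` is the indefinite integral of `g`. Being in `L^p` is automatic for `x` itself, as `x` is
continuous on the compact interval `[0, T]`. Values outside `[0, T]` play no role. -/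
def MemW1 {E : Type*} [NormedAddCommGroup E] [NormedSpace ℝ E] (p : ENNReal) (T : ℝ)
    (x : ℝ → E) : Prop :=
  ∃ g : ℝ → E, MemLp g p (timeMeasure T) ∧
    ∀ t ∈ Set.Icc 0 T, x t = x 0 + ∫ s in (0 : ℝ)..t, g s

/-- A triple `w = (x, u, v)` of functions of time: state, nonlinear control, affine control. -/
structure Triple (n l m : ℕ) where
  x : ℝ → Vec n
  u : ℝ → Vec l
  v : ℝ → Vec m

/-- Membership in `W^{1,p} × L^p × L^p`; the space `𝒲` is the case `p = ∞` and the space `𝒲₂` is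
the case `p = 2`. -/
def Triple.MemW {n l m : ℕ} (p : ENNReal) (T : ℝ) (w : Triple n l m) : Prop :=
  MemW1 p T w.x ∧ MemLp w.u p (timeMeasure T) ∧ MemLp w.v p (timeMeasure T)

/-- A function of class `C²` whose second order derivative is Lipschitz continuous. -/
def HasLipschitzSecondDeriv {E F : Type*} [NormedAddCommGroup E] [NormedSpace ℝ E]
    [NormedAddCommGroup F] [NormedSpace ℝ F] (g : E → F) : Prop :=
  ContDiff ℝ 2 g ∧ ∃ K : NNReal, LipschitzWith K (iteratedFDeriv ℝ 2 g)

/-- An element `λ = (α, β, p)`, where `p` takes values in the space of row vectors. -/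
structure Multiplier (n dφ dη : ℕ) where
  α : Fin (dφ + 1) → ℝ
  β : Fin dη → ℝ
  p : ℝ → (Vec n →L[ℝ] ℝ)

/-- The data of the optimal control problem: minimize `φ₀(x(0),x(T))` subject to
`ẋ = f₀(x,u) + ∑ i, vᵢ fᵢ(x,u)`, `η_j(x(0),x(T)) = 0` for all `j`, `φᵢ(x(0),x(T)) ≤ 0` for `i ≥ 1`,
`u(t) ∈ U`, `v(t) ∈ V`. The index `0` of `f` and `φ` is the one of `f₀` and `φ₀`. -/
structure ControlProblem (n l m dφ dη : ℕ) where
  T : ℝ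
  f : Fin (m + 1) → Vec n × Vec l → Vec n
  φ : Fin (dφ + 1) → Vec n × Vec n → ℝ
  η : Fin dη → Vec n × Vec n → ℝ
  U : Set (Vec l)
  V : Set (Vec m)

namespace ControlProblem

variable {n l m dφ dη : ℕ} (P : ControlProblem n l m dφ dη)

/-- All data functions have Lipschitz continuous second order derivatives. -/
def IsRegular : Prop :=
  (∀ i, HasLipschitzSecondDeriv (P.f i)) ∧ (∀ i, HasLipschitzSecondDeriv (P.φ i)) ∧
    ∀ j, HasLipschitzSecondDeriv (P.η j)

/-- The dynamics `F(x,u,v) = f₀(x,u) + ∑ i, vᵢ fᵢ(x,u)`. -/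
def F (x : Vec n) (u : Vec l) (v : Vec m) : Vec n :=
  P.f 0 (x, u) + ∑ i : Fin m, v i • P.f i.succ (x, u)

/-- The pair `(x(0), x(T))` of endpoints. -/
def endpoints (w : Triple n l m) : Vec n × Vec n := (w.x 0, w.x P.T)

/-- A trajectory: an element of `𝒲` that satisfies the state equation. -/
def IsTrajectory (w : Triple n l m) : Prop :=
  w.MemW ⊤ P.T ∧
    ∀ᵐ t ∂(timeMeasure P.T), HasDerivAt w.x (P.F (w.x t) (w.u t) (w.v t)) t

/-- A feasible trajectory. -/
def IsFeasible (w : Triple n l m) : Prop :=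
  P.IsTrajectory w ∧
    (∀ j, P.η j (P.endpoints w) = 0) ∧
    (∀ i : Fin dφ, P.φ i.succ (P.endpoints w) ≤ 0) ∧
    ∀ᵐ t ∂(timeMeasure P.T), w.u t ∈ P.U ∧ w.v t ∈ P.V

/-- A weak minimum: a feasible trajectory that is optimal among the feasible trajectories whose
three components are uniformly close to its own. -/
def IsWeakMin (wh : Triple n l m) : Prop :=
  P.IsFeasible wh ∧ ∃ ε : ℝ, 0 < ε ∧ ∀ w : Triple n l m, P.IsFeasible w →
    eLpNorm (fun t => w.x t - wh.x t) ⊤ (timeMeasure P.T) < ENNReal.ofReal ε →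
    eLpNorm (fun t => w.u t - wh.u t) ⊤ (timeMeasure P.T) < ENNReal.ofReal ε →
    eLpNorm (fun t => w.v t - wh.v t) ⊤ (timeMeasure P.T) < ENNReal.ofReal ε →
    P.φ 0 (P.endpoints wh) ≤ P.φ 0 (P.endpoints w)

/-- The controls do not accumulate at the boundary: for some `δ > 0`, the closed Euclidean ball of
radius `δ` around `(u(t), v(t))` is contained in `U × V` for almost all `t`. -/
def ControlsAwayFromBoundary (wh : Triple n l m) : Prop :=
  ∃ δ : ℝ, 0 < δ ∧ ∀ᵐ t ∂(timeMeasure P.T), ∀ (a : Vec l) (b : Vec m),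
    ‖a‖ ^ 2 + ‖b‖ ^ 2 ≤ δ ^ 2 → wh.u t + a ∈ P.U ∧ wh.v t + b ∈ P.V

/-- The unmaximized Hamiltonian `H[λ](x,u,v,t) = p(t) F(x,u,v)`. -/
def H (μ : Multiplier n dφ dη) (x : Vec n) (u : Vec l) (v : Vec m) (t : ℝ) : ℝ :=
  μ.p t (P.F x u v)

/-- The endpoint Lagrangian `ℓ[λ]`. -/
def endpointLagrangian (μ : Multiplier n dφ dη) (z : Vec n × Vec n) : ℝ :=
  ∑ i, μ.α i * P.φ i z + ∑ j, μ.β j * P.η j z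

/-- The derivative `H_x[λ]`. -/
def Hx (μ : Multiplier n dφ dη) (x : Vec n) (u : Vec l) (v : Vec m) (t : ℝ) : Vec n →L[ℝ] ℝ :=
  fderiv ℝ (fun y => P.H μ y u v t) x

/-- The derivative `H_u[λ]`. -/
def Hu (μ : Multiplier n dφ dη) (x : Vec n) (u : Vec l) (v : Vec m) (t : ℝ) : Vec l →L[ℝ] ℝ :=
  fderiv ℝ (fun y => P.H μ x y v t) u

/-- The derivative `H_v[λ]`. -/
def Hv (μ : Multiplier n dφ dη) (x : Vec n) (u : Vec l) (v : Vec m) (t : ℝ) : Vec m →L[ℝ] ℝ :=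
  fderiv ℝ (fun y => P.H μ x u y t) v

/-- The set `Λ` of Lagrange multipliers associated with the trajectory `wh`. -/
def multipliers (wh : Triple n l m) : Set (Multiplier n dφ dη) :=
  {μ | MemW1 ⊤ P.T μ.p ∧
    -- nontriviality and sign
    ∑ i, |μ.α i| + ∑ j, |μ.β j| = 1 ∧ (∀ i, 0 ≤ μ.α i) ∧
    -- costate equation
    (∀ᵐ t ∂(timeMeasure P.T), HasDerivAt μ.p (-(P.Hx μ (wh.x t) (wh.u t) (wh.v t) t)) t) ∧
    -- transversality conditions
    μ.p 0 = -(fderiv ℝ (fun y => P.endpointLagrangian μ (y, wh.x P.T)) (wh.x 0)) ∧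
    μ.p P.T = fderiv ℝ (fun y => P.endpointLagrangian μ (wh.x 0, y)) (wh.x P.T) ∧
    -- stationarity conditions
    ∀ᵐ t ∂(timeMeasure P.T), P.Hu μ (wh.x t) (wh.u t) (wh.v t) t = 0 ∧
      P.Hv μ (wh.x t) (wh.u t) (wh.v t) t = 0}

/-- The right-hand side `F_x x̄ + F_u ū + F_v v̄` of the linearized state equation at time `t`, the
derivatives being evaluated along `wh`. -/
def linearizedRHS (wh w : Triple n l m) (t : ℝ) : Vec n :=
  fderiv ℝ (fun y => P.F y (wh.u t) (wh.v t)) (wh.x t) (w.x t) +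
    fderiv ℝ (fun y => P.F (wh.x t) y (wh.v t)) (wh.u t) (w.u t) +
    fderiv ℝ (fun y => P.F (wh.x t) (wh.u t) y) (wh.v t) (w.v t)

/-- The critical cone `𝒞₂` in `𝒲₂`. The initial value of the state component is free. -/
def criticalConeL2 (wh : Triple n l m) : Set (Triple n l m) :=
  {w | w.MemW 2 P.T ∧
    (∀ᵐ t ∂(timeMeasure P.T), HasDerivAt w.x (P.linearizedRHS wh w t) t) ∧
    (∀ j, fderiv ℝ (P.η j) (P.endpoints wh) (P.endpoints w) = 0) ∧
    ∀ i, fderiv ℝ (P.φ i) (P.endpoints wh) (P.endpoints w) ≤ 0}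

/-- The critical cone `𝒞 = 𝒞₂ ∩ 𝒲`. -/
def criticalCone (wh : Triple n l m) : Set (Triple n l m) :=
  P.criticalConeL2 wh ∩ {w | w.MemW ⊤ P.T}

/-- The integrand of the second variation at time `t`. Second order derivatives of the Hamiltonian
are bilinear forms obtained by differentiating `H_x`, `H_u` and `H_v`: for instance `ūᵀ H_ux x̄` is
the derivative of `x ↦ H_u` in the direction `x̄`, applied to `ū`. -/
def secondVariationIntegrand (wh : Triple n l m) (μ : Multiplier n dφ dη) (w : Triple n l m)
    (t : ℝ) : ℝ :=
  (1 / 2 : ℝ) * fderiv ℝ (fun y => P.Hx μ y (wh.u t) (wh.v t) t) (wh.x t) (w.x t) (w.x t) +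
    fderiv ℝ (fun y => P.Hu μ y (wh.u t) (wh.v t) t) (wh.x t) (w.x t) (w.u t) +
    fderiv ℝ (fun y => P.Hv μ y (wh.u t) (wh.v t) t) (wh.x t) (w.x t) (w.v t) +
    (1 / 2 : ℝ) * fderiv ℝ (fun y => P.Hu μ (wh.x t) y (wh.v t) t) (wh.u t) (w.u t) (w.u t) +
    fderiv ℝ (fun y => P.Hv μ (wh.x t) y (wh.v t) t) (wh.u t) (w.u t) (w.v t)

/-- The second variation `Ω[λ](x̄,ū,v̄)` of the Lagrangian at `wh`. -/
def secondVariation (wh : Triple n l m) (μ : Multiplier n dφ dη) (w : Triple n l m) : ℝ :=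
  (1 / 2 : ℝ) * iteratedFDeriv ℝ 2 (P.endpointLagrangian μ) (P.endpoints wh)
      (fun _ => P.endpoints w) +
    ∫ t in (0 : ℝ)..P.T, P.secondVariationIntegrand wh μ w t

end ControlProblem

end

/-!
The trajectories near `ŵ` are the zeros of a map in the state and finitely many controls, which is
strictly differentiable in the sup norm along bounded controls. If the equality constraints are
regular, a Lyusternik type correction turns each curve `ŵ + s q + s² q₁` that solves the
constraints up to `o(s²)` into exact trajectories at distance `o(s²)`. Hence, for a critical
direction `q` with bounded controls, the optimality of `ŵ` excludes second order directions `q₁`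
along which the endpoint functions decrease, and separating convex sets in finite dimensions gives
`(α, β)` with a nonnegative second order term that annihilates the linearized endpoint map.
By the adjoint equation and integration by parts, these `(α, β)` are exactly the endpoint components
of the Lagrange multipliers, and the second order term is `Ω[λ]`. The normalized `(α, β)` form a
compact set and directions with bounded controls are dense in the critical directions that share
their endpoint values, which gives the maximum and the passage to `𝒞₂`.
-/

noncomputable section

open Set hiding IccExtend
open ContinuousMap (IccExtend)
open Filter Topology

instance isFiniteMeasure_timeMeasure (T : ℝ) : IsFiniteMeasure (timeMeasure T) := by
  unfold timeMeasure; infer_instance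

section Primitive

variable {E : Type*} [NormedAddCommGroup E] {T : ℝ}

theorem ae_timeMeasure_mem (T : ℝ) : ∀ᵐ t ∂timeMeasure T, t ∈ Icc 0 T :=
  ae_restrict_mem measurableSet_Icc

theorem timeMeasure_eq_Ioc (T : ℝ) : timeMeasure T = volume.restrict (Ioc 0 T) :=
  Measure.restrict_congr_set Ioc_ae_eq_Icc.symm

theorem intervalIntegrable_of_timeMeasure {b : ℝ → E} (hb : Integrable b (timeMeasure T)) {s t : ℝ}
    (hs : s ∈ Icc 0 T) (ht : t ∈ Icc 0 T) : IntervalIntegrable b volume s t := by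
  rw [intervalIntegrable_iff]
  refine IntegrableOn.mono_set (t := Icc 0 T) hb (fun x hx => ?_)
  rw [mem_uIoc] at hx
  rcases hx with h | h
  · exact ⟨hs.1.trans h.1.le, h.2.trans ht.2⟩
  · exact ⟨ht.1.trans h.1.le, h.2.trans hs.2⟩

theorem intervalIntegrable_iff_timeMeasure (hT : 0 ≤ T) {b : ℝ → E} :
    IntervalIntegrable b volume 0 T ↔ Integrable b (timeMeasure T) := by
  rw [intervalIntegrable_iff_integrableOn_Ioc_of_le hT, timeMeasure_eq_Ioc, IntegrableOn]

theorem IccExtend_apply_of_mem (hT : 0 ≤ T) (x : C(Icc 0 T, E)) {t : ℝ} (ht : t ∈ Icc 0 T) :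
    IccExtend hT x t = x ⟨t, ht⟩ :=
  Set.IccExtend_of_mem hT x ht

theorem norm_IccExtend_le (hT : 0 ≤ T) (x : C(Icc 0 T, E)) (t : ℝ) : ‖IccExtend hT x t‖ ≤ ‖x‖ :=
  x.norm_coe_le_norm _

theorem aestronglyMeasurable_IccExtend (hT : 0 ≤ T) (x : C(Icc 0 T, E)) :
    AEStronglyMeasurable (IccExtend hT x) (timeMeasure T) :=
  (IccExtend hT x).continuous.aestronglyMeasurable

theorem memLp_IccExtend (hT : 0 ≤ T) (x : C(Icc 0 T, E)) (p : ENNReal) :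
    MemLp (IccExtend hT x) p (timeMeasure T) :=
  MemLp.of_bound (aestronglyMeasurable_IccExtend hT x) ‖x‖
    (Eventually.of_forall (norm_IccExtend_le hT x))

variable [NormedSpace ℝ E]

theorem intervalIntegral_eq_timeMeasure (hT : 0 ≤ T) (b : ℝ → E) :
    ∫ s in (0 : ℝ)..T, b s = ∫ s, b s ∂timeMeasure T := by
  rw [intervalIntegral.integral_of_le hT, timeMeasure_eq_Ioc]

theorem intervalIntegral_congr_timeMeasure {b c : ℝ → E} (h : b =ᵐ[timeMeasure T] c) {t : ℝ}
    (ht : t ∈ Icc 0 T) : ∫ s in (0 : ℝ)..t, b s = ∫ s in (0 : ℝ)..t, c s := by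
  refine intervalIntegral.integral_congr_ae ?_
  have := (ae_restrict_iff' measurableSet_Icc).1 h
  filter_upwards [this] with s hs hst
  rw [uIoc_of_le ht.1] at hst
  exact hs ⟨hst.1.le, hst.2.trans ht.2⟩

theorem norm_intervalIntegral_le_timeMeasure {b : ℝ → E} (hb : Integrable b (timeMeasure T)) {t : ℝ}
    (ht : t ∈ Icc 0 T) : ‖∫ s in (0 : ℝ)..t, b s‖ ≤ ∫ s, ‖b s‖ ∂timeMeasure T := by
  rw [intervalIntegral.integral_of_le ht.1]
  refine (norm_integral_le_integral_norm _).trans ?_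
  refine setIntegral_mono_set (s := Ioc 0 t) (t := Icc 0 T) hb.norm ?_ ?_
  · exact Eventually.of_forall fun _ => norm_nonneg _
  · exact LE.le.eventuallyLE fun x hx => ⟨hx.1.le, hx.2.trans ht.2⟩

theorem continuousOn_primitive_timeMeasure {b : ℝ → E} (hb : Integrable b (timeMeasure T)) :
    ContinuousOn (fun t => ∫ s in (0 : ℝ)..t, b s) (Icc 0 T) := by
  rcases le_or_gt 0 T with hT | hT
  · have := intervalIntegral.continuousOn_primitive_interval (a := 0) (b := T) (μ := volume)
      (f := b) (by rw [uIcc_of_le hT]; exact hb)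
    rwa [uIcc_of_le hT] at this
  · rw [Icc_eq_empty (not_le.2 hT)]
    exact continuousOn_empty _

open Classical in
/-- The primitive on `[0, T]` vanishing at `0`; it is zero if the function is not integrable. -/
def primitive (T : ℝ) (b : ℝ → E) : C(Icc 0 T, E) :=
  if hb : Integrable b (timeMeasure T) then
    ⟨fun t => ∫ s in (0 : ℝ)..t, b s, continuousOn_iff_continuous_domRestrict.1
      (continuousOn_primitive_timeMeasure hb)⟩
  else 0

theorem primitive_apply {b : ℝ → E} (hb : Integrable b (timeMeasure T)) (t : Icc 0 T) :
    primitive T b t = ∫ s in (0 : ℝ)..t, b s := by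
  rw [primitive, dif_pos hb]; rfl

theorem norm_primitive_le (b : ℝ → E) :
    ‖primitive T b‖ ≤ ∫ s, ‖b s‖ ∂timeMeasure T := by
  rw [ContinuousMap.norm_le _ (integral_nonneg fun _ => norm_nonneg _)]
  intro t
  by_cases hb : Integrable b (timeMeasure T)
  · rw [primitive_apply hb]
    exact norm_intervalIntegral_le_timeMeasure hb t.2
  · rw [primitive, dif_neg hb]
    simpa using integral_nonneg fun _ => norm_nonneg _

theorem norm_primitive_le_of_ae_le_div (hT : 0 ≤ T) {b : ℝ → E} {K : ℝ} (hK : 0 ≤ K)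
    (hb : ∀ᵐ t ∂timeMeasure T, ‖b t‖ ≤ K / (T + 1)) : ‖primitive T b‖ ≤ K := by
  calc ‖primitive T b‖ ≤ ∫ s, ‖b s‖ ∂timeMeasure T := norm_primitive_le b
    _ ≤ ∫ _, K / (T + 1) ∂timeMeasure T :=
      integral_mono_of_nonneg (Eventually.of_forall fun _ => norm_nonneg _) (integrable_const _) hb
    _ = T / (T + 1) * K := by simp [timeMeasure, Measure.real, hT]; ring
    _ ≤ K := mul_le_of_le_one_left hK ((div_le_one (by positivity)).2 (by linarith))

theorem primitive_congr {b c : ℝ → E} (h : b =ᵐ[timeMeasure T] c) :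
    primitive T b = primitive T c := by
  by_cases hb : Integrable b (timeMeasure T)
  · ext t
    rw [primitive_apply hb, primitive_apply (hb.congr h), intervalIntegral_congr_timeMeasure h t.2]
  · rw [primitive, primitive, dif_neg hb, dif_neg (fun h' => hb (h'.congr h.symm))]

theorem primitive_add {b c : ℝ → E} (hb : Integrable b (timeMeasure T))
    (hc : Integrable c (timeMeasure T)) :
    primitive T (fun t => b t + c t) = primitive T b + primitive T c := by
  ext t
  have hbc : Integrable (fun t => b t + c t) (timeMeasure T) := hb.add hc
  rw [ContinuousMap.add_apply, primitive_apply hb, primitive_apply hc, primitive_apply hbc]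
  have h0 : (0 : ℝ) ∈ Icc 0 T := ⟨le_rfl, t.2.1.trans t.2.2⟩
  exact intervalIntegral.integral_add (intervalIntegrable_of_timeMeasure hb h0 t.2)
    (intervalIntegrable_of_timeMeasure hc h0 t.2)

theorem primitive_smul {b : ℝ → E} (r : ℝ) (hb : Integrable b (timeMeasure T)) :
    primitive T (fun t => r • b t) = r • primitive T b := by
  ext t
  have hrb : Integrable (fun t => r • b t) (timeMeasure T) := hb.smul r
  rw [ContinuousMap.smul_apply, primitive_apply hb, primitive_apply hrb]
  exact intervalIntegral.integral_smul _ _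

/-- The primitive as a continuous linear map from `L¹`. -/
def primitiveL (T : ℝ) (E : Type*) [NormedAddCommGroup E] [NormedSpace ℝ E] :
    Lp E 1 (timeMeasure T) →L[ℝ] C(Icc 0 T, E) :=
  LinearMap.mkContinuous
    { toFun := fun b => primitive T b
      map_add' := fun b c => by
        rw [primitive_congr (Lp.coeFn_add b c)]
        exact primitive_add (L1.integrable_coeFn b) (L1.integrable_coeFn c)
      map_smul' := fun r b => by
        rw [primitive_congr (Lp.coeFn_smul r b)]
        exact primitive_smul r (L1.integrable_coeFn b) } 1
    fun b => by
      rw [one_mul, L1.norm_eq_integral_norm]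
      exact norm_primitive_le b

theorem primitiveL_apply (b : Lp E 1 (timeMeasure T)) : primitiveL T E b = primitive T b := rfl

theorem primitive_sub {b c : ℝ → E} (hb : Integrable b (timeMeasure T))
    (hc : Integrable c (timeMeasure T)) :
    primitive T (fun t => b t - c t) = primitive T b - primitive T c := by
  have hneg : primitive T (-c) = -primitive T c := by
    simpa only [neg_one_smul] using! primitive_smul (-1) hc
  simpa only [sub_eq_add_neg, hneg, Pi.neg_apply] using! primitive_add hb hc.neg

theorem primitive_taylor_remainder {g f₀ f₁ f₂ : ℝ → E} (s : ℝ)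
    (hg : Integrable g (timeMeasure T)) (h₀ : Integrable f₀ (timeMeasure T))
    (h₁ : Integrable f₁ (timeMeasure T)) (h₂ : Integrable f₂ (timeMeasure T)) :
    primitive T (fun t => g t - f₀ t - s • f₁ t - s ^ 2 • f₂ t) =
      primitive T g - primitive T f₀ - s • primitive T f₁ - s ^ 2 • primitive T f₂ := by
  have h₁' : Integrable (fun t => s • f₁ t) (timeMeasure T) := h₁.smul s
  have h₂' : Integrable (fun t => s ^ 2 • f₂ t) (timeMeasure T) := h₂.smul (s ^ 2)
  have hg₀ : Integrable (fun t => g t - f₀ t) (timeMeasure T) := hg.sub h₀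
  have hg₁ : Integrable (fun t => g t - f₀ t - s • f₁ t) (timeMeasure T) := hg₀.sub h₁'
  rw [primitive_sub hg₁ h₂', primitive_sub hg₀ h₁', primitive_sub hg h₀, primitive_smul s h₁,
    primitive_smul _ h₂]

theorem primitive_zero (hT : 0 ≤ T) (b : ℝ → E) : primitive T b ⟨0, le_rfl, hT⟩ = 0 := by
  by_cases hb : Integrable b (timeMeasure T)
  · rw [primitive_apply hb, intervalIntegral.integral_same]
  · rw [primitive, dif_neg hb, ContinuousMap.zero_apply]

/-- The embedding of the continuous functions on `[0, T]` into `L^p`. -/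
def extendLp (hT : 0 ≤ T) (E : Type*) [NormedAddCommGroup E] [NormedSpace ℝ E] (p : ENNReal)
    [Fact (1 ≤ p)] : C(Icc 0 T, E) →L[ℝ] Lp E p (timeMeasure T) :=
  LinearMap.mkContinuous
    { toFun := fun x => (memLp_IccExtend hT x p).toLp
      map_add' := fun x y => by
        rw [← MemLp.toLp_add]; rfl
      map_smul' := fun r x => by
        rw [RingHom.id_apply, ← MemLp.toLp_const_smul]; rfl }
    ((measureUnivNNReal (timeMeasure T) : ℝ) ^ p.toReal⁻¹)
    fun x => by
      refine Lp.norm_le_of_ae_bound (norm_nonneg x) ?_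
      filter_upwards [(memLp_IccExtend hT x p).coeFn_toLp] with t ht
      simp only [LinearMap.coe_mk, AddHom.coe_mk, ht]
      exact norm_IccExtend_le hT x t

theorem coeFn_extendLp (hT : 0 ≤ T) (p : ENNReal) [Fact (1 ≤ p)] (x : C(Icc 0 T, E)) :
    extendLp hT E p x =ᵐ[timeMeasure T] IccExtend hT x :=
  (memLp_IccExtend hT x p).coeFn_toLp

/-- The pair of the endpoint values of a continuous function on `[0, T]`. -/
def endpointsL (hT : 0 ≤ T) (E : Type*) [NormedAddCommGroup E]
    [NormedSpace ℝ E] :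
    C(Icc 0 T, E) →L[ℝ] E × E :=
  (ContinuousMap.evalCLM ℝ (⟨0, le_rfl, hT⟩ : Icc 0 T)).prod
    (ContinuousMap.evalCLM ℝ (⟨T, hT, le_rfl⟩ : Icc 0 T))

theorem endpointsL_apply (hT : 0 ≤ T) (x : C(Icc 0 T, E)) :
    endpointsL hT E x = (x ⟨0, le_rfl, hT⟩, x ⟨T, hT, le_rfl⟩) := rfl

theorem norm_endpointsL_le (hT : 0 ≤ T) (x : C(Icc 0 T, E)) : ‖endpointsL hT E x‖ ≤ ‖x‖ :=
  max_le (x.norm_coe_le_norm _) (x.norm_coe_le_norm _)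

end Primitive

section Lebesgue

variable {α : Type*} [MeasurableSpace α] {μ : Measure α}

theorem ae_norm_le_norm_Lp_top {F : Type*} [NormedAddCommGroup F] (A : Lp F ⊤ μ) :
    ∀ᵐ a ∂μ, ‖A a‖ ≤ ‖A‖ := by
  filter_upwards [ae_le_eLpNormEssSup (f := A) (μ := μ)] with a ha
  rw [Lp.norm_def, eLpNorm_exponent_top, ← toReal_enorm]
  refine ENNReal.toReal_mono ?_ ha
  rw [← eLpNorm_exponent_top]
  exact (Lp.memLp A).2.ne

theorem memLp_continuous_comp_of_bounded [IsFiniteMeasure μ] {W Y : Type*} [NormedAddCommGroup W]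
    [ProperSpace W] [NormedAddCommGroup Y] {G : W → Y} (hG : Continuous G) {f : α → W}
    (hf : AEStronglyMeasurable f μ) {M : ℝ} (hM : ∀ᵐ a ∂μ, ‖f a‖ ≤ M) (p : ENNReal) :
    MemLp (fun a => G (f a)) p μ := by
  obtain ⟨K, hK⟩ := (isCompact_closedBall (0 : W) M).exists_bound_of_continuousOn hG.continuousOn
  refine MemLp.of_bound (hG.comp_aestronglyMeasurable hf) K ?_
  filter_upwards [hM] with a ha
  exact hK _ (mem_closedBall_zero_iff.2 ha)

variable {X Y : Type*} [NormedAddCommGroup X] [NormedSpace ℝ X] [NormedAddCommGroup Y]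
  [NormedSpace ℝ Y] (p q r : ENNReal) [Fact (1 ≤ p)] [Fact (1 ≤ q)] [Fact (1 ≤ r)]
  [ENNReal.HolderTriple p q r]

/-- The pointwise application of a function with values in the continuous linear maps, as a
bilinear map on `L^p` spaces. -/
def applyLp : Lp (X →L[ℝ] Y) p μ →L[ℝ] Lp X q μ →L[ℝ] Lp Y r μ :=
  (ContinuousLinearMap.id ℝ (X →L[ℝ] Y)).holderL μ p q r

theorem coeFn_applyLp (L : Lp (X →L[ℝ] Y) p μ) (f : Lp X q μ) :
    applyLp p q r L f =ᵐ[μ] fun a => L a (f a) :=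
  ContinuousLinearMap.coeFn_holder (r := r) (ContinuousLinearMap.id ℝ (X →L[ℝ] Y)) L f

end Lebesgue

section Volterra

variable {E : Type*} [NormedAddCommGroup E] [NormedSpace ℝ E] {T : ℝ}

/-- The Volterra operator `x ↦ ∫₀ᵗ A x` with bounded measurable coefficient `A`. -/
def volterra (hT : 0 ≤ T) (A : Lp (E →L[ℝ] E) ⊤ (timeMeasure T)) :
    C(Icc 0 T, E) →L[ℝ] C(Icc 0 T, E) :=
  primitiveL T E ∘L applyLp ⊤ 1 1 A ∘L extendLp hT E 1

theorem coeFn_applyLp_extendLp (hT : 0 ≤ T) (A : Lp (E →L[ℝ] E) ⊤ (timeMeasure T))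
    (x : C(Icc 0 T, E)) :
    applyLp ⊤ 1 1 A (extendLp hT E 1 x) =ᵐ[timeMeasure T] fun t => A t (IccExtend hT x t) := by
  filter_upwards [coeFn_applyLp ⊤ 1 1 A (extendLp hT E 1 x), coeFn_extendLp hT 1 x]
    with t happly hextend
  rw [happly, hextend]

theorem integrable_volterra (hT : 0 ≤ T) (A : Lp (E →L[ℝ] E) ⊤ (timeMeasure T))
    (x : C(Icc 0 T, E)) : Integrable (fun t => A t (IccExtend hT x t)) (timeMeasure T) :=
  (L1.integrable_coeFn _).congr (coeFn_applyLp_extendLp hT A x)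

theorem volterra_eq_primitive (hT : 0 ≤ T) (A : Lp (E →L[ℝ] E) ⊤ (timeMeasure T))
    (x : C(Icc 0 T, E)) : volterra hT A x = primitive T (fun t => A t (IccExtend hT x t)) :=
  primitive_congr (coeFn_applyLp_extendLp hT A x)

theorem norm_volterra_pow_apply_le (hT : 0 ≤ T) (A : Lp (E →L[ℝ] E) ⊤ (timeMeasure T)) (k : ℕ)
    (x : C(Icc 0 T, E)) (t : Icc 0 T) :
    ‖(volterra hT A ^ k) x t‖ ≤ (‖A‖ * t) ^ k / k.factorial * ‖x‖ := by
  induction k generalizing t with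
  | zero => simpa using x.norm_coe_le_norm t
  | succ k ih =>
    rw [pow_succ', mul_apply_eq_comp, volterra_eq_primitive,
      primitive_apply (integrable_volterra hT A _)]
    have hA := (ae_restrict_iff' measurableSet_Icc).1 (ae_norm_le_norm_Lp_top A)
    have hle : ‖∫ s in (0 : ℝ)..t, A s (IccExtend hT ((volterra hT A ^ k) x) s)‖ ≤
        ∫ s in (0 : ℝ)..t, ‖A‖ * ((‖A‖ * s) ^ k / k.factorial * ‖x‖) := by
      refine intervalIntegral.norm_integral_le_of_norm_le t.2.1 ?_ ?_
      · filter_upwards [hA] with s hs hst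
        have hs' : s ∈ Icc 0 T := ⟨hst.1.le, hst.2.trans t.2.2⟩
        refine (ContinuousLinearMap.le_opNorm _ _).trans ?_
        rw [IccExtend_apply_of_mem hT _ hs']
        exact mul_le_mul (hs hs') (ih ⟨s, hs'⟩) (norm_nonneg _) (norm_nonneg _)
      · exact Continuous.intervalIntegrable (by fun_prop) _ _
    refine hle.trans (le_of_eq ?_)
    have hmonomial : (fun s : ℝ => ‖A‖ * ((‖A‖ * s) ^ k / k.factorial * ‖x‖)) =
        fun s => (‖A‖ ^ (k + 1) / k.factorial * ‖x‖) * s ^ k := by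
      funext s; ring
    rw [hmonomial, intervalIntegral.integral_const_mul, integral_pow, Nat.factorial_succ]
    push_cast
    rw [mul_pow]
    field_simp
    simp

theorem isUnit_one_sub_volterra (hT : 0 ≤ T) [CompleteSpace E]
    (A : Lp (E →L[ℝ] E) ⊤ (timeMeasure T)) :
    IsUnit (1 - volterra hT A) := by
  obtain ⟨k, hk⟩ : ∃ k : ℕ, (‖A‖ * T) ^ k / k.factorial < 1 :=
    ((FloorSemiring.tendsto_pow_div_factorial_atTop (‖A‖ * T)).eventually
      (gt_mem_nhds zero_lt_one)).exists
  have hnorm : ‖volterra hT A ^ k‖ < 1 := by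
    refine lt_of_le_of_lt ?_ hk
    have h0 : 0 ≤ (‖A‖ * T) ^ k / (k.factorial : ℝ) := by positivity
    refine ContinuousLinearMap.opNorm_le_bound _ h0 fun x => ?_
    rw [ContinuousMap.norm_le _ (by positivity)]
    intro t
    refine (norm_volterra_pow_apply_le hT A k x t).trans ?_
    have := t.2.1
    have := t.2.2
    gcongr
  have hu : IsUnit (1 - volterra hT A ^ k) :=
    isUnit_one_sub_of_norm_lt_one (R := C(Icc 0 T, E) →L[ℝ] C(Icc 0 T, E)) hnorm
  have hcomm : Commute (1 - volterra hT A) (∑ i ∈ Finset.range k, volterra hT A ^ i) :=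
    Commute.sum_right _ _ _ fun i _ =>
      ((Commute.one_left _).sub_left (Commute.refl _)).pow_right i
  rw [← mul_neg_geom_sum] at hu
  exact (hcomm.isUnit_mul_iff.1 hu).1

/-- The solution operator `y ↦ x` of the linear Volterra equation `x(t) = y(t) + ∫₀ᵗ A x`. -/
def volterraResolvent (hT : 0 ≤ T) (A : Lp (E →L[ℝ] E) ⊤ (timeMeasure T)) :
    C(Icc 0 T, E) →L[ℝ] C(Icc 0 T, E) :=
  Ring.inverse (1 - volterra hT A)

variable [CompleteSpace E]

theorem volterraResolvent_eq (hT : 0 ≤ T) (A : Lp (E →L[ℝ] E) ⊤ (timeMeasure T))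
    (y : C(Icc 0 T, E)) :
    volterraResolvent hT A y = y + volterra hT A (volterraResolvent hT A y) :=
  sub_eq_iff_eq_add.1
    (DFunLike.congr_fun (Ring.mul_inverse_cancel _ (isUnit_one_sub_volterra hT A)) y)

theorem eq_volterraResolvent (hT : 0 ≤ T) (A : Lp (E →L[ℝ] E) ⊤ (timeMeasure T))
    {x y : C(Icc 0 T, E)} (h : x = y + volterra hT A x) : x = volterraResolvent hT A y := by
  have hinv : volterraResolvent hT A (x - volterra hT A x) = x :=
    DFunLike.congr_fun (Ring.inverse_mul_cancel _ (isUnit_one_sub_volterra hT A)) x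
  rwa [sub_eq_iff_eq_add.2 h, eq_comm] at hinv

end Volterra

/-- A bounded trajectory `(x, c)` on `[0, T]` of a control system `ẋ = F (x, c)`, around which the
system is expanded. The controls enter through a single variable `c`. -/
structure ReferenceTrajectory (E C : Type*) [NormedAddCommGroup E] [NormedSpace ℝ E]
    [NormedAddCommGroup C] [NormedSpace ℝ C] (T : ℝ) where
  nonneg : 0 ≤ T
  F : E × C → E
  contDiff : ContDiff ℝ 2 F
  x : C(Icc 0 T, E)
  c : ℝ → C
  measurable_c : AEStronglyMeasurable c (timeMeasure T)
  bounded_c : ∃ M : ℝ, ∀ᵐ t ∂timeMeasure T, ‖c t‖ ≤ M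
  x_eq : x = ContinuousMap.const _ (x ⟨0, le_rfl, nonneg⟩) +
    primitive T (fun t => F (IccExtend nonneg x t, c t))

namespace ReferenceTrajectory

variable {E C : Type*} [NormedAddCommGroup E] [NormedSpace ℝ E] [NormedAddCommGroup C]
  [NormedSpace ℝ C] {T : ℝ} (R : ReferenceTrajectory E C T)

/-- The value `(x t, c t)` of the reference trajectory. -/
def pt (t : ℝ) : E × C := (IccExtend R.nonneg R.x t, R.c t)

theorem aestronglyMeasurable_pt : AEStronglyMeasurable R.pt (timeMeasure T) :=
  (aestronglyMeasurable_IccExtend R.nonneg R.x).prodMk R.measurable_c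

theorem exists_bound_pt : ∃ M : ℝ, 0 ≤ M ∧ ∀ᵐ t ∂timeMeasure T, ‖R.pt t‖ ≤ M := by
  obtain ⟨M, hM⟩ := R.bounded_c
  refine ⟨max ‖R.x‖ M, le_max_of_le_left (norm_nonneg _), ?_⟩
  filter_upwards [hM] with t ht
  exact max_le_max (norm_IccExtend_le _ _ _) ht

theorem continuous_fderiv : Continuous (fderiv ℝ R.F) :=
  R.contDiff.continuous_fderiv (by norm_num)

theorem contDiff_fderiv : ContDiff ℝ 1 (fderiv ℝ R.F) :=
  R.contDiff.fderiv_right (by norm_num)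

theorem continuous_fderiv_fderiv : Continuous (fderiv ℝ (fderiv ℝ R.F)) :=
  R.contDiff_fderiv.continuous_fderiv (by norm_num)

variable [FiniteDimensional ℝ E] [FiniteDimensional ℝ C]

theorem memLp_comp_pt {Y : Type*} [NormedAddCommGroup Y] {G : E × C → Y} (hG : Continuous G)
    (p : ENNReal) : MemLp (fun t => G (R.pt t)) p (timeMeasure T) := by
  obtain ⟨M, -, hM⟩ := R.exists_bound_pt
  have := FiniteDimensional.proper ℝ (E × C)
  exact memLp_continuous_comp_of_bounded hG R.aestronglyMeasurable_pt hM p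

theorem memLp_fderiv_comp {X : Type*} [NormedAddCommGroup X] [NormedSpace ℝ X]
    (L : X →L[ℝ] E × C) (p : ENNReal) :
    MemLp (fun t => (fderiv ℝ R.F (R.pt t)).comp L) p (timeMeasure T) :=
  R.memLp_comp_pt (G := fun w => (fderiv ℝ R.F w).comp L)
    (R.continuous_fderiv.clm_comp continuous_const) p

/-- The coefficient `F_x` of the linearized equation. -/
def stateCoeff : Lp (E →L[ℝ] E) ⊤ (timeMeasure T) :=
  (R.memLp_fderiv_comp (ContinuousLinearMap.inl ℝ E C) ⊤).toLp

/-- The coefficient `F_c` of the linearized equation. -/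
def controlCoeff : Lp (C →L[ℝ] E) 2 (timeMeasure T) :=
  (R.memLp_fderiv_comp (ContinuousLinearMap.inr ℝ E C) 2).toLp

/-- The second derivative of `F` along the reference trajectory. -/
def hessianCoeff : Lp (E × C →L[ℝ] E × C →L[ℝ] E) ⊤ (timeMeasure T) :=
  (R.memLp_comp_pt R.continuous_fderiv_fderiv ⊤).toLp

theorem coeFn_stateCoeff : R.stateCoeff =ᵐ[timeMeasure T]
    fun t => (fderiv ℝ R.F (R.pt t)).comp (ContinuousLinearMap.inl ℝ E C) :=
  MemLp.coeFn_toLp _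

theorem coeFn_controlCoeff : R.controlCoeff =ᵐ[timeMeasure T]
    fun t => (fderiv ℝ R.F (R.pt t)).comp (ContinuousLinearMap.inr ℝ E C) :=
  MemLp.coeFn_toLp _

theorem coeFn_hessianCoeff :
    R.hessianCoeff =ᵐ[timeMeasure T] fun t => fderiv ℝ (fderiv ℝ R.F) (R.pt t) :=
  MemLp.coeFn_toLp _

/-- The forcing term `F_c c` of the linearized equation. -/
def forcing : Lp C 2 (timeMeasure T) →L[ℝ] Lp E 1 (timeMeasure T) :=
  applyLp 2 2 1 R.controlCoeff

theorem coeFn_forcing (c : Lp C 2 (timeMeasure T)) : R.forcing c =ᵐ[timeMeasure T]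
    fun t => fderiv ℝ R.F (R.pt t) (0, c t) := by
  filter_upwards [coeFn_applyLp 2 2 1 R.controlCoeff c, R.coeFn_controlCoeff] with t happly hcoeff
  rw [forcing, happly, hcoeff]; rfl

/-- The state of the linearized system with given initial value and control. -/
def linearizedState : E × Lp C 2 (timeMeasure T) →L[ℝ] C(Icc 0 T, E) :=
  volterraResolvent R.nonneg R.stateCoeff ∘L
    (ContinuousLinearMap.const ℝ (Icc 0 T) ∘L ContinuousLinearMap.fst ℝ _ _ +
      primitiveL T E ∘L R.forcing ∘L ContinuousLinearMap.snd ℝ _ _)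

theorem coeFn_stateCoeff_apply (x : C(Icc 0 T, E)) :
    (fun t => R.stateCoeff t (IccExtend R.nonneg x t)) =ᵐ[timeMeasure T]
      fun t => fderiv ℝ R.F (R.pt t) (IccExtend R.nonneg x t, 0) := by
  filter_upwards [R.coeFn_stateCoeff] with t ht
  rw [ht]; rfl

theorem volterra_stateCoeff_eq (x : C(Icc 0 T, E)) : volterra R.nonneg R.stateCoeff x =
    primitive T (fun t => fderiv ℝ R.F (R.pt t) (IccExtend R.nonneg x t, 0)) := by
  rw [volterra_eq_primitive, primitive_congr (R.coeFn_stateCoeff_apply x)]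

theorem integrable_stateCoeff (x : C(Icc 0 T, E)) :
    Integrable (fun t => fderiv ℝ R.F (R.pt t) (IccExtend R.nonneg x t, 0)) (timeMeasure T) :=
  (integrable_volterra R.nonneg R.stateCoeff x).congr (R.coeFn_stateCoeff_apply x)

theorem integrable_forcing (c : Lp C 2 (timeMeasure T)) :
    Integrable (fun t => fderiv ℝ R.F (R.pt t) (0, c t)) (timeMeasure T) :=
  (L1.integrable_coeFn _).congr (R.coeFn_forcing c)

theorem integrable_linearized (x : C(Icc 0 T, E)) (c : Lp C 2 (timeMeasure T)) :
    Integrable (fun t => fderiv ℝ R.F (R.pt t) (IccExtend R.nonneg x t, c t)) (timeMeasure T) := by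
  refine ((R.integrable_stateCoeff x).add (R.integrable_forcing c)).congr
    (Eventually.of_forall fun t => ?_)
  simp only [Pi.add_apply]
  rw [← map_add]; simp

theorem primitive_linearized (x : C(Icc 0 T, E)) (c : Lp C 2 (timeMeasure T)) :
    primitive T (fun t => fderiv ℝ R.F (R.pt t) (IccExtend R.nonneg x t, c t)) =
      primitiveL T E (R.forcing c) + volterra R.nonneg R.stateCoeff x := by
  rw [volterra_stateCoeff_eq, primitiveL_apply, primitive_congr (R.coeFn_forcing c),
    ← primitive_add (R.integrable_forcing c) (R.integrable_stateCoeff x)]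
  congr 1
  funext t
  rw [← map_add]; simp

theorem linearizedState_eq (q : E × Lp C 2 (timeMeasure T)) :
    R.linearizedState q = ContinuousMap.const _ q.1 + primitive T
      (fun t => fderiv ℝ R.F (R.pt t) (IccExtend R.nonneg (R.linearizedState q) t, q.2 t)) := by
  have := FiniteDimensional.complete ℝ E
  rw [primitive_linearized, ← add_assoc]
  exact volterraResolvent_eq R.nonneg R.stateCoeff _

theorem eq_linearizedState {x : C(Icc 0 T, E)} {ξ : E} {c : Lp C 2 (timeMeasure T)}
    (h : x = ContinuousMap.const _ ξ + primitive T
      (fun t => fderiv ℝ R.F (R.pt t) (IccExtend R.nonneg x t, c t))) :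
    x = R.linearizedState (ξ, c) := by
  have := FiniteDimensional.complete ℝ E
  rw [primitive_linearized, ← add_assoc] at h
  exact eq_volterraResolvent R.nonneg R.stateCoeff h

/-- The pair of the linearized state and the control, as a square integrable function. -/
def linearizedPair : E × Lp C 2 (timeMeasure T) →L[ℝ] Lp (E × C) 2 (timeMeasure T) :=
  (ContinuousLinearMap.inl ℝ E C).compLpL 2 (timeMeasure T) ∘L extendLp R.nonneg E 2 ∘L
      R.linearizedState +
    (ContinuousLinearMap.inr ℝ E C).compLpL 2 (timeMeasure T) ∘L ContinuousLinearMap.snd ℝ _ _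

theorem coeFn_linearizedPair (q : E × Lp C 2 (timeMeasure T)) :
    R.linearizedPair q =ᵐ[timeMeasure T]
      fun t => (IccExtend R.nonneg (R.linearizedState q) t, q.2 t) := by
  let x := extendLp R.nonneg E 2 (R.linearizedState q)
  have hadd := Lp.coeFn_add ((ContinuousLinearMap.inl ℝ E C).compLpL 2 (timeMeasure T) x)
    ((ContinuousLinearMap.inr ℝ E C).compLpL 2 (timeMeasure T) q.2)
  filter_upwards [hadd, (ContinuousLinearMap.inl ℝ E C).coeFn_compLpL x,
    (ContinuousLinearMap.inr ℝ E C).coeFn_compLpL q.2,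
    coeFn_extendLp R.nonneg 2 (R.linearizedState q)] with t hsum hinl hinr hextend
  refine hsum.trans ?_
  rw [Pi.add_apply, hinl, hinr, hextend, ContinuousLinearMap.inl_apply,
    ContinuousLinearMap.inr_apply, Prod.mk_add_mk, add_zero, zero_add]

/-- The quadratic term `D²F (x, c)²` of the expansion of the dynamics. -/
def quadraticTerm (q : E × Lp C 2 (timeMeasure T)) : Lp E 1 (timeMeasure T) :=
  applyLp 2 2 1 (applyLp ⊤ 2 2 R.hessianCoeff (R.linearizedPair q)) (R.linearizedPair q)

theorem continuous_quadraticTerm : Continuous R.quadraticTerm := by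
  unfold quadraticTerm
  fun_prop

theorem coeFn_quadraticTerm (q : E × Lp C 2 (timeMeasure T)) : R.quadraticTerm q =ᵐ[timeMeasure T]
    fun t => fderiv ℝ (fderiv ℝ R.F) (R.pt t) (IccExtend R.nonneg (R.linearizedState q) t, q.2 t)
      (IccExtend R.nonneg (R.linearizedState q) t, q.2 t) := by
  filter_upwards [coeFn_applyLp ⊤ 2 2 R.hessianCoeff (R.linearizedPair q),
    coeFn_applyLp 2 2 1 (applyLp ⊤ 2 2 R.hessianCoeff (R.linearizedPair q)) (R.linearizedPair q),
    R.coeFn_linearizedPair q, R.coeFn_hessianCoeff] with t hinner houter hpair hhessian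
  rw [quadraticTerm, houter, hinner, hpair, hhessian]

/-- The second order correction of the state: the solution with initial value zero of the
linearized equation with forcing term `1/2 D²F (x, c)²`. -/
def secondOrderState (q : E × Lp C 2 (timeMeasure T)) : C(Icc 0 T, E) :=
  volterraResolvent R.nonneg R.stateCoeff (primitiveL T E ((1 / 2 : ℝ) • R.quadraticTerm q))

theorem continuous_secondOrderState : Continuous R.secondOrderState :=
  (volterraResolvent R.nonneg R.stateCoeff).continuous.comp
    ((primitiveL T E).continuous.comp
      ((continuous_const_smul (1 / 2 : ℝ)).comp R.continuous_quadraticTerm))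

theorem integrable_quadraticTerm (q : E × Lp C 2 (timeMeasure T)) : Integrable
    (fun t => (1 / 2 : ℝ) • fderiv ℝ (fderiv ℝ R.F) (R.pt t)
      (IccExtend R.nonneg (R.linearizedState q) t, q.2 t)
      (IccExtend R.nonneg (R.linearizedState q) t, q.2 t)) (timeMeasure T) :=
  ((L1.integrable_coeFn _).congr (R.coeFn_quadraticTerm q)).smul _

theorem secondOrderState_eq (q : E × Lp C 2 (timeMeasure T)) : R.secondOrderState q = primitive T
    (fun t => fderiv ℝ R.F (R.pt t) (IccExtend R.nonneg (R.secondOrderState q) t, 0) +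
      (1 / 2 : ℝ) • fderiv ℝ (fderiv ℝ R.F) (R.pt t)
        (IccExtend R.nonneg (R.linearizedState q) t, q.2 t)
        (IccExtend R.nonneg (R.linearizedState q) t, q.2 t)) := by
  have := FiniteDimensional.complete ℝ E
  rw [primitive_add (R.integrable_stateCoeff _) (R.integrable_quadraticTerm q),
    ← volterra_stateCoeff_eq, add_comm]
  refine (volterraResolvent_eq R.nonneg R.stateCoeff _).trans ?_
  congr 1
  rw [primitiveL_apply]
  refine primitive_congr ?_
  filter_upwards [Lp.coeFn_smul (1 / 2 : ℝ) (R.quadraticTerm q), R.coeFn_quadraticTerm q]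
    with t hsmul hquad
  rw [hsmul, Pi.smul_apply, hquad]

theorem linearizedState_zero (q : E × Lp C 2 (timeMeasure T)) :
    R.linearizedState q ⟨0, le_rfl, R.nonneg⟩ = q.1 := by
  rw [linearizedState_eq, ContinuousMap.add_apply, primitive_zero R.nonneg]; simp

theorem secondOrderState_zero (q : E × Lp C 2 (timeMeasure T)) :
    R.secondOrderState q ⟨0, le_rfl, R.nonneg⟩ = 0 := by
  rw [secondOrderState_eq, primitive_zero R.nonneg]

end ReferenceTrajectory

section Taylor

variable {X Y : Type*} [NormedAddCommGroup X] [NormedSpace ℝ X] [NormedAddCommGroup Y]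
  [NormedSpace ℝ Y]

theorem hasFDerivAt_half_smul_diag {D : X →L[ℝ] X →L[ℝ] Y} (hD : ∀ a b, D a b = D b a) (k : X) :
    HasFDerivAt (fun k => (1 / 2 : ℝ) • D k k) (D k) k := by
  have hdiag : HasFDerivAt (fun k => D k k) _ k := D.hasFDerivAt.clm_apply (hasFDerivAt_id k)
  convert! hdiag.const_smul (1 / 2 : ℝ) using 1
  ext v
  change D k v = (1 / 2 : ℝ) • (D k v + D v k)
  rw [hD v k, ← two_smul ℝ, smul_smul]
  norm_num

theorem norm_smul_add_sq_smul_le {a b : X} {K s : ℝ} (ha : ‖a‖ ≤ K) (hb : ‖b‖ ≤ K) (hs : 0 ≤ s)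
    (hs1 : s ≤ 1) : ‖s • a + s ^ 2 • b‖ ≤ 2 * K * s := by
  have : 0 ≤ K := (norm_nonneg a).trans ha
  calc ‖s • a + s ^ 2 • b‖ ≤ s * ‖a‖ + s ^ 2 * ‖b‖ := by
        refine (norm_add_le _ _).trans_eq ?_
        rw [norm_smul, norm_smul, norm_pow, Real.norm_of_nonneg hs]
    _ ≤ s * K + s * K := by
        have : s ^ 2 ≤ s := by nlinarith
        gcongr
    _ = 2 * K * s := by ring

theorem norm_diag_sub_sq_smul_diag_le (D : X →L[ℝ] X →L[ℝ] Y) {a b : X} {K s : ℝ}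
    (ha : ‖a‖ ≤ K) (hb : ‖b‖ ≤ K) (hs : 0 ≤ s) (hs1 : s ≤ 1) :
    ‖D (s • a + s ^ 2 • b) (s • a + s ^ 2 • b) - s ^ 2 • D a a‖ ≤ 3 * ‖D‖ * K ^ 2 * s ^ 3 := by
  have : 0 ≤ K := (norm_nonneg a).trans ha
  have hsplit : D (s • a + s ^ 2 • b) (s • a + s ^ 2 • b) - s ^ 2 • D a a =
      s ^ 2 • D b (s • a + s ^ 2 • b) + s ^ 3 • D a b := by
    simp only [map_add, map_smul, add_apply, smul_apply]
    module
  calc _ ≤ s ^ 2 * ‖D b (s • a + s ^ 2 • b)‖ + s ^ 3 * ‖D a b‖ := by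
        rw [hsplit]
        refine (norm_add_le _ _).trans_eq ?_
        rw [norm_smul, norm_smul, norm_pow, norm_pow, Real.norm_of_nonneg hs]
    _ ≤ s ^ 2 * (‖D‖ * K * (2 * K * s)) + s ^ 3 * (‖D‖ * K * K) := by
        gcongr
        · exact D.le_of_opNorm₂_le_of_le le_rfl hb (norm_smul_add_sq_smul_le ha hb hs hs1)
        · exact D.le_of_opNorm₂_le_of_le le_rfl ha hb
    _ = 3 * ‖D‖ * K ^ 2 * s ^ 3 := by ring

variable [FiniteDimensional ℝ X]

theorem exists_uniform_strict_approx {f : X → Y} (hf : ContDiff ℝ 1 f) (M : ℝ) {ε : ℝ}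
    (hε : 0 < ε) :
    ∃ δ > 0, ∀ w, ‖w‖ ≤ M → ∀ a ∈ Metric.closedBall w δ, ∀ b ∈ Metric.closedBall w δ,
      ‖f a - f b - fderiv ℝ f w (a - b)‖ ≤ ε * ‖a - b‖ := by
  have := FiniteDimensional.proper ℝ X
  have hc : Continuous (fderiv ℝ f) := hf.continuous_fderiv (by norm_num)
  obtain ⟨δ, hδ, huniform⟩ := Metric.uniformContinuousOn_iff.1
    ((isCompact_closedBall (0 : X) (M + 1)).uniformContinuousOn_of_continuous hc.continuousOn) ε hε
  refine ⟨min (δ / 2) 1, by positivity, fun w hw a ha b hb => ?_⟩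
  refine Convex.norm_image_sub_le_of_norm_fderiv_le' (𝕜 := ℝ)
    (s := Metric.closedBall w (min (δ / 2) 1))
    (fun z _ => hf.differentiable (by norm_num) z) (fun z hz => ?_) (convex_closedBall _ _) hb ha
  have hz' : dist z w ≤ min (δ / 2) 1 := hz
  have hzM : ‖z‖ ≤ M + 1 := by
    have := norm_le_norm_add_norm_sub' z w
    rw [dist_eq_norm] at hz'
    linarith [min_le_right (δ / 2) 1]
  rw [← dist_eq_norm]
  refine (huniform z (mem_closedBall_zero_iff.2 hzM) w
    (mem_closedBall_zero_iff.2 (by linarith)) ?_).le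
  linarith [min_le_left (δ / 2) 1]

theorem exists_uniform_taylor_two {f : X → Y} (hf : ContDiff ℝ 2 f) (M : ℝ) {ε : ℝ} (hε : 0 < ε) :
    ∃ δ > 0, ∀ w, ‖w‖ ≤ M → ∀ h, ‖h‖ ≤ δ →
      ‖f (w + h) - f w - fderiv ℝ f w h - (1 / 2 : ℝ) • fderiv ℝ (fderiv ℝ f) w h h‖ ≤
        ε * ‖h‖ ^ 2 := by
  have hf' : ContDiff ℝ 1 (fderiv ℝ f) := hf.fderiv_right (by norm_num)
  obtain ⟨δ, hδ, happrox⟩ := exists_uniform_strict_approx hf' M hε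
  refine ⟨δ, hδ, fun w hw h hh => ?_⟩
  set D := fderiv ℝ (fderiv ℝ f) w
  let r : X → Y := fun k => f (w + k) - fderiv ℝ f w k - (1 / 2 : ℝ) • D k k
  have hder : ∀ k, HasFDerivAt r (fderiv ℝ f (w + k) - fderiv ℝ f w - D k) k := fun k =>
    (((hasFDerivAt_comp_add_left w).2 (hf.differentiable (by norm_num) (w + k)).hasFDerivAt).sub
      (fderiv ℝ f w).hasFDerivAt).sub
      (hasFDerivAt_half_smul_diag (hf.contDiffAt.isSymmSndFDerivAt (by simp)) k)
  have hder_le : ∀ k ∈ Metric.closedBall (0 : X) ‖h‖,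
      ‖fderiv ℝ f (w + k) - fderiv ℝ f w - D k‖ ≤ ε * ‖h‖ := fun k hk => by
    have hk' : ‖k‖ ≤ ‖h‖ := mem_closedBall_zero_iff.1 hk
    have := happrox w hw (w + k) (by simpa using hk'.trans hh) w (by simpa using hδ.le)
    rw [add_sub_cancel_left] at this
    exact this.trans (by gcongr)
  have hmv := Convex.norm_image_sub_le_of_norm_hasFDerivWithin_le (𝕜 := ℝ) (x := 0) (y := h)
    (fun k _ => (hder k).hasFDerivWithinAt) hder_le (convex_closedBall _ _) (by simp) (by simp)
  calc _ = ‖r h - r 0‖ := by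
        congr 1
        simp only [r, add_zero, map_zero, smul_zero, sub_zero]
        abel
    _ ≤ ε * ‖h‖ * ‖h - 0‖ := hmv
    _ = ε * ‖h‖ ^ 2 := by rw [sub_zero]; ring

theorem exists_uniform_taylor_parabola {f : X → Y} (hf : ContDiff ℝ 2 f) (M K : ℝ) {ε : ℝ}
    (hε : 0 < ε) :
    ∃ δ > 0, ∀ w, ‖w‖ ≤ M → ∀ a, ‖a‖ ≤ K → ∀ b, ‖b‖ ≤ K → ∀ s, 0 ≤ s → s ≤ δ →
      ‖f (w + (s • a + s ^ 2 • b)) - f w - s • fderiv ℝ f w a -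
        s ^ 2 • (fderiv ℝ f w b + (1 / 2 : ℝ) • fderiv ℝ (fderiv ℝ f) w a a)‖ ≤ ε * s ^ 2 := by
  have := FiniteDimensional.proper ℝ X
  wlog hK : 0 < K generalizing K
  · obtain ⟨δ, hδ, h⟩ := this 1 zero_lt_one
    have hK1 : K ≤ 1 := (not_lt.1 hK).trans zero_le_one
    exact ⟨δ, hδ, fun w hw a ha b hb => h w hw a (ha.trans hK1) b (hb.trans hK1)⟩
  have hc : Continuous (fderiv ℝ (fderiv ℝ f)) :=
    (hf.fderiv_right (m := 1) (by norm_num)).continuous_fderiv (by norm_num)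
  obtain ⟨N, hN, hbound⟩ : ∃ N > 0, ∀ w, ‖w‖ ≤ M → ‖fderiv ℝ (fderiv ℝ f) w‖ ≤ N := by
    obtain ⟨N, hN⟩ := (isCompact_closedBall (0 : X) M).exists_bound_of_continuousOn
      (E := X →L[ℝ] X →L[ℝ] Y) hc.continuousOn
    exact ⟨|N| + 1, by positivity, fun w hw =>
      (hN w (mem_closedBall_zero_iff.2 hw)).trans (by linarith [le_abs_self N])⟩
  obtain ⟨δ, hδ, htaylor⟩ := exists_uniform_taylor_two hf M (ε := ε / (8 * K ^ 2)) (by positivity)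
  refine ⟨min 1 (min (δ / (2 * K)) (ε / (3 * N * K ^ 2))), by positivity,
    fun w hw a ha b hb s hs hsδ => ?_⟩
  obtain ⟨hs1, hsδ', hsε⟩ : s ≤ 1 ∧ s ≤ δ / (2 * K) ∧ s ≤ ε / (3 * N * K ^ 2) := by
    simpa only [le_min_iff] using hsδ
  rw [le_div_iff₀ (by positivity)] at hsδ' hsε
  set D := fderiv ℝ (fderiv ℝ f) w
  set h := s • a + s ^ 2 • b with hh
  have hnorm : ‖h‖ ≤ 2 * K * s := norm_smul_add_sq_smul_le ha hb hs hs1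
  have hremainder : ‖f (w + h) - f w - fderiv ℝ f w h - (1 / 2 : ℝ) • D h h‖ ≤ ε / 2 * s ^ 2 :=
    calc _ ≤ ε / (8 * K ^ 2) * ‖h‖ ^ 2 := htaylor w hw h (hnorm.trans (by linarith))
      _ ≤ ε / (8 * K ^ 2) * (2 * K * s) ^ 2 := by gcongr
      _ = ε / 2 * s ^ 2 := by field_simp; ring
  have hdiag : ‖(1 / 2 : ℝ) • (D h h - s ^ 2 • D a a)‖ ≤ ε / 2 * s ^ 2 :=
    calc _ = 1 / 2 * ‖D h h - s ^ 2 • D a a‖ := by rw [norm_smul]; norm_num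
      _ ≤ 1 / 2 * (3 * ‖D‖ * K ^ 2 * s ^ 3) := by
        gcongr; exact norm_diag_sub_sq_smul_diag_le D ha hb hs hs1
      _ ≤ 1 / 2 * (3 * N * K ^ 2 * s ^ 3) := by gcongr; exact hbound w hw
      _ = 1 / 2 * (s * (3 * N * K ^ 2)) * s ^ 2 := by ring
      _ ≤ 1 / 2 * ε * s ^ 2 := by gcongr
      _ = ε / 2 * s ^ 2 := by ring
  calc _ = ‖(f (w + h) - f w - fderiv ℝ f w h - (1 / 2 : ℝ) • D h h) +
        (1 / 2 : ℝ) • (D h h - s ^ 2 • D a a)‖ := by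
        congr 1
        have hlin : fderiv ℝ f w h = s • fderiv ℝ f w a + s ^ 2 • fderiv ℝ f w b := by
          rw [hh, map_add, map_smul, map_smul]
        rw [hlin]
        module
    _ ≤ ε / 2 * s ^ 2 + ε / 2 * s ^ 2 := norm_add_le_of_le hremainder hdiag
    _ = ε * s ^ 2 := by ring

end Taylor

theorem exists_zero_near_of_surjective_approx {X Y : Type*} [NormedAddCommGroup X]
    [NormedSpace ℝ X] [CompleteSpace X] [NormedAddCommGroup Y] [NormedSpace ℝ Y] [CompleteSpace Y]
    (L : X →L[ℝ] Y) (hL : Function.Surjective L) :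
    ∃ c : ℝ, 0 < c ∧ ∃ K : ℝ, 0 < K ∧ ∀ (G : X → Y) (b : X) (ρ : ℝ),
      (∀ z ∈ Metric.closedBall b ρ, ∀ z' ∈ Metric.closedBall b ρ,
        ‖G z - G z' - L (z - z')‖ ≤ c * ‖z - z'‖) →
      K * ‖G b‖ ≤ ρ → ∃ z, G z = 0 ∧ ‖z - b‖ ≤ K * ‖G b‖ := by
  obtain ⟨S, hS⟩ := L.exists_nonlinearRightInverse_of_surjective (LinearMap.range_eq_top.2 hL)
  have : (0 : ℝ) < S.nnnorm := hS
  refine ⟨(S.nnnorm : ℝ)⁻¹ / 2, by positivity, 2 * S.nnnorm, by positivity,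
    fun G b ρ hG hρ => ?_⟩
  have happ : ApproximatesLinearOn G L (Metric.closedBall b ρ) (S.nnnorm⁻¹ / 2) :=
    fun z hz z' hz' => by
      simpa using hG z hz z' hz'
  have hsurj := happ.surjOn_closedBall_of_nonlinearRightInverse S
    (ε := 2 * S.nnnorm * ‖G b‖) (b := b) (by positivity) (Metric.closedBall_subset_closedBall hρ)
  have hmem : (0 : Y) ∈ Metric.closedBall (G b)
      (((S.nnnorm : ℝ)⁻¹ - ((S.nnnorm⁻¹ / 2 : NNReal) : ℝ)) * (2 * S.nnnorm * ‖G b‖)) := by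
    rw [Metric.mem_closedBall, dist_zero_left]
    refine le_of_eq ?_
    push_cast
    field_simp
    ring
  obtain ⟨z, hz, hz0⟩ := hsurj hmem
  exact ⟨z, hz0, by simpa [dist_eq_norm] using hz⟩

namespace ReferenceTrajectory

variable {E C : Type*} [NormedAddCommGroup E] [NormedSpace ℝ E] [NormedAddCommGroup C]
  [NormedSpace ℝ C] {T : ℝ} (R : ReferenceTrajectory E C T)

/-- The defect `x - ξ - ∫₀ᵗ F (x, c)` in the integrated state equation. -/
def defect (ξ : E) (x : C(Icc 0 T, E)) (c : ℝ → C) : C(Icc 0 T, E) :=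
  x - ContinuousMap.const _ ξ - primitive T (fun t => R.F (IccExtend R.nonneg x t, c t))

/-- The base curve of controls. -/
def curveControl (q₀ q₁ : E × Lp C 2 (timeMeasure T)) (s : ℝ) (t : ℝ) : C :=
  R.c t + (s • q₀.2 t + s ^ 2 • q₁.2 t)

theorem aestronglyMeasurable_curveControl (q₀ q₁ : E × Lp C 2 (timeMeasure T)) (s : ℝ) :
    AEStronglyMeasurable (R.curveControl q₀ q₁ s) (timeMeasure T) :=
  R.measurable_c.add (((Lp.aestronglyMeasurable q₀.2).const_smul s).add
    ((Lp.aestronglyMeasurable q₁.2).const_smul (s ^ 2)))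

theorem ae_norm_curveControl_sub_le {q₀ q₁ : E × Lp C 2 (timeMeasure T)} {M₀ M₁ s : ℝ}
    (h₀ : ∀ᵐ t ∂timeMeasure T, ‖q₀.2 t‖ ≤ M₀) (h₁ : ∀ᵐ t ∂timeMeasure T, ‖q₁.2 t‖ ≤ M₁)
    (hs : 0 ≤ s) :
    ∀ᵐ t ∂timeMeasure T, ‖R.curveControl q₀ q₁ s t - R.c t‖ ≤ s * M₀ + s ^ 2 * M₁ := by
  filter_upwards [h₀, h₁] with t ht₀ ht₁
  rw [curveControl, add_sub_cancel_left]
  refine norm_add_le_of_le ?_ ?_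
  · rw [norm_smul, Real.norm_of_nonneg hs]; gcongr
  · rw [norm_smul, Real.norm_of_nonneg (by positivity)]; gcongr

variable {Y : Type*} [NormedAddCommGroup Y] [NormedSpace ℝ Y] [FiniteDimensional ℝ E]

theorem exists_endpoint_strict_approx {H : E × E → Y} (hH : ContDiff ℝ 1 H) {κ : ℝ} (hκ : 0 < κ) :
    ∃ δ > 0, ∀ x x' : C(Icc 0 T, E), ‖x - R.x‖ ≤ δ → ‖x' - R.x‖ ≤ δ →
      ‖H (endpointsL R.nonneg E x) - H (endpointsL R.nonneg E x') -
        fderiv ℝ H (endpointsL R.nonneg E R.x) (endpointsL R.nonneg E (x - x'))‖ ≤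
          κ * ‖x - x'‖ := by
  obtain ⟨δ, hδ, happrox⟩ := exists_uniform_strict_approx hH ‖endpointsL R.nonneg E R.x‖ hκ
  refine ⟨δ, hδ, fun x x' hx hx' => ?_⟩
  have hmem : ∀ y : C(Icc 0 T, E), ‖y - R.x‖ ≤ δ →
      endpointsL R.nonneg E y ∈ Metric.closedBall (endpointsL R.nonneg E R.x) δ := fun y hy => by
    rw [mem_closedBall_iff_norm, ← map_sub]
    exact (norm_endpointsL_le _ _).trans hy
  have := happrox _ le_rfl _ (hmem x hx) _ (hmem x' hx')
  rw [← map_sub] at this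
  exact this.trans (by gcongr; exact norm_endpointsL_le _ _)

variable [FiniteDimensional ℝ C]

/-- The linearization at the reference trajectory of a function of the endpoints. -/
def linearization (H : E × E → Y) : E × Lp C 2 (timeMeasure T) →L[ℝ] Y :=
  fderiv ℝ H (endpointsL R.nonneg E R.x) ∘L endpointsL R.nonneg E ∘L R.linearizedState

/-- The second order term of the expansion of a function of the endpoints in the direction `q`. -/
def curvature (H : E × E → Y) (q : E × Lp C 2 (timeMeasure T)) : Y :=
  fderiv ℝ H (endpointsL R.nonneg E R.x) (endpointsL R.nonneg E (R.secondOrderState q)) +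
    (1 / 2 : ℝ) • fderiv ℝ (fderiv ℝ H) (endpointsL R.nonneg E R.x)
      (endpointsL R.nonneg E (R.linearizedState q)) (endpointsL R.nonneg E (R.linearizedState q))

theorem linearization_apply (H : E × E → Y) (q : E × Lp C 2 (timeMeasure T)) :
    R.linearization H q =
      fderiv ℝ H (endpointsL R.nonneg E R.x) (endpointsL R.nonneg E (R.linearizedState q)) := rfl

theorem continuous_curvature (H : E × E → Y) : Continuous (R.curvature H) := by
  unfold curvature
  have := R.continuous_secondOrderState
  fun_prop

/-- The constraints (state equation and endpoint equations `H = const`) for the unknown state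
and the parameter `y` of the correction `S y` of initial value and control. -/
def residual (H : E × E → Y) (S : Y →L[ℝ] E × Lp C 2 (timeMeasure T)) (ξ : E) (c : ℝ → C)
    (z : C(Icc 0 T, E) × Y) : C(Icc 0 T, E) × Y :=
  (R.defect (ξ + (S z.2).1) z.1 (fun t => c t + (S z.2).2 t),
    H (endpointsL R.nonneg E z.1) - H (endpointsL R.nonneg E R.x))

/-- The linearization of the constraints. -/
def residualDeriv (H : E × E → Y) (S : Y →L[ℝ] E × Lp C 2 (timeMeasure T)) :
    C(Icc 0 T, E) × Y →L[ℝ] C(Icc 0 T, E) × Y :=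
  ContinuousLinearMap.prod
    (ContinuousLinearMap.fst ℝ C(Icc 0 T, E) Y -
      volterra R.nonneg R.stateCoeff ∘L ContinuousLinearMap.fst ℝ C(Icc 0 T, E) Y -
      (ContinuousLinearMap.const ℝ (Icc 0 T) ∘L ContinuousLinearMap.fst ℝ _ _ +
        primitiveL T E ∘L R.forcing ∘L ContinuousLinearMap.snd ℝ _ _) ∘L S ∘L
          ContinuousLinearMap.snd ℝ C(Icc 0 T, E) Y)
    (fderiv ℝ H (endpointsL R.nonneg E R.x) ∘L endpointsL R.nonneg E ∘L
      ContinuousLinearMap.fst ℝ C(Icc 0 T, E) Y)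

theorem residualDeriv_apply (H : E × E → Y) (S : Y →L[ℝ] E × Lp C 2 (timeMeasure T))
    (z : C(Icc 0 T, E) × Y) : R.residualDeriv H S z =
      (z.1 - ContinuousMap.const _ (S z.2).1 - primitive T
        (fun t => fderiv ℝ R.F (R.pt t) (IccExtend R.nonneg z.1 t, (S z.2).2 t)),
        fderiv ℝ H (endpointsL R.nonneg E R.x) (endpointsL R.nonneg E z.1)) := by
  rw [primitive_linearized]
  refine Prod.ext ?_ rfl
  change z.1 - volterra R.nonneg R.stateCoeff z.1 - (ContinuousMap.const _ (S z.2).1 +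
    primitiveL T E (R.forcing (S z.2).2)) = _
  abel_nf

theorem surjective_residualDeriv {H : E × E → Y} {S : Y →L[ℝ] E × Lp C 2 (timeMeasure T)}
    (hS : ∀ y, R.linearization H (S y) = y) : Function.Surjective (R.residualDeriv H S) := by
  have := FiniteDimensional.complete ℝ E
  rintro ⟨g, η⟩
  set r := volterraResolvent R.nonneg R.stateCoeff g with hr
  set θ := η - fderiv ℝ H (endpointsL R.nonneg E R.x) (endpointsL R.nonneg E r) with hθ
  have hr_eq := volterraResolvent_eq R.nonneg R.stateCoeff g
  have hθ_eq : R.linearizedState (S θ) = (ContinuousMap.const _ (S θ).1 +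
      primitiveL T E (R.forcing (S θ).2)) +
        volterra R.nonneg R.stateCoeff (R.linearizedState (S θ)) :=
    volterraResolvent_eq R.nonneg R.stateCoeff _
  refine ⟨(r + R.linearizedState (S θ), θ), Prod.ext ?_ ?_⟩
  · change r + R.linearizedState (S θ) -
      volterra R.nonneg R.stateCoeff (r + R.linearizedState (S θ)) -
      (ContinuousMap.const _ (S θ).1 + primitiveL T E (R.forcing (S θ).2)) = g
    rw [← hr] at hr_eq
    rw [map_add]
    nth_rw 1 [hr_eq, hθ_eq]
    abel
  · change fderiv ℝ H (endpointsL R.nonneg E R.x)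
      (endpointsL R.nonneg E (r + R.linearizedState (S θ))) = η
    rw [map_add, map_add, ← linearization_apply, hS, hθ]
    abel

theorem memLp_dynamics (x : C(Icc 0 T, E)) {c : ℝ → C}
    (hc : AEStronglyMeasurable c (timeMeasure T)) {M : ℝ}
    (hM : ∀ᵐ t ∂timeMeasure T, ‖c t - R.c t‖ ≤ M) (p : ENNReal) :
    MemLp (fun t => R.F (IccExtend R.nonneg x t, c t)) p (timeMeasure T) := by
  have := FiniteDimensional.proper ℝ (E × C)
  obtain ⟨B, -, hB⟩ := R.exists_bound_pt
  refine memLp_continuous_comp_of_bounded (M := max ‖x‖ (B + M))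
    (f := fun t => (IccExtend R.nonneg x t, c t)) R.contDiff.continuous
    ((aestronglyMeasurable_IccExtend R.nonneg x).prodMk hc) ?_ p
  filter_upwards [hM, hB] with t ht hpt
  refine max_le_max (norm_IccExtend_le _ _ _) ?_
  exact (norm_le_norm_add_norm_sub' (c t) (R.c t)).trans
    (add_le_add ((le_max_right _ _).trans hpt) ht)

theorem integrable_dynamics (x : C(Icc 0 T, E)) {c : ℝ → C}
    (hc : AEStronglyMeasurable c (timeMeasure T)) {M : ℝ}
    (hM : ∀ᵐ t ∂timeMeasure T, ‖c t - R.c t‖ ≤ M) :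
    Integrable (fun t => R.F (IccExtend R.nonneg x t, c t)) (timeMeasure T) :=
  memLp_one_iff_integrable.1 (R.memLp_dynamics x hc hM 1)

theorem exists_dynamics_strict_approx {κ : ℝ} (hκ : 0 < κ) :
    ∃ δ > 0, ∀ (x x' : C(Icc 0 T, E)) (c c' : ℝ → C) (ρ : ℝ), ‖x - R.x‖ ≤ δ → ‖x' - R.x‖ ≤ δ →
      (∀ᵐ t ∂timeMeasure T, ‖c t - R.c t‖ ≤ δ) → (∀ᵐ t ∂timeMeasure T, ‖c' t - R.c t‖ ≤ δ) →
      ‖x - x'‖ ≤ ρ → (∀ᵐ t ∂timeMeasure T, ‖c t - c' t‖ ≤ ρ) →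
      ‖primitive T (fun t => R.F (IccExtend R.nonneg x t, c t) -
        R.F (IccExtend R.nonneg x' t, c' t) -
          fderiv ℝ R.F (R.pt t) (IccExtend R.nonneg (x - x') t, c t - c' t))‖ ≤ κ * ρ := by
  obtain ⟨B, -, hB⟩ := R.exists_bound_pt
  have hT := R.nonneg
  obtain ⟨δ, hδ, happrox⟩ := exists_uniform_strict_approx (R.contDiff.of_le (by norm_num)) B
    (ε := κ / (T + 1)) (by positivity)
  refine ⟨δ, hδ, fun x x' c c' ρ hx hx' hc hc' hxx' hcc' => ?_⟩
  have hρ : 0 ≤ ρ := (norm_nonneg _).trans hxx'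
  refine norm_primitive_le_of_ae_le_div hT (by positivity) ?_
  filter_upwards [hB, hc, hc', hcc'] with t hBt hct hct' hcct'
  have hmem : ∀ (y : C(Icc 0 T, E)) (d : C), ‖y - R.x‖ ≤ δ → ‖d - R.c t‖ ≤ δ →
      (IccExtend R.nonneg y t, d) ∈ Metric.closedBall (R.pt t) δ := fun y d hy hd => by
    rw [mem_closedBall_iff_norm]
    exact max_le ((norm_IccExtend_le R.nonneg (y - R.x) t).trans hy) hd
  calc _ ≤ κ / (T + 1) * ‖((IccExtend R.nonneg x t, c t) - (IccExtend R.nonneg x' t, c' t))‖ :=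
        happrox _ hBt _ (hmem x _ hx hct) _ (hmem x' _ hx' hct')
    _ ≤ κ / (T + 1) * ρ := by
        gcongr
        exact max_le ((norm_IccExtend_le R.nonneg (x - x') t).trans hxx') hcct'
    _ = κ * ρ / (T + 1) := by ring

theorem fst_residual_sub_residualDeriv (H : E × E → Y)
    (S : Y →L[ℝ] E × Lp C 2 (timeMeasure T)) (ξ : E) (c : ℝ → C) (z z' : C(Icc 0 T, E) × Y)
    (hz : Integrable (fun t => R.F (IccExtend R.nonneg z.1 t, c t + (S z.2).2 t)) (timeMeasure T))
    (hz' : Integrable (fun t => R.F (IccExtend R.nonneg z'.1 t, c t + (S z'.2).2 t))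
      (timeMeasure T)) :
    (R.residual H S ξ c z - R.residual H S ξ c z' - R.residualDeriv H S (z - z')).1 =
      -primitive T (fun t => R.F (IccExtend R.nonneg z.1 t, c t + (S z.2).2 t) -
        R.F (IccExtend R.nonneg z'.1 t, c t + (S z'.2).2 t) -
          fderiv ℝ R.F (R.pt t) (IccExtend R.nonneg (z.1 - z'.1) t,
            (c t + (S z.2).2 t) - (c t + (S z'.2).2 t))) := by
  have hderiv : primitive T (fun t => R.F (IccExtend R.nonneg z.1 t, c t + (S z.2).2 t) -
        R.F (IccExtend R.nonneg z'.1 t, c t + (S z'.2).2 t) -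
          fderiv ℝ R.F (R.pt t) (IccExtend R.nonneg (z.1 - z'.1) t,
            (c t + (S z.2).2 t) - (c t + (S z'.2).2 t))) =
      primitive T (fun t => R.F (IccExtend R.nonneg z.1 t, c t + (S z.2).2 t) -
        R.F (IccExtend R.nonneg z'.1 t, c t + (S z'.2).2 t) -
          fderiv ℝ R.F (R.pt t) (IccExtend R.nonneg (z - z').1 t, (S (z - z').2).2 t)) := by
    refine primitive_congr ?_
    filter_upwards [Lp.coeFn_sub (S z.2).2 (S z'.2).2] with t ht
    rw [Prod.snd_sub, map_sub, Prod.snd_sub, ht, Pi.sub_apply, add_sub_add_left_eq_sub,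
      Prod.fst_sub]
  have hconst : ContinuousMap.const (Icc 0 T) (ξ + (S z.2).1) -
      ContinuousMap.const (Icc 0 T) (ξ + (S z'.2).1) =
        ContinuousMap.const (Icc 0 T) ((S z.2).1 - (S z'.2).1) := by
    ext; simp
  have hsub : Integrable (fun t => R.F (IccExtend R.nonneg z.1 t, c t + (S z.2).2 t) -
      R.F (IccExtend R.nonneg z'.1 t, c t + (S z'.2).2 t)) (timeMeasure T) := hz.sub hz'
  rw [hderiv, primitive_sub hsub (R.integrable_linearized _ _), primitive_sub hz hz',
    residualDeriv_apply]
  simp only [residual, defect, Prod.fst_sub, Prod.snd_sub, map_sub]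
  rw [← hconst]
  abel

theorem exists_residual_strict_approx {H : E × E → Y} (hH : ContDiff ℝ 1 H)
    (S : Y →L[ℝ] E × Lp C 2 (timeMeasure T)) {M : ℝ} (hM0 : 0 ≤ M)
    (hM : ∀ y, ∀ᵐ t ∂timeMeasure T, ‖(S y).2 t‖ ≤ M * ‖y‖) {κ : ℝ} (hκ : 0 < κ) :
    ∃ δ > 0, ∀ (ξ : E) (c : ℝ → C), AEStronglyMeasurable c (timeMeasure T) →
      (∀ᵐ t ∂timeMeasure T, ‖c t - R.c t‖ ≤ δ) → ∀ z z' : C(Icc 0 T, E) × Y,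
      ‖z.1 - R.x‖ ≤ δ → ‖z.2‖ ≤ δ → ‖z'.1 - R.x‖ ≤ δ → ‖z'.2‖ ≤ δ →
      ‖R.residual H S ξ c z - R.residual H S ξ c z' - R.residualDeriv H S (z - z')‖ ≤
        κ * ‖z - z'‖ := by
  obtain ⟨δ₁, hδ₁, hdynamics⟩ := R.exists_dynamics_strict_approx (κ := κ / (1 + M)) (by positivity)
  obtain ⟨δ₂, hδ₂, hendpoint⟩ := R.exists_endpoint_strict_approx hH hκ
  refine ⟨min (δ₁ / (1 + M)) δ₂, by positivity, fun ξ c hc hcδ z z' hz1 hz2 hz1' hz2' => ?_⟩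
  obtain ⟨hδ, hδM⟩ : min (δ₁ / (1 + M)) δ₂ ≤ δ₁ ∧ (1 + M) * min (δ₁ / (1 + M)) δ₂ ≤ δ₁ := by
    have hle : (1 + M) * min (δ₁ / (1 + M)) δ₂ ≤ δ₁ := by
      rw [← le_div_iff₀' (by positivity)]; exact min_le_left _ _
    exact ⟨le_trans (le_mul_of_one_le_left (by positivity) (by linarith)) hle, hle⟩
  have hδ' : min (δ₁ / (1 + M)) δ₂ ≤ δ₂ := min_le_right _ _
  have hcontrol : ∀ y : Y, ‖y‖ ≤ min (δ₁ / (1 + M)) δ₂ →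
      ∀ᵐ t ∂timeMeasure T, ‖c t + (S y).2 t - R.c t‖ ≤ δ₁ := fun y hy => by
    filter_upwards [hcδ, hM y] with t hct hSt
    calc ‖c t + (S y).2 t - R.c t‖ = ‖(c t - R.c t) + (S y).2 t‖ := by congr 1; abel
      _ ≤ min (δ₁ / (1 + M)) δ₂ + M * min (δ₁ / (1 + M)) δ₂ :=
        norm_add_le_of_le hct (hSt.trans (by gcongr))
      _ ≤ δ₁ := by linarith
  have hdiff : ∀ᵐ t ∂timeMeasure T,
      ‖(c t + (S z.2).2 t) - (c t + (S z'.2).2 t)‖ ≤ (1 + M) * ‖z - z'‖ := by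
    filter_upwards [hM (z - z').2, Lp.coeFn_sub (S z.2).2 (S z'.2).2] with t hSt hsub
    rw [add_sub_add_left_eq_sub, ← Pi.sub_apply, ← hsub, ← Prod.snd_sub, ← map_sub, ← Prod.snd_sub]
    refine hSt.trans (mul_le_mul (by linarith) (norm_snd_le _) (norm_nonneg _) (by positivity))
  have hint : ∀ w : C(Icc 0 T, E) × Y, ‖w.2‖ ≤ min (δ₁ / (1 + M)) δ₂ →
      Integrable (fun t => R.F (IccExtend R.nonneg w.1 t, c t + (S w.2).2 t)) (timeMeasure T) :=
    fun w hw => R.integrable_dynamics w.1 (hc.add (Lp.aestronglyMeasurable _)) (hcontrol w.2 hw)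
  refine max_le ?_ ?_
  · rw [R.fst_residual_sub_residualDeriv H S ξ c z z' (hint z hz2) (hint z' hz2'), norm_neg]
    calc _ ≤ κ / (1 + M) * ((1 + M) * ‖z - z'‖) :=
          hdynamics _ _ _ _ _ (hz1.trans hδ) (hz1'.trans hδ) (hcontrol _ hz2) (hcontrol _ hz2')
            ((norm_fst_le (z - z')).trans (le_mul_of_one_le_left (norm_nonneg _) (by linarith)))
            hdiff
      _ = κ * ‖z - z'‖ := by field_simp
  · rw [residualDeriv_apply]
    calc _ = ‖H (endpointsL R.nonneg E z.1) - H (endpointsL R.nonneg E z'.1) -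
          fderiv ℝ H (endpointsL R.nonneg E R.x) (endpointsL R.nonneg E (z.1 - z'.1))‖ := by
          simp only [residual, Prod.snd_sub, Prod.fst_sub, sub_sub_sub_cancel_right]
      _ ≤ κ * ‖z.1 - z'.1‖ := hendpoint _ _ (hz1.trans hδ') (hz1'.trans hδ')
      _ ≤ κ * ‖z - z'‖ := by gcongr; exact norm_fst_le (z - z')

end ReferenceTrajectory

/-- The directions with essentially bounded control. -/
def boundedDirections (E C : Type*) [NormedAddCommGroup E] [NormedSpace ℝ E]
    [NormedAddCommGroup C] [NormedSpace ℝ C] (T : ℝ) :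
    Submodule ℝ (E × Lp C 2 (timeMeasure T)) where
  carrier := {q | ∃ M : ℝ, ∀ᵐ t ∂timeMeasure T, ‖q.2 t‖ ≤ M}
  add_mem' := by
    rintro q r ⟨M, hM⟩ ⟨N, hN⟩
    refine ⟨M + N, ?_⟩
    filter_upwards [hM, hN, Lp.coeFn_add q.2 r.2] with t hMt hNt hadd
    rw [Prod.snd_add, hadd]
    exact norm_add_le_of_le hMt hNt
  zero_mem' := by
    refine ⟨0, ?_⟩
    filter_upwards [Lp.coeFn_zero C 2 (timeMeasure T)] with t hzero
    rw [Prod.snd_zero, hzero, Pi.zero_apply, norm_zero]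
  smul_mem' := by
    rintro a q ⟨M, hM⟩
    refine ⟨‖a‖ * M, ?_⟩
    filter_upwards [hM, Lp.coeFn_smul a q.2] with t hMt hsmul
    rw [Prod.smul_snd, hsmul, Pi.smul_apply, norm_smul]
    gcongr

namespace ReferenceTrajectory

variable {E C : Type*} [NormedAddCommGroup E] [NormedSpace ℝ E] [NormedAddCommGroup C]
  [NormedSpace ℝ C] {T : ℝ} (R : ReferenceTrajectory E C T)
  [FiniteDimensional ℝ E] [FiniteDimensional ℝ C]

/-- The base curve of states, to which small corrections are applied to obtain trajectories. -/
def curveState (q₀ q₁ : E × Lp C 2 (timeMeasure T)) (s : ℝ) : C(Icc 0 T, E) :=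
  R.x + (s • R.linearizedState q₀ + s ^ 2 • (R.linearizedState q₁ + R.secondOrderState q₀))

theorem eventually_norm_endpoint_expansion_le {Y : Type*} [NormedAddCommGroup Y] [NormedSpace ℝ Y]
    {H : E × E → Y} (hH : ContDiff ℝ 2 H) (q₀ q₁ : E × Lp C 2 (timeMeasure T)) {ε : ℝ}
    (hε : 0 < ε) :
    ∀ᶠ s in 𝓝[>] (0 : ℝ),
      ‖H (endpointsL R.nonneg E (R.curveState q₀ q₁ s)) - H (endpointsL R.nonneg E R.x) -
        s • R.linearization H q₀ - s ^ 2 • (R.linearization H q₁ + R.curvature H q₀)‖ ≤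
          ε * s ^ 2 := by
  set e := endpointsL R.nonneg E with he
  obtain ⟨δ, hδ, htaylor⟩ := exists_uniform_taylor_parabola hH ‖e R.x‖
    (max ‖e (R.linearizedState q₀)‖ ‖e (R.linearizedState q₁ + R.secondOrderState q₀)‖) hε
  filter_upwards [Ioc_mem_nhdsGT hδ] with s ⟨hs, hsδ⟩
  have hcurve : e (R.curveState q₀ q₁ s) = e R.x + (s • e (R.linearizedState q₀) +
      s ^ 2 • e (R.linearizedState q₁ + R.secondOrderState q₀)) := by
    simp only [curveState, map_add, map_smul]
  have hsecond : R.linearization H q₁ + R.curvature H q₀ =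
      fderiv ℝ H (e R.x) (e (R.linearizedState q₁ + R.secondOrderState q₀)) + (1 / 2 : ℝ) •
        fderiv ℝ (fderiv ℝ H) (e R.x) (e (R.linearizedState q₀)) (e (R.linearizedState q₀)) := by
    rw [linearization_apply, curvature, ← he, map_add, map_add, add_assoc]
  rw [hcurve, hsecond, linearization_apply]
  exact htaylor _ le_rfl _ (le_max_left _ _) _ (le_max_right _ _) s hs.le hsδ

/-- The integrand whose primitive is the second order coefficient of the base curve of states. -/
def secondOrderRate (q₀ q₁ : E × Lp C 2 (timeMeasure T)) (t : ℝ) : E :=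
  fderiv ℝ R.F (R.pt t)
      (IccExtend R.nonneg (R.linearizedState q₁ + R.secondOrderState q₀) t, q₁.2 t) +
    (1 / 2 : ℝ) • fderiv ℝ (fderiv ℝ R.F) (R.pt t)
      (IccExtend R.nonneg (R.linearizedState q₀) t, q₀.2 t)
      (IccExtend R.nonneg (R.linearizedState q₀) t, q₀.2 t)

theorem integrable_secondOrderRate (q₀ q₁ : E × Lp C 2 (timeMeasure T)) :
    Integrable (R.secondOrderRate q₀ q₁) (timeMeasure T) :=
  (R.integrable_linearized _ _).add (R.integrable_quadraticTerm q₀)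

theorem primitive_secondOrderRate (q₀ q₁ : E × Lp C 2 (timeMeasure T)) :
    primitive T (R.secondOrderRate q₀ q₁) =
      R.linearizedState q₁ + R.secondOrderState q₀ - ContinuousMap.const _ q₁.1 := by
  have hforced : Integrable (fun t =>
      fderiv ℝ R.F (R.pt t) (IccExtend R.nonneg (R.secondOrderState q₀) t, 0) +
        (1 / 2 : ℝ) • fderiv ℝ (fderiv ℝ R.F) (R.pt t)
          (IccExtend R.nonneg (R.linearizedState q₀) t, q₀.2 t)
          (IccExtend R.nonneg (R.linearizedState q₀) t, q₀.2 t)) (timeMeasure T) :=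
    (R.integrable_stateCoeff _).add (R.integrable_quadraticTerm q₀)
  rw [add_sub_right_comm, ← eq_sub_of_add_eq' (R.linearizedState_eq q₁).symm,
    R.secondOrderState_eq q₀, ← primitive_add (R.integrable_linearized _ _) hforced]
  congr 1
  funext t
  rw [← add_assoc, ← map_add, Prod.mk_add_mk, add_zero]
  rfl

theorem defect_curve (q₀ q₁ : E × Lp C 2 (timeMeasure T)) (s : ℝ)
    (hint : Integrable (fun t => R.F (IccExtend R.nonneg (R.curveState q₀ q₁ s) t,
      R.curveControl q₀ q₁ s t)) (timeMeasure T)) :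
    R.defect (R.x ⟨0, le_rfl, R.nonneg⟩ + (s • q₀.1 + s ^ 2 • q₁.1)) (R.curveState q₀ q₁ s)
        (R.curveControl q₀ q₁ s) =
      -primitive T (fun t => R.F (IccExtend R.nonneg (R.curveState q₀ q₁ s) t,
          R.curveControl q₀ q₁ s t) - R.F (R.pt t) -
        s • fderiv ℝ R.F (R.pt t) (IccExtend R.nonneg (R.linearizedState q₀) t, q₀.2 t) -
        s ^ 2 • R.secondOrderRate q₀ q₁ t) := by
  have hreference : primitive T (fun t => R.F (R.pt t)) =
      R.x - ContinuousMap.const _ (R.x ⟨0, le_rfl, R.nonneg⟩) :=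
    eq_sub_of_add_eq' R.x_eq.symm
  have hlinear : primitive T (fun t => fderiv ℝ R.F (R.pt t)
      (IccExtend R.nonneg (R.linearizedState q₀) t, q₀.2 t)) =
        R.linearizedState q₀ - ContinuousMap.const _ q₀.1 :=
    eq_sub_of_add_eq' (R.linearizedState_eq q₀).symm
  rw [primitive_taylor_remainder s hint
    (memLp_one_iff_integrable.1 (R.memLp_comp_pt R.contDiff.continuous 1))
    (R.integrable_linearized _ _) (R.integrable_secondOrderRate q₀ q₁), hreference, hlinear,
    primitive_secondOrderRate, defect]
  nth_rw 1 [curveState]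
  ext t
  simp only [ContinuousMap.sub_apply, ContinuousMap.add_apply, ContinuousMap.smul_apply,
    ContinuousMap.neg_apply, ContinuousMap.const_apply, smul_sub]
  abel

theorem eventually_norm_defect_curve_le {q₀ q₁ : E × Lp C 2 (timeMeasure T)}
    (hq₀ : q₀ ∈ boundedDirections E C T) (hq₁ : q₁ ∈ boundedDirections E C T) {ε : ℝ}
    (hε : 0 < ε) :
    ∀ᶠ s in 𝓝[>] (0 : ℝ),
      ‖R.defect (R.x ⟨0, le_rfl, R.nonneg⟩ + (s • q₀.1 + s ^ 2 • q₁.1)) (R.curveState q₀ q₁ s)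
        (R.curveControl q₀ q₁ s)‖ ≤ ε * s ^ 2 := by
  obtain ⟨B, -, hB⟩ := R.exists_bound_pt
  obtain ⟨M₀, hM₀⟩ := hq₀
  obtain ⟨M₁, hM₁⟩ := hq₁
  have hT := R.nonneg
  set x₂ := R.linearizedState q₁ + R.secondOrderState q₀
  obtain ⟨δ, hδ, htaylor⟩ := exists_uniform_taylor_parabola R.contDiff B
    (max (max ‖R.linearizedState q₀‖ M₀) (max ‖x₂‖ M₁)) (ε := ε / (T + 1)) (by positivity)
  filter_upwards [Ioc_mem_nhdsGT hδ] with s ⟨hs, hsδ⟩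
  rw [R.defect_curve q₀ q₁ s (R.integrable_dynamics _ (R.aestronglyMeasurable_curveControl q₀ q₁ s)
    (R.ae_norm_curveControl_sub_le hM₀ hM₁ hs.le)), norm_neg]
  refine norm_primitive_le_of_ae_le_div hT (by positivity) ?_
  filter_upwards [hB, hM₀, hM₁] with t hBt hM₀t hM₁t
  calc _ ≤ ε / (T + 1) * s ^ 2 :=
        htaylor _ hBt (IccExtend R.nonneg (R.linearizedState q₀) t, q₀.2 t)
          ((max_le_max (norm_IccExtend_le _ _ _) hM₀t).trans (le_max_left _ _))
          (IccExtend R.nonneg x₂ t, q₁.2 t)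
          ((max_le_max (norm_IccExtend_le _ _ _) hM₁t).trans (le_max_right _ _)) s hs.le hsδ
    _ = ε * s ^ 2 / (T + 1) := by ring

end ReferenceTrajectory

theorem exists_pos_forall_le_neg {ι : Type*} [Finite ι] {a : ι → ℝ} (ha : ∀ i, a i < 0) :
    ∃ γ > 0, ∀ i, a i ≤ -γ := by
  rcases isEmpty_or_nonempty ι with h | h
  · exact ⟨1, one_pos, fun i => h.elim i⟩
  · obtain ⟨j, hj⟩ := Finite.exists_max a
    exact ⟨-a j, neg_pos.2 (ha j), by simpa only [neg_neg] using hj⟩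

namespace ReferenceTrajectory

variable {E C : Type*} [NormedAddCommGroup E] [NormedSpace ℝ E] [NormedAddCommGroup C]
  [NormedSpace ℝ C] {T : ℝ} (R : ReferenceTrajectory E C T)

/-- `(x, c)` is a trajectory of the control system at uniform distance at most `ε` from the
reference trajectory. -/
def IsNearbyTrajectory (ε : ℝ) (x : C(Icc 0 T, E)) (c : ℝ → C) : Prop :=
  AEStronglyMeasurable c (timeMeasure T) ∧
    x = ContinuousMap.const _ (x ⟨0, le_rfl, R.nonneg⟩) +
      primitive T (fun t => R.F (IccExtend R.nonneg x t, c t)) ∧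
    ‖x - R.x‖ ≤ ε ∧ ∀ᵐ t ∂timeMeasure T, ‖c t - R.c t‖ ≤ ε

theorem eq_const_add_primitive_of_defect_eq_zero {ξ : E} {x : C(Icc 0 T, E)} {c : ℝ → C}
    (h : R.defect ξ x c = 0) :
    x = ContinuousMap.const _ (x ⟨0, le_rfl, R.nonneg⟩) +
      primitive T (fun t => R.F (IccExtend R.nonneg x t, c t)) := by
  have hx : x = ContinuousMap.const _ ξ +
      primitive T (fun t => R.F (IccExtend R.nonneg x t, c t)) :=
    sub_eq_zero.1 ((sub_sub _ _ _).symm.trans h)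
  have hξ : x ⟨0, le_rfl, R.nonneg⟩ = ξ := by
    rw [hx, ContinuousMap.add_apply, primitive_zero R.nonneg, add_zero, ContinuousMap.const_apply]
  rwa [hξ]

theorem eventually_ae_norm_curveControl_sub_le {q₀ q₁ : E × Lp C 2 (timeMeasure T)}
    (hq₀ : q₀ ∈ boundedDirections E C T) (hq₁ : q₁ ∈ boundedDirections E C T) {δ : ℝ}
    (hδ : 0 < δ) :
    ∀ᶠ s in 𝓝[>] (0 : ℝ), ∀ᵐ t ∂timeMeasure T, ‖R.curveControl q₀ q₁ s t - R.c t‖ ≤ δ := by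
  obtain ⟨M₀, hM₀⟩ := hq₀
  obtain ⟨M₁, hM₁⟩ := hq₁
  have hsmall : ∀ᶠ s in 𝓝 (0 : ℝ), s * M₀ + s ^ 2 * M₁ < δ :=
    (Continuous.tendsto' (by fun_prop) (0 : ℝ) 0 (by simp)).eventually_lt_const hδ
  filter_upwards [hsmall.filter_mono nhdsWithin_le_nhds, self_mem_nhdsWithin] with s hs hs0
  filter_upwards [R.ae_norm_curveControl_sub_le hM₀ hM₁ (le_of_lt hs0)] with t ht
  exact ht.trans hs.le

variable {Y : Type*} [NormedAddCommGroup Y] [NormedSpace ℝ Y]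

theorem residual_mk_zero (H : E × E → Y) (S : Y →L[ℝ] E × Lp C 2 (timeMeasure T)) (ξ : E)
    (c : ℝ → C) (x : C(Icc 0 T, E)) : R.residual H S ξ c (x, 0) =
      (R.defect ξ x c, H (endpointsL R.nonneg E x) - H (endpointsL R.nonneg E R.x)) := by
  refine Prod.ext ?_ rfl
  simp only [residual, defect, map_zero, Prod.fst_zero, add_zero, Prod.snd_zero]
  congr 1
  refine primitive_congr ?_
  filter_upwards [Lp.coeFn_zero C 2 (timeMeasure T)] with t ht
  rw [ht, Pi.zero_apply, add_zero]

variable [FiniteDimensional ℝ E] [FiniteDimensional ℝ C]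

theorem eventually_norm_curveState_sub_lt (q₀ q₁ : E × Lp C 2 (timeMeasure T)) {δ : ℝ}
    (hδ : 0 < δ) : ∀ᶠ s in 𝓝[>] (0 : ℝ), ‖R.curveState q₀ q₁ s - R.x‖ < δ := by
  have hcont : Continuous fun s : ℝ => ‖R.curveState q₀ q₁ s - R.x‖ := by
    unfold curveState
    fun_prop
  exact ((hcont.tendsto' 0 0 (by simp [curveState])).eventually_lt_const hδ).filter_mono
    nhdsWithin_le_nhds

theorem exists_nearbyTrajectory_of_residual_le [CompleteSpace Y] {H : E × E → Y}
    (hH : ContDiff ℝ 1 H) {S : Y →L[ℝ] E × Lp C 2 (timeMeasure T)}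
    (hS : ∀ y, R.linearization H (S y) = y) {M : ℝ} (hM0 : 0 ≤ M)
    (hM : ∀ y, ∀ᵐ t ∂timeMeasure T, ‖(S y).2 t‖ ≤ M * ‖y‖) {ε : ℝ} (hε : 0 < ε) :
    ∃ K > 0, ∃ ρ > 0, ∀ (ξ : E) (c : ℝ → C) (x : C(Icc 0 T, E)),
      AEStronglyMeasurable c (timeMeasure T) → (∀ᵐ t ∂timeMeasure T, ‖c t - R.c t‖ ≤ ρ) →
      ‖x - R.x‖ ≤ ρ → K * ‖R.residual H S ξ c (x, 0)‖ ≤ ρ →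
      ∃ x' c', R.IsNearbyTrajectory ε x' c' ∧
        H (endpointsL R.nonneg E x') = H (endpointsL R.nonneg E R.x) ∧
        ‖x' - x‖ ≤ K * ‖R.residual H S ξ c (x, 0)‖ := by
  have := FiniteDimensional.complete ℝ E
  obtain ⟨k, hk, K, hK, hzero⟩ := exists_zero_near_of_surjective_approx (R.residualDeriv H S)
    (R.surjective_residualDeriv hS)
  obtain ⟨δ, hδ, happrox⟩ := R.exists_residual_strict_approx hH S hM0 hM hk
  set ρ := min (δ / 2) (ε / (2 * (1 + M)))
  have hρ0 : 0 < ρ := by positivity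
  have hρδ : ρ ≤ δ / 2 := min_le_left _ _
  have hρM : (1 + M) * ρ ≤ ε / 2 := by
    have : ρ ≤ ε / (2 * (1 + M)) := min_le_right _ _
    rw [le_div_iff₀ (by positivity)] at this
    linarith
  have hρε : 2 * ρ ≤ ε := by nlinarith
  refine ⟨K, hK, ρ, hρ0, fun ξ c x hc hcρ hxρ hres => ?_⟩
  have hball : ∀ z ∈ Metric.closedBall ((x, 0) : C(Icc 0 T, E) × Y) ρ,
      ‖z.1 - R.x‖ ≤ 2 * ρ ∧ ‖z.2‖ ≤ ρ := fun z hz => by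
    rw [mem_closedBall_iff_norm] at hz
    have hz₁ : ‖z.1 - x‖ ≤ ρ := (norm_fst_le (z - (x, 0))).trans hz
    have hz₂ : ‖z.2 - 0‖ ≤ ρ := (norm_snd_le (z - (x, 0))).trans hz
    have := norm_sub_le_norm_sub_add_norm_sub z.1 x R.x
    exact ⟨by linarith, by rwa [sub_zero] at hz₂⟩
  have hballδ : ∀ z ∈ Metric.closedBall ((x, 0) : C(Icc 0 T, E) × Y) ρ,
      ‖z.1 - R.x‖ ≤ δ ∧ ‖z.2‖ ≤ δ := fun z hz =>
    ⟨(hball z hz).1.trans (by linarith), (hball z hz).2.trans (by linarith)⟩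
  obtain ⟨z, hz0, hz⟩ := hzero (R.residual H S ξ c) (x, 0) ρ (fun z hz z' hz' =>
    happrox ξ c hc (hcρ.mono fun t ht => by linarith) z z' (hballδ z hz).1 (hballδ z hz).2
      (hballδ z' hz').1 (hballδ z' hz').2) hres
  obtain ⟨hz₁, hz₂⟩ := hball z (mem_closedBall_iff_norm.2 (hz.trans hres))
  refine ⟨z.1, fun t => c t + (S z.2).2 t, ⟨hc.add (Lp.aestronglyMeasurable _),
    R.eq_const_add_primitive_of_defect_eq_zero (congrArg Prod.fst hz0), hz₁.trans hρε, ?_⟩,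
    sub_eq_zero.1 (congrArg Prod.snd hz0), (norm_fst_le (z - (x, 0))).trans hz⟩
  filter_upwards [hcρ, hM z.2] with t hct hSt
  have : M * ‖z.2‖ ≤ M * ρ := by gcongr
  calc ‖c t + (S z.2).2 t - R.c t‖ = ‖(c t - R.c t) + (S z.2).2 t‖ := by congr 1; abel
    _ ≤ ‖c t - R.c t‖ + ‖(S z.2).2 t‖ := norm_add_le _ _
    _ ≤ ε := by linarith

theorem eventually_norm_residual_curve_le {H : E × E → Y} (hH : ContDiff ℝ 2 H)
    (S : Y →L[ℝ] E × Lp C 2 (timeMeasure T)) {q₀ q₁ : E × Lp C 2 (timeMeasure T)}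
    (hq₀ : q₀ ∈ boundedDirections E C T) (hq₁ : q₁ ∈ boundedDirections E C T)
    (hfirst : R.linearization H q₀ = 0)
    (hsecond : R.linearization H q₁ + R.curvature H q₀ = 0) {ε : ℝ} (hε : 0 < ε) :
    ∀ᶠ s in 𝓝[>] (0 : ℝ),
      ‖R.residual H S (R.x ⟨0, le_rfl, R.nonneg⟩ + (s • q₀.1 + s ^ 2 • q₁.1))
        (R.curveControl q₀ q₁ s) (R.curveState q₀ q₁ s, 0)‖ ≤ ε * s ^ 2 := by
  filter_upwards [R.eventually_norm_defect_curve_le hq₀ hq₁ hε,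
    R.eventually_norm_endpoint_expansion_le hH q₀ q₁ hε] with s hdefect hendpoint
  rw [residual_mk_zero]
  refine max_le hdefect ?_
  rwa [hfirst, hsecond, smul_zero, smul_zero, sub_zero, sub_zero] at hendpoint

theorem eventually_exists_nearbyTrajectory [CompleteSpace Y] {H : E × E → Y} (hH : ContDiff ℝ 2 H)
    {S : Y →L[ℝ] E × Lp C 2 (timeMeasure T)} (hS : ∀ y, R.linearization H (S y) = y) {M : ℝ}
    (hM0 : 0 ≤ M) (hM : ∀ y, ∀ᵐ t ∂timeMeasure T, ‖(S y).2 t‖ ≤ M * ‖y‖)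
    {q₀ q₁ : E × Lp C 2 (timeMeasure T)} (hq₀ : q₀ ∈ boundedDirections E C T)
    (hq₁ : q₁ ∈ boundedDirections E C T) (hfirst : R.linearization H q₀ = 0)
    (hsecond : R.linearization H q₁ + R.curvature H q₀ = 0) {ε κ : ℝ} (hε : 0 < ε) (hκ : 0 < κ) :
    ∀ᶠ s in 𝓝[>] (0 : ℝ), ∃ x c, R.IsNearbyTrajectory ε x c ∧
      H (endpointsL R.nonneg E x) = H (endpointsL R.nonneg E R.x) ∧
      ‖x - R.curveState q₀ q₁ s‖ ≤ κ * s ^ 2 := by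
  obtain ⟨K, hK, ρ, hρ, hcorrect⟩ :=
    R.exists_nearbyTrajectory_of_residual_le (hH.of_le (by norm_num)) hS hM0 hM hε
  have hsmall : ∀ᶠ s in 𝓝 (0 : ℝ), κ * s ^ 2 < ρ :=
    (Continuous.tendsto' (by fun_prop) (0 : ℝ) 0 (by simp)).eventually_lt_const hρ
  filter_upwards [R.eventually_norm_residual_curve_le hH S hq₀ hq₁ hfirst hsecond (div_pos hκ hK),
    R.eventually_norm_curveState_sub_lt q₀ q₁ hρ,
    R.eventually_ae_norm_curveControl_sub_le hq₀ hq₁ hρ,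
    hsmall.filter_mono nhdsWithin_le_nhds] with s hres hstate hcontrol hs
  have hKres := (mul_le_mul_of_nonneg_left hres hK.le).trans_eq
    (show K * (κ / K * s ^ 2) = κ * s ^ 2 by field_simp)
  obtain ⟨x, c, hnear, hH, hdist⟩ := hcorrect _ _ _ (R.aestronglyMeasurable_curveControl q₀ q₁ s)
    hcontrol hstate.le (hKres.trans hs.le)
  exact ⟨x, c, hnear, hH, hdist.trans hKres⟩

theorem exists_nearbyTrajectory_decrease [CompleteSpace Y] {ι : Type*} [Fintype ι]
    {Φ : E × E → ι → ℝ} (hΦ : ContDiff ℝ 2 Φ) {H : E × E → Y} (hH : ContDiff ℝ 2 H)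
    {S : Y →L[ℝ] E × Lp C 2 (timeMeasure T)} (hS : ∀ y, R.linearization H (S y) = y) {M : ℝ}
    (hM0 : 0 ≤ M) (hM : ∀ y, ∀ᵐ t ∂timeMeasure T, ‖(S y).2 t‖ ≤ M * ‖y‖)
    {q₀ q₁ : E × Lp C 2 (timeMeasure T)} (hq₀ : q₀ ∈ boundedDirections E C T)
    (hq₁ : q₁ ∈ boundedDirections E C T) (hfirst : R.linearization H q₀ = 0)
    (hsecond : R.linearization H q₁ + R.curvature H q₀ = 0)
    (hfirstΦ : ∀ i, R.linearization Φ q₀ i ≤ 0)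
    (hsecondΦ : ∀ i, R.linearization Φ q₁ i + R.curvature Φ q₀ i < 0) {ε : ℝ} (hε : 0 < ε) :
    ∃ x c, R.IsNearbyTrajectory ε x c ∧
      H (endpointsL R.nonneg E x) = H (endpointsL R.nonneg E R.x) ∧
      ∀ i, Φ (endpointsL R.nonneg E x) i < Φ (endpointsL R.nonneg E R.x) i := by
  obtain ⟨γ, hγ, hdecrease⟩ := exists_pos_forall_le_neg hsecondΦ
  have hsmooth : ContDiff ℝ 1 fun x => Φ (endpointsL R.nonneg E x) :=
    (hΦ.comp (endpointsL R.nonneg E).contDiff).of_le (by norm_num)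
  obtain ⟨L, U, hU, hLip⟩ := hsmooth.contDiffAt.exists_lipschitzOnWith (x := R.x)
  obtain ⟨δ, hδ, hδU⟩ := Metric.nhds_basis_closedBall.mem_iff.1 hU
  have hcorrect := R.eventually_exists_nearbyTrajectory hH hS hM0 hM hq₀ hq₁ hfirst hsecond
    (ε := min ε δ) (κ := γ / (4 * (L + 1))) (by positivity) (by positivity)
  obtain ⟨s, ⟨x, c, ⟨hc, hx, hxε, hcε⟩, hHx, hdist⟩, hexpand, hstate, hs⟩ :=
    (hcorrect.and ((R.eventually_norm_endpoint_expansion_le hΦ q₀ q₁ (ε := γ / 4)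
      (by positivity)).and ((R.eventually_norm_curveState_sub_lt q₀ q₁ hδ).and
        self_mem_nhdsWithin))).exists
  refine ⟨x, c, ⟨hc, hx, hxε.trans (min_le_left _ _),
    hcε.mono fun t ht => ht.trans (min_le_left _ _)⟩, hHx, fun i => ?_⟩
  have hcorrection : ‖Φ (endpointsL R.nonneg E x) -
      Φ (endpointsL R.nonneg E (R.curveState q₀ q₁ s))‖ ≤ γ / 4 * s ^ 2 :=
    calc _ ≤ L * ‖x - R.curveState q₀ q₁ s‖ := hLip.norm_sub_le
          (hδU (mem_closedBall_iff_norm.2 (hxε.trans (min_le_right _ _))))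
          (hδU (mem_closedBall_iff_norm.2 hstate.le))
      _ ≤ (L + 1) * (γ / (4 * (L + 1)) * s ^ 2) := by gcongr; linarith
      _ = γ / 4 * s ^ 2 := by field_simp
  have hcorrection_i := (abs_le.1 ((norm_le_pi_norm _ i).trans hcorrection)).2
  have hexpand_i := (abs_le.1 ((norm_le_pi_norm _ i).trans hexpand)).2
  simp only [Pi.sub_apply, Pi.smul_apply, Pi.add_apply, smul_eq_mul] at hcorrection_i hexpand_i
  have hs2 : 0 < s ^ 2 := pow_pos hs 2
  have hfirst_i : s * R.linearization Φ q₀ i ≤ 0 :=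
    mul_nonpos_of_nonneg_of_nonpos (le_of_lt hs) (hfirstΦ i)
  have hsecond_i := mul_le_mul_of_nonneg_left (hdecrease i) hs2.le
  nlinarith

end ReferenceTrajectory

section StrictEpigraph

variable {ι κ V : Type*} [AddCommGroup V] [Module ℝ V] (L : V →ₗ[ℝ] (ι → ℝ) × (κ → ℝ))

/-- The values `z` for which the system `L.1 < z.1`, `L.2 = z.2` is solvable. -/
def strictEpigraph : Set ((ι → ℝ) × (κ → ℝ)) :=
  {z | ∃ q, (∀ i, (L q).1 i < z.1 i) ∧ (L q).2 = z.2}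

theorem convex_strictEpigraph : Convex ℝ (strictEpigraph L) := by
  refine convex_iff_forall_pos.2 ?_
  rintro z ⟨q, hq, hq'⟩ w ⟨r, hr, hr'⟩ a b ha hb -
  refine ⟨a • q + b • r, fun i => ?_, ?_⟩
  · simp only [map_add, map_smul, Prod.fst_add, Prod.smul_fst, Pi.add_apply, Pi.smul_apply]
    exact add_lt_add (smul_lt_smul_of_pos_left (hq i) ha) (smul_lt_smul_of_pos_left (hr i) hb)
  · rw [map_add, map_smul, map_smul, Prod.snd_add, Prod.smul_snd, Prod.smul_snd, hq', hr']
    rfl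

theorem smul_mem_strictEpigraph {r : ℝ} (hr : 0 < r) {z : (ι → ℝ) × (κ → ℝ)}
    (hz : z ∈ strictEpigraph L) : r • z ∈ strictEpigraph L := by
  obtain ⟨q, hq, hq'⟩ := hz
  refine ⟨r • q, fun i => ?_, ?_⟩
  · rw [map_smul]; exact smul_lt_smul_of_pos_left (hq i) hr
  · rw [map_smul, Prod.smul_snd, hq', Prod.smul_snd]

theorem mem_closure_strictEpigraph {q : V} {z : (ι → ℝ) × (κ → ℝ)}
    (hle : ∀ i, (L q).1 i ≤ z.1 i) (heq : (L q).2 = z.2) : z ∈ closure (strictEpigraph L) := by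
  have hcont : Continuous fun t : ℝ => z + ((fun _ => t, 0) : (ι → ℝ) × (κ → ℝ)) := by fun_prop
  refine mem_closure_of_tendsto
    ((hcont.tendsto' 0 z (add_zero z)).mono_left (nhdsWithin_le_nhds (s := Ioi 0)))
    (eventually_mem_nhdsWithin.mono fun t ht => ⟨q, ?_, ?_⟩)
  · exact fun i => lt_add_of_le_of_pos (hle i) ht
  · rw [heq, Prod.snd_add, add_zero]

theorem isOpen_strictEpigraph [Finite ι] [Finite κ] (hL : Function.Surjective fun q => (L q).2) :
    IsOpen (strictEpigraph L) := by
  obtain ⟨r, hr⟩ := (LinearMap.snd ℝ _ _ ∘ₗ L).exists_rightInverse_of_surjective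
    (LinearMap.range_eq_top.2 hL)
  have hr' : ∀ y, (L (r y)).2 = y := LinearMap.congr_fun hr
  have hcont : Continuous fun y => (L (r y)).1 :=
    (LinearMap.fst ℝ _ _ ∘ₗ L ∘ₗ r).continuous_of_finiteDimensional
  refine isOpen_iff_mem_nhds.2 ?_
  rintro z ⟨q, hq, hq'⟩
  have hopen : IsOpen {w : (ι → ℝ) × (κ → ℝ) |
      ∀ i, (L q).1 i + (L (r (w.2 - z.2))).1 i < w.1 i} := by
    simp only [ofPred_forall]
    exact isOpen_iInter_of_finite fun i => isOpen_lt
      (continuous_const.add ((continuous_apply i).comp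
        (hcont.comp (continuous_snd.sub continuous_const)))) (by fun_prop)
  have hz : ∀ i, (L q).1 i + (L (r (z.2 - z.2))).1 i < z.1 i := by
    simpa only [sub_self, map_zero, Prod.fst_zero, Pi.zero_apply, add_zero] using hq
  filter_upwards [hopen.mem_nhds hz] with w hw
  refine ⟨q + r (w.2 - z.2), fun i => ?_, ?_⟩
  · rw [map_add]; exact hw i
  · rw [map_add, Prod.snd_add, hr', hq', add_sub_cancel]

end StrictEpigraph

section Duality

variable {ι κ : Type*} [Fintype ι] [Fintype κ]

/-- The pairing of a multiplier `(α, β)` with the values of the inequality and equality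
constraints. -/
def pairing (ab k : (ι → ℝ) × (κ → ℝ)) : ℝ := ab.1 ⬝ᵥ k.1 + ab.2 ⬝ᵥ k.2

theorem smul_pairing (r : ℝ) (ab k : (ι → ℝ) × (κ → ℝ)) :
    pairing (r • ab) k = r * pairing ab k := by
  simp only [pairing, Prod.smul_fst, Prod.smul_snd, smul_dotProduct, smul_eq_mul, mul_add]

theorem continuous_pairing :
    Continuous fun p : ((ι → ℝ) × (κ → ℝ)) × ((ι → ℝ) × (κ → ℝ)) => pairing p.1 p.2 := by
  unfold pairing dotProduct
  fun_prop

theorem exists_pairing_eq (f : (ι → ℝ) × (κ → ℝ) →ₗ[ℝ] ℝ) :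
    ∃ ab : (ι → ℝ) × (κ → ℝ), ∀ k, f k = pairing ab k := by
  classical
  refine ⟨((dotProductEquiv ℝ ι).symm (f ∘ₗ LinearMap.inl ℝ _ _),
    (dotProductEquiv ℝ κ).symm (f ∘ₗ LinearMap.inr ℝ _ _)), fun k => ?_⟩
  have hfst := LinearMap.congr_fun
    ((dotProductEquiv ℝ ι).apply_symm_apply (f ∘ₗ LinearMap.inl ℝ _ (κ → ℝ))) k.1
  have hsnd := LinearMap.congr_fun
    ((dotProductEquiv ℝ κ).apply_symm_apply (f ∘ₗ LinearMap.inr ℝ (ι → ℝ) _)) k.2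
  rw [dotProductEquiv_apply_apply] at hfst hsnd
  rw [pairing, hfst, hsnd, LinearMap.comp_apply, LinearMap.comp_apply, ← map_add]
  simp

/-- The normalized Lagrange multipliers of the constraints `L.1 ≤ 0`, `L.2 = 0`. -/
def normalizedMultipliers {V : Type*} (L : V → (ι → ℝ) × (κ → ℝ)) : Set ((ι → ℝ) × (κ → ℝ)) :=
  {ab | ∑ i, |ab.1 i| + ∑ j, |ab.2 j| = 1 ∧ (∀ i, 0 ≤ ab.1 i) ∧ ∀ q, pairing ab (L q) = 0}

theorem norm_le_sum_abs (f : ι → ℝ) : ‖f‖ ≤ ∑ i, |f i| :=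
  (pi_norm_le_iff_of_nonneg (Finset.sum_nonneg fun _ _ => abs_nonneg _)).2 fun i =>
    Finset.single_le_sum (f := fun i => |f i|) (fun _ _ => abs_nonneg _) (Finset.mem_univ i)

theorem norm_le_sum_abs_add_sum_abs (ab : (ι → ℝ) × (κ → ℝ)) :
    ‖ab‖ ≤ ∑ i, |ab.1 i| + ∑ j, |ab.2 j| :=
  max_le (le_add_of_le_of_nonneg (norm_le_sum_abs _) (Finset.sum_nonneg fun _ _ => abs_nonneg _))
    (le_add_of_nonneg_of_le (Finset.sum_nonneg fun _ _ => abs_nonneg _) (norm_le_sum_abs _))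

theorem isCompact_normalizedMultipliers {V : Type*} (L : V → (ι → ℝ) × (κ → ℝ)) :
    IsCompact (normalizedMultipliers L) := by
  have hnonneg : IsClosed {ab : (ι → ℝ) × (κ → ℝ) | ∀ i, 0 ≤ ab.1 i} := by
    simp only [ofPred_forall]
    exact isClosed_iInter fun i => isClosed_le continuous_const (by fun_prop)
  have horth : IsClosed {ab : (ι → ℝ) × (κ → ℝ) | ∀ q, pairing ab (L q) = 0} := by
    simp only [ofPred_forall]
    exact isClosed_iInter fun q => isClosed_eq
      (continuous_pairing.comp (continuous_id.prodMk continuous_const)) continuous_const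
  refine Metric.isCompact_of_isClosed_isBounded ?_ ?_
  · exact (isClosed_eq (by fun_prop) continuous_const).inter (hnonneg.inter horth)
  · refine (Metric.isBounded_closedBall (x := 0) (r := 1)).subset fun ab hab => ?_
    rw [mem_closedBall_zero_iff, ← hab.1]
    exact norm_le_sum_abs_add_sum_abs ab

theorem exists_isGreatest_pairing {V : Type*} {L : V → (ι → ℝ) × (κ → ℝ)}
    (hne : (normalizedMultipliers L).Nonempty) (k : (ι → ℝ) × (κ → ℝ)) :
    ∃ M, IsGreatest ((fun ab => pairing ab k) '' normalizedMultipliers L) M :=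
  ((isCompact_normalizedMultipliers L).image
    (continuous_pairing.comp (continuous_id.prodMk continuous_const))).exists_isGreatest
    (hne.image _)

theorem exists_mem_normalizedMultipliers {V : Type*} {L : V → (ι → ℝ) × (κ → ℝ)}
    {k ab : (ι → ℝ) × (κ → ℝ)} (hne : ab ≠ 0) (hpos : ∀ i, 0 ≤ ab.1 i)
    (hL : ∀ q, pairing ab (L q) = 0) (hk : 0 ≤ pairing ab k) :
    ∃ ab ∈ normalizedMultipliers L, 0 ≤ pairing ab k := by
  set N := ∑ i, |ab.1 i| + ∑ j, |ab.2 j| with hN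
  have hN0 : 0 < N := (norm_pos_iff.2 hne).trans_le (norm_le_sum_abs_add_sum_abs ab)
  refine ⟨N⁻¹ • ab, ⟨?_, fun i => ?_, fun q => ?_⟩, ?_⟩
  · simp only [Prod.smul_fst, Prod.smul_snd, Pi.smul_apply, smul_eq_mul, abs_mul,
      abs_of_pos (inv_pos.2 hN0), ← Finset.mul_sum]
    rw [← mul_add, ← hN, inv_mul_cancel₀ hN0.ne']
  · exact mul_nonneg (inv_nonneg.2 hN0.le) (hpos i)
  · rw [smul_pairing, hL, mul_zero]
  · rw [smul_pairing]; exact mul_nonneg (inv_nonneg.2 hN0.le) hk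

theorem nonneg_of_forall_add_mul_pos {a c : ℝ} (h : ∀ t > 0, 0 < c + t * a) : 0 ≤ c := by
  have htendsto : Tendsto (fun t => c + t * a) (𝓝[>] 0) (𝓝 c) :=
    (Continuous.tendsto' (by fun_prop) 0 c (by simp)).mono_left nhdsWithin_le_nhds
  exact ge_of_tendsto htendsto (eventually_mem_nhdsWithin.mono fun t ht => (h t ht).le)

theorem exists_nonneg_functional_of_neg_notMem_cone {W : Type*} [NormedAddCommGroup W]
    [NormedSpace ℝ W] {D : Set W} (hconvex : Convex ℝ D) (hopen : IsOpen D) (hne : D.Nonempty)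
    (hcone : ∀ r : ℝ, 0 < r → ∀ z ∈ D, r • z ∈ D) {k : W} (hk : -k ∉ D) :
    ∃ f : StrongDual ℝ W, f ≠ 0 ∧ (∀ z ∈ D, 0 ≤ f z) ∧ 0 ≤ f k := by
  obtain ⟨g, hg⟩ := geometric_hahn_banach_open_point hconvex hopen hk
  have hray : ∀ z ∈ D, ∀ t > 0, 0 < -g k + t * -g z := fun z hz t ht => by
    have := hg _ (hcone t ht z hz)
    rw [map_smul, map_neg, smul_eq_mul] at this
    linarith
  obtain ⟨z₀, hz₀⟩ := hne
  refine ⟨-g, fun h0 => ?_, fun z hz => ?_, nonneg_of_forall_add_mul_pos (hray z₀ hz₀)⟩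
  · have := hg z₀ hz₀
    simp [neg_eq_zero.1 h0] at this
  · refine nonneg_of_forall_add_mul_pos (a := -g k) fun t ht => ?_
    have := mul_pos ht (hray z hz t⁻¹ (inv_pos.2 ht))
    rwa [mul_add, mul_inv_cancel_left₀ ht.ne', add_comm] at this

variable {V : Type*} [AddCommGroup V] [Module ℝ V] (L : V →ₗ[ℝ] (ι → ℝ) × (κ → ℝ))

theorem exists_mem_normalizedMultipliers_of_surjective {k : (ι → ℝ) × (κ → ℝ)}
    (hL : Function.Surjective fun q => (L q).2) (hk : -k ∉ strictEpigraph L) :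
    ∃ ab ∈ normalizedMultipliers L, 0 ≤ pairing ab k := by
  classical
  have hone : ((fun _ => 1, 0) : (ι → ℝ) × (κ → ℝ)) ∈ strictEpigraph L :=
    ⟨0, by simp, by simp⟩
  obtain ⟨f, hf0, hfD, hfk⟩ := exists_nonneg_functional_of_neg_notMem_cone
    (convex_strictEpigraph L) (isOpen_strictEpigraph L hL) ⟨_, hone⟩
    (fun r hr z => smul_mem_strictEpigraph L hr) hk
  have hclosure : ∀ z ∈ closure (strictEpigraph L), 0 ≤ f z := fun z hz =>
    closure_minimal hfD (isClosed_Ici.preimage f.continuous) hz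
  have hrange : ∀ q, 0 ≤ f (L q) := fun q =>
    hclosure _ (mem_closure_strictEpigraph L (fun _ => le_rfl) rfl)
  obtain ⟨ab, hab⟩ := exists_pairing_eq f.toLinearMap
  change ∀ z, f z = pairing ab z at hab
  refine exists_mem_normalizedMultipliers (ab := ab) ?_ (fun i => ?_) (fun q => ?_) (hab k ▸ hfk)
  · rintro rfl
    exact hf0 (ContinuousLinearMap.ext fun z => by simp [hab, pairing])
  · have hsingle : ((Pi.single i 1, 0) : (ι → ℝ) × (κ → ℝ)) ∈ closure (strictEpigraph L) :=
      mem_closure_strictEpigraph L (q := 0)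
        (fun j => by rw [map_zero]; exact (Pi.single_nonneg.2 zero_le_one : 0 ≤ Pi.single i 1) j)
        (by simp)
    simpa [hab, pairing] using hclosure _ hsingle
  · rw [← hab]
    have := hrange (-q)
    rw [map_neg, map_neg] at this
    exact le_antisymm (neg_nonneg.1 this) (hrange q)

theorem exists_mem_normalizedMultipliers_of_not_surjective (k : (ι → ℝ) × (κ → ℝ))
    (hL : ¬Function.Surjective fun q => (L q).2) :
    ∃ ab ∈ normalizedMultipliers L, 0 ≤ pairing ab k := by
  classical
  let L₂ : V →ₗ[ℝ] κ → ℝ := LinearMap.snd ℝ _ _ ∘ₗ L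
  have hlt : LinearMap.range L₂ < ⊤ :=
    lt_top_iff_ne_top.2 fun htop => hL (LinearMap.range_eq_top.1 htop)
  obtain ⟨f, hf0, hf⟩ := (LinearMap.range L₂).exists_le_ker_of_lt_top hlt
  obtain ⟨β, rfl⟩ := (dotProductEquiv ℝ κ).surjective f
  have hβ : β ≠ 0 := by
    rintro rfl
    exact hf0 (map_zero _)
  have hβL : ∀ q, β ⬝ᵥ (L q).2 = 0 := fun q => hf ⟨q, rfl⟩
  have hsign : ∀ r : ℝ, r ≠ 0 → 0 ≤ r * (β ⬝ᵥ k.2) →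
      ∃ ab ∈ normalizedMultipliers L, 0 ≤ pairing ab k := fun r hr hrk =>
    exists_mem_normalizedMultipliers (ab := (0, r • β))
      (fun h0 => smul_ne_zero hr hβ (congrArg Prod.snd h0)) (fun _ => le_rfl)
      (fun q => by rw [pairing, zero_dotProduct, smul_dotProduct, hβL, smul_zero, add_zero])
      (by rwa [pairing, zero_dotProduct, smul_dotProduct, zero_add])
  rcases le_total 0 (β ⬝ᵥ k.2) with hk | hk
  · exact hsign 1 one_ne_zero (by linarith)
  · exact hsign (-1) (by norm_num) (by linarith)

theorem exists_mem_normalizedMultipliers_of_not_solvable (k : (ι → ℝ) × (κ → ℝ))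
    (h : Function.Surjective (fun q => (L q).2) →
      ¬∃ q, (∀ i, (L q).1 i + k.1 i < 0) ∧ (L q).2 + k.2 = 0) :
    ∃ ab ∈ normalizedMultipliers L, 0 ≤ pairing ab k := by
  by_cases hL : Function.Surjective fun q => (L q).2
  · refine exists_mem_normalizedMultipliers_of_surjective L hL ?_
    rintro ⟨q, hlt, heq⟩
    exact h hL ⟨q, fun i => lt_neg_iff_add_neg.1 (hlt i), eq_neg_iff_add_eq_zero.1 heq⟩
  · exact exists_mem_normalizedMultipliers_of_not_surjective L k hL

theorem isClosed_setOf_exists_mem_normalizedMultipliers {V : Type*} (L : V → (ι → ℝ) × (κ → ℝ)) :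
    IsClosed {k | ∃ ab ∈ normalizedMultipliers L, 0 ≤ pairing ab k} := by
  have := isCompact_iff_compactSpace.1 (isCompact_normalizedMultipliers L)
  have hclosed : IsClosed {p : normalizedMultipliers L × ((ι → ℝ) × (κ → ℝ)) |
      0 ≤ pairing p.1.1 p.2} :=
    isClosed_le continuous_const
      (continuous_pairing.comp (continuous_subtype_val.prodMap continuous_id))
  convert! isClosedMap_snd_of_compactSpace _ hclosed
  ext k
  simp

theorem normalizedMultipliers_subset_of_dense {V : Type*} [NormedAddCommGroup V]
    [NormedSpace ℝ V] {D : Submodule ℝ V} (hD : Dense (D : Set V))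
    (A : V →L[ℝ] (ι → ℝ) × (κ → ℝ)) :
    normalizedMultipliers (fun d : D => A d) ⊆ normalizedMultipliers A := fun ab hab => by
  have hclosed : IsClosed {q | pairing ab (A q) = 0} :=
    isClosed_eq (continuous_pairing.comp (continuous_const.prodMk A.continuous)) continuous_const
  exact ⟨hab.1, hab.2.1, fun q =>
    closure_minimal (fun d hd => hab.2.2 ⟨d, hd⟩) hclosed (hD q)⟩

end Duality

theorem mem_closure_fiber {V W : Type*} [NormedAddCommGroup V] [NormedSpace ℝ V]
    [NormedAddCommGroup W] [NormedSpace ℝ W] [FiniteDimensional ℝ W] {D : Submodule ℝ V}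
    (hD : Dense (D : Set V)) (A : V →L[ℝ] W) (v : V) :
    v ∈ closure {d | d ∈ D ∧ A d = A v} := by
  let A' : D →ₗ[ℝ] W := A.toLinearMap ∘ₗ D.subtype
  obtain ⟨r₀, hr₀⟩ := A'.rangeRestrict.exists_rightInverse_of_surjective
    (LinearMap.range_rangeRestrict _)
  obtain ⟨r, hr⟩ := LinearMap.exists_extend r₀
  have hAr : ∀ y ∈ LinearMap.range A', A (r y) = y := fun y hy => by
    rw [show r y = r₀ ⟨y, hy⟩ from LinearMap.congr_fun hr ⟨y, hy⟩]
    exact congrArg Subtype.val (LinearMap.congr_fun hr₀ ⟨y, hy⟩)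
  have hrange : ∀ x, A x ∈ LinearMap.range A' := fun x => by
    rw [← SetLike.mem_coe, ← (Submodule.closed_of_finiteDimensional _).closure_eq]
    exact map_mem_closure A.continuous (hD x) fun d hd => ⟨⟨d, hd⟩, rfl⟩
  -- Correcting an approximation `x ∈ D` of `v` by `r` moves it into the fiber.
  let correct : V → V := fun x => x + r (A v - A x)
  have hcont : Continuous correct :=
    continuous_id.add ((continuous_subtype_val.comp r.continuous_of_finiteDimensional).comp
      (continuous_const.sub A.continuous))
  have hv : correct v = v := by simp [correct]
  rw [← hv]
  refine map_mem_closure hcont (hD v) fun d hd => ⟨D.add_mem hd (r _).2, ?_⟩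
  simp only [correct, map_add, sub_self, map_zero, ZeroMemClass.coe_zero, add_zero]
  rw [hAr _ ((LinearMap.range A').sub_mem (hrange v) (hrange d)), add_sub_cancel]

section BoundedDirections

variable {E C : Type*} [NormedAddCommGroup E] [NormedSpace ℝ E] [NormedAddCommGroup C]
  [NormedSpace ℝ C] {T : ℝ}

theorem dense_boundedDirections :
    Dense (boundedDirections E C T : Set (E × Lp C 2 (timeMeasure T))) := by
  rintro ⟨ξ, c⟩
  refine map_mem_closure (f := fun c => (ξ, c)) (by fun_prop)
    (Lp.simpleFunc.dense (by norm_num) c) fun f hf => ?_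
  obtain ⟨M, hM⟩ := SimpleFunc.exists_forall_norm_le (Lp.simpleFunc.toSimpleFunc ⟨f, hf⟩)
  refine ⟨M, ?_⟩
  filter_upwards [Lp.simpleFunc.toSimpleFunc_eq_toFun ⟨f, hf⟩] with t ht
  exact ht ▸ hM t

theorem exists_forall_ae_norm_le_mul_norm {Y : Type*} [NormedAddCommGroup Y] [NormedSpace ℝ Y]
    [FiniteDimensional ℝ Y] (S : Y →ₗ[ℝ] boundedDirections E C T) :
    ∃ M : ℝ, 0 ≤ M ∧ ∀ y, ∀ᵐ t ∂timeMeasure T, ‖(S y).1.2 t‖ ≤ M * ‖y‖ := by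
  have hmem : ∀ y, MemLp (S y).1.2 ⊤ (timeMeasure T) := fun y => by
    obtain ⟨M, hM⟩ := (S y).2
    exact memLp_top_of_bound (Lp.aestronglyMeasurable _) M hM
  let J : Y →ₗ[ℝ] Lp C ⊤ (timeMeasure T) :=
    { toFun := fun y => (hmem y).toLp
      map_add' := fun y z => by
        rw [← MemLp.toLp_add]
        refine MemLp.toLp_congr _ _ ?_
        rw [map_add]
        exact Lp.coeFn_add _ _
      map_smul' := fun a y => by
        rw [RingHom.id_apply, ← MemLp.toLp_const_smul]
        refine MemLp.toLp_congr _ _ ?_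
        rw [map_smul]
        exact Lp.coeFn_smul _ _ }
  refine ⟨‖J.toContinuousLinearMap‖, norm_nonneg _, fun y => ?_⟩
  filter_upwards [ae_norm_le_norm_Lp_top (J y), (hmem y).coeFn_toLp] with t hnorm hcoe
  rw [← hcoe]
  exact hnorm.trans (J.toContinuousLinearMap.le_opNorm y)

end BoundedDirections

namespace ReferenceTrajectory

variable {E C : Type*} [NormedAddCommGroup E] [NormedSpace ℝ E] [NormedAddCommGroup C]
  [NormedSpace ℝ C] {T : ℝ} (R : ReferenceTrajectory E C T)

/-- No trajectory within uniform distance `ε` of the reference trajectory and with the same value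
of `H` decreases all components of `Φ` strictly. -/
def IsWeakParetoMin {ι κ : Type*} (Φ : E × E → ι → ℝ) (H : E × E → κ → ℝ) (ε : ℝ) : Prop :=
  ∀ x c, R.IsNearbyTrajectory ε x c →
    H (endpointsL R.nonneg E x) = H (endpointsL R.nonneg E R.x) →
      ¬∀ i, Φ (endpointsL R.nonneg E x) i < Φ (endpointsL R.nonneg E R.x) i

variable [FiniteDimensional ℝ E] [FiniteDimensional ℝ C] {ι κ : Type*} [Fintype ι] [Fintype κ]
  {Φ : E × E → ι → ℝ} (hΦ : ContDiff ℝ 2 Φ) {H : E × E → κ → ℝ} (hH : ContDiff ℝ 2 H)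
  {ε : ℝ} (hε : 0 < ε) (hmin : R.IsWeakParetoMin Φ H ε)

include hΦ hH hε hmin

theorem exists_multiplier_of_mem_boundedDirections {q : E × Lp C 2 (timeMeasure T)}
    (hq : q ∈ boundedDirections E C T) (hqH : R.linearization H q = 0)
    (hqΦ : ∀ i, R.linearization Φ q i ≤ 0) :
    ∃ ab ∈ normalizedMultipliers fun q => (R.linearization Φ q, R.linearization H q),
      0 ≤ pairing ab (R.curvature Φ q, R.curvature H q) := by
  let A := (R.linearization Φ).prod (R.linearization H)
  obtain ⟨ab, hab, hk⟩ := exists_mem_normalizedMultipliers_of_not_solvable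
    (A.toLinearMap ∘ₗ (boundedDirections E C T).subtype) (R.curvature Φ q, R.curvature H q) (by
      rintro hsurj ⟨q₁, hq₁Φ, hq₁H⟩
      obtain ⟨S, hS⟩ := LinearMap.exists_rightInverse_of_surjective
        ((R.linearization H).toLinearMap ∘ₗ (boundedDirections E C T).subtype)
        (LinearMap.range_eq_top.2 hsurj)
      obtain ⟨M, hM0, hM⟩ := exists_forall_ae_norm_le_mul_norm S
      obtain ⟨x, c, hx, hHx, hΦx⟩ := R.exists_nearbyTrajectory_decrease hΦ hH
        (S := ((boundedDirections E C T).subtype ∘ₗ S).toContinuousLinearMap)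
        (LinearMap.congr_fun hS) hM0 hM hq q₁.2 hqH hq₁H hqΦ hq₁Φ hε
      exact hmin x c hx hHx hΦx)
  exact ⟨ab, normalizedMultipliers_subset_of_dense dense_boundedDirections A hab, hk⟩

theorem exists_multiplier {q : E × Lp C 2 (timeMeasure T)} (hqH : R.linearization H q = 0)
    (hqΦ : ∀ i, R.linearization Φ q i ≤ 0) :
    ∃ ab ∈ normalizedMultipliers fun q => (R.linearization Φ q, R.linearization H q),
      0 ≤ pairing ab (R.curvature Φ q, R.curvature H q) := by
  have hcurvature : Continuous fun q => (R.curvature Φ q, R.curvature H q) :=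
    (R.continuous_curvature Φ).prodMk (R.continuous_curvature H)
  refine (isClosed_setOf_exists_mem_normalizedMultipliers _).closure_subset
    (map_mem_closure (f := fun q => (R.curvature Φ q, R.curvature H q)) hcurvature
      (mem_closure_fiber dense_boundedDirections
        ((R.linearization Φ).prod (R.linearization H)) q) ?_)
  rintro q₀ ⟨hq₀, hA⟩
  obtain ⟨hAΦ, hAH⟩ := Prod.ext_iff.1 hA
  exact R.exists_multiplier_of_mem_boundedDirections hΦ hH hε hmin hq₀ (hAH.trans hqH)
    fun i => (congrFun hAΦ i).trans_le (hqΦ i)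

end ReferenceTrajectory

section IntegrationByParts

variable {T : ℝ}

theorem integral_mul_add_mul_of_eq_integral (hT : 0 ≤ T) {f k a b : ℝ → ℝ}
    (ha : Integrable a (timeMeasure T)) (hb : Integrable b (timeMeasure T))
    (hf : ∀ t ∈ Icc 0 T, f t = f 0 + ∫ s in (0 : ℝ)..t, a s)
    (hk : ∀ t ∈ Icc 0 T, k t = k 0 + ∫ s in (0 : ℝ)..t, b s) :
    ∫ t, (a t * k t + f t * b t) ∂timeMeasure T = f T * k T - f 0 * k 0 := by
  have ha' := (intervalIntegrable_iff_timeMeasure hT).2 ha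
  have hb' := (intervalIntegrable_iff_timeMeasure hT).2 hb
  have habsolutely : ∀ {a : ℝ → ℝ} (r : ℝ), IntervalIntegrable a volume 0 T →
      AbsolutelyContinuousOnInterval (fun t => r + ∫ s in (0 : ℝ)..t, a s) 0 T := fun r ha =>
    (LipschitzWith.const r).lipschitzOnWith.absolutelyContinuousOnInterval.add
      (ha.absolutelyContinuousOnInterval_intervalIntegral (c := 0) (by simp))
  have hderiv : ∀ {a : ℝ → ℝ} (r : ℝ), IntervalIntegrable a volume 0 T →
      ∀ᵐ t ∂timeMeasure T, t ∈ uIcc 0 T →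
        deriv (fun t => r + ∫ s in (0 : ℝ)..t, a s) t = a t := fun r ha =>
    ae_restrict_of_ae (ha.ae_hasDerivAt_integral.mono fun t ht htT =>
      ((ht htT 0 (by simp)).const_add r).deriv)
  have hparts := (habsolutely (f 0) ha').integral_deriv_mul_eq_sub (habsolutely (k 0) hb')
  have h0 : (0 : ℝ) ∈ Icc 0 T := ⟨le_rfl, hT⟩
  have hTT : T ∈ Icc 0 T := ⟨hT, le_rfl⟩
  rw [← hf T hTT, ← hk T hTT, ← hf 0 h0, ← hk 0 h0, intervalIntegral_eq_timeMeasure hT] at hparts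
  rw [← hparts]
  refine integral_congr_ae ?_
  filter_upwards [hderiv (f 0) ha', hderiv (k 0) hb', ae_timeMeasure_mem T] with t hft hkt ht
  have ht' : t ∈ uIcc 0 T := uIcc_of_le hT ▸ ht
  rw [hft ht', hkt ht', ← hf t ht, ← hk t ht]

variable {E F : Type*} [NormedAddCommGroup E] [NormedSpace ℝ E] [NormedAddCommGroup F]
  [NormedSpace ℝ F] {x g : ℝ → E}

theorem continuousOn_of_eq_integral (hg : Integrable g (timeMeasure T))
    (hx : ∀ t ∈ Icc 0 T, x t = x 0 + ∫ s in (0 : ℝ)..t, g s) : ContinuousOn x (Icc 0 T) :=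
  (continuousOn_const.add (continuousOn_primitive_timeMeasure hg)).congr hx

theorem map_eq_integral [CompleteSpace E] [CompleteSpace F] (hT : 0 ≤ T) (L : E →L[ℝ] F)
    (hg : Integrable g (timeMeasure T))
    (hx : ∀ t ∈ Icc 0 T, x t = x 0 + ∫ s in (0 : ℝ)..t, g s) :
    ∀ t ∈ Icc 0 T, L (x t) = L (x 0) + ∫ s in (0 : ℝ)..t, L (g s) := fun t ht => by
  rw [L.intervalIntegral_comp_comm (intervalIntegrable_of_timeMeasure hg ⟨le_rfl, hT⟩ ht),
    ← map_add, ← hx t ht]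

theorem integral_dual_apply_of_eq_integral [FiniteDimensional ℝ E] (hT : 0 ≤ T)
    {p h : ℝ → E →L[ℝ] ℝ} (hg : Integrable g (timeMeasure T)) (hh : Integrable h (timeMeasure T))
    (hx : ∀ t ∈ Icc 0 T, x t = x 0 + ∫ s in (0 : ℝ)..t, g s)
    (hp : ∀ t ∈ Icc 0 T, p t = p 0 + ∫ s in (0 : ℝ)..t, h s) :
    ∫ t, (h t (x t) + p t (g t)) ∂timeMeasure T = p T (x T) - p 0 (x 0) := by
  have := FiniteDimensional.complete ℝ E
  let b := Module.finBasis ℝ E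
  let coord := fun i => (b.coord i).toContinuousLinearMap
  let eval := fun i => ContinuousLinearMap.apply ℝ ℝ (b i)
  have hexpand : ∀ (r : E →L[ℝ] ℝ) (y : E), r y = ∑ i, eval i r * coord i y := fun r y => by
    simpa [eval, coord] using
      (LinearMap.congr_fun (b.sum_dual_apply_smul_coord r.toLinearMap) y).symm
  have hcoord := fun i => (coord i).integrable_comp hg
  have heval := fun i => (eval i).integrable_comp hh
  have hintegrable : ∀ i, Integrable (fun t => eval i (h t) * coord i (x t) +
      eval i (p t) * coord i (g t)) (timeMeasure T) := fun i =>
    (IntegrableOn.mul_continuousOn (heval i)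
      ((coord i).continuous.comp_continuousOn (continuousOn_of_eq_integral hg hx))
      isCompact_Icc).add
    (IntegrableOn.continuousOn_mul
      ((eval i).continuous.comp_continuousOn (continuousOn_of_eq_integral hh hp)) (hcoord i)
      isCompact_Icc)
  calc ∫ t, (h t (x t) + p t (g t)) ∂timeMeasure T
      = ∫ t, ∑ i, (eval i (h t) * coord i (x t) + eval i (p t) * coord i (g t))
        ∂timeMeasure T := by simp only [hexpand (h _), hexpand (p _), Finset.sum_add_distrib]
    _ = ∑ i, (eval i (p T) * coord i (x T) - eval i (p 0) * coord i (x 0)) := by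
      rw [integral_finsetSum _ fun i _ => hintegrable i]
      exact Finset.sum_congr rfl fun i _ => integral_mul_add_mul_of_eq_integral hT (heval i)
        (hcoord i) (map_eq_integral hT (eval i) hh hp) (map_eq_integral hT (coord i) hg hx)
    _ = p T (x T) - p 0 (x 0) := by
      rw [Finset.sum_sub_distrib, ← hexpand, ← hexpand]

theorem IccExtend_eq_integral (hT : 0 ≤ T) {x : C(Icc 0 T, E)} {ξ : E}
    (hg : Integrable g (timeMeasure T)) (hx : x = ContinuousMap.const _ ξ + primitive T g) :
    ∀ t ∈ Icc 0 T, IccExtend hT x t = IccExtend hT x 0 + ∫ s in (0 : ℝ)..t, g s := by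
  have hval : ∀ t ∈ Icc 0 T, IccExtend hT x t = ξ + ∫ s in (0 : ℝ)..t, g s := fun t ht => by
    rw [IccExtend_apply_of_mem hT x ht, hx, ContinuousMap.add_apply, primitive_apply hg]
    rfl
  intro t ht
  rw [hval t ht, hval 0 ⟨le_rfl, hT⟩, intervalIntegral.integral_same, add_zero]

end IntegrationByParts

theorem ae_eq_zero_of_forall_integral_apply_eq_zero {C : Type*} [NormedAddCommGroup C]
    [NormedSpace ℝ C] [FiniteDimensional ℝ C] {X : Type*} [MeasurableSpace X] {μ : Measure X}
    {f : X → C →L[ℝ] ℝ} (hf : Integrable f μ) (h : ∀ q : Lp C 2 μ, ∫ t, f t (q t) ∂μ = 0) :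
    f =ᵐ[μ] 0 := by
  let b := Module.finBasis ℝ C
  have hcoord : ∀ i, (fun t => f t (b i)) =ᵐ[μ] 0 := fun i => by
    refine ((ContinuousLinearMap.apply ℝ ℝ (b i)).integrable_comp
      hf).ae_eq_zero_of_forall_setIntegral_eq_zero fun s hs hμs => ?_
    rw [← h (indicatorConstLp 2 hs hμs.ne (b i)), ← integral_indicator hs]
    refine integral_congr_ae ?_
    filter_upwards [indicatorConstLp_coeFn (p := 2) (hs := hs) (hμs := hμs.ne) (c := b i)]
      with t ht
    rw [ht]
    by_cases hts : t ∈ s <;> simp [hts]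
  filter_upwards [ae_all_iff.2 hcoord] with t ht
  exact ContinuousLinearMap.coe_injective (b.ext ht)

namespace ReferenceTrajectory

variable {E C : Type*} [NormedAddCommGroup E] [NormedSpace ℝ E] [NormedAddCommGroup C]
  [NormedSpace ℝ C] {T : ℝ} (R : ReferenceTrajectory E C T)

/-- The right-hand side `-p F_x` of the adjoint equation. -/
def adjointRHS (p : C(Icc 0 T, E →L[ℝ] ℝ)) (t : ℝ) : E →L[ℝ] ℝ :=
  -(IccExtend R.nonneg p t ∘L (fderiv ℝ R.F (R.pt t) ∘L ContinuousLinearMap.inl ℝ E C))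

/-- The solutions of the adjoint equation `-ṗ = p F_x`. -/
def IsAdjoint (p : C(Icc 0 T, E →L[ℝ] ℝ)) : Prop :=
  p = ContinuousMap.const _ (p ⟨0, le_rfl, R.nonneg⟩) + primitive T (R.adjointRHS p)

theorem continuous_adjointCoeff : Continuous fun w => (-(ContinuousLinearMap.compL ℝ E E ℝ).flip)
    ((fderiv ℝ R.F w).comp (ContinuousLinearMap.inl ℝ E C)) :=
  (-(ContinuousLinearMap.compL ℝ E E ℝ).flip).continuous.comp
    (R.continuous_fderiv.clm_comp continuous_const)

theorem integral_adjoint_control_zero (p : C(Icc 0 T, E →L[ℝ] ℝ)) :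
    ∫ t, IccExtend R.nonneg p t (fderiv ℝ R.F (R.pt t) (0, (0 : Lp C 2 (timeMeasure T)) t))
      ∂timeMeasure T = 0 := by
  refine integral_eq_zero_of_ae ?_
  filter_upwards [Lp.coeFn_zero C 2 (timeMeasure T)] with t ht
  rw [ht, Pi.zero_apply, Prod.mk_zero_zero, map_zero, map_zero, Pi.zero_apply]

variable [FiniteDimensional ℝ E] [FiniteDimensional ℝ C]

/-- The coefficient `p ↦ -p F_x` of the adjoint equation. -/
def adjointCoeff : Lp ((E →L[ℝ] ℝ) →L[ℝ] E →L[ℝ] ℝ) ⊤ (timeMeasure T) :=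
  (R.memLp_comp_pt (Y := (E →L[ℝ] ℝ) →L[ℝ] E →L[ℝ] ℝ) R.continuous_adjointCoeff ⊤).toLp

theorem coeFn_adjointCoeff_apply (p : C(Icc 0 T, E →L[ℝ] ℝ)) :
    (fun t => R.adjointCoeff t (IccExtend R.nonneg p t)) =ᵐ[timeMeasure T] R.adjointRHS p := by
  filter_upwards [(R.memLp_comp_pt (Y := (E →L[ℝ] ℝ) →L[ℝ] E →L[ℝ] ℝ)
    R.continuous_adjointCoeff ⊤).coeFn_toLp] with t ht
  rw [adjointCoeff, ht]
  rfl

theorem memLp_adjointRHS (p : C(Icc 0 T, E →L[ℝ] ℝ)) :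
    MemLp (R.adjointRHS p) ⊤ (timeMeasure T) :=
  ((ContinuousLinearMap.compL ℝ E E ℝ).memLp_of_bilin ⊤ (memLp_IccExtend R.nonneg p ⊤)
    (R.memLp_fderiv_comp (ContinuousLinearMap.inl ℝ E C) ⊤)).neg

theorem integrable_adjointRHS (p : C(Icc 0 T, E →L[ℝ] ℝ)) :
    Integrable (R.adjointRHS p) (timeMeasure T) :=
  (R.memLp_adjointRHS p).integrable le_top

theorem exists_isAdjoint (p₀ : E →L[ℝ] ℝ) :
    ∃ p, R.IsAdjoint p ∧ p ⟨0, le_rfl, R.nonneg⟩ = p₀ := by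
  set p := volterraResolvent R.nonneg R.adjointCoeff (ContinuousMap.const _ p₀)
  have heq : p = ContinuousMap.const _ p₀ + primitive T (R.adjointRHS p) := by
    rw [← primitive_congr (R.coeFn_adjointCoeff_apply p), ← volterra_eq_primitive]
    exact volterraResolvent_eq R.nonneg R.adjointCoeff _
  have hp0 : p ⟨0, le_rfl, R.nonneg⟩ = p₀ := by
    rw [heq, ContinuousMap.add_apply, primitive_zero R.nonneg, add_zero, ContinuousMap.const_apply]
  refine ⟨p, ?_, hp0⟩
  rwa [IsAdjoint, hp0]

theorem adjoint_apply_sub_apply {p : C(Icc 0 T, E →L[ℝ] ℝ)} (hp : R.IsAdjoint p)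
    {x : C(Icc 0 T, E)} {ξ : E} {r : ℝ → E} (hr : Integrable r (timeMeasure T))
    (hx : x = ContinuousMap.const _ ξ +
      primitive T (fun t => fderiv ℝ R.F (R.pt t) (IccExtend R.nonneg x t, 0) + r t)) :
    p ⟨T, R.nonneg, le_rfl⟩ (x ⟨T, R.nonneg, le_rfl⟩) -
        p ⟨0, le_rfl, R.nonneg⟩ (x ⟨0, le_rfl, R.nonneg⟩) =
      ∫ t, IccExtend R.nonneg p t (r t) ∂timeMeasure T := by
  have hrate : Integrable (fun t => fderiv ℝ R.F (R.pt t) (IccExtend R.nonneg x t, 0) + r t)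
      (timeMeasure T) := (R.integrable_stateCoeff x).add hr
  have hparts := integral_dual_apply_of_eq_integral R.nonneg hrate (R.integrable_adjointRHS p)
    (IccExtend_eq_integral R.nonneg hrate hx)
    (IccExtend_eq_integral R.nonneg (R.integrable_adjointRHS p) hp)
  simp only [IccExtend_apply_of_mem R.nonneg _ (⟨R.nonneg, le_rfl⟩ : T ∈ Icc 0 T),
    IccExtend_apply_of_mem R.nonneg _ (⟨le_rfl, R.nonneg⟩ : (0 : ℝ) ∈ Icc 0 T)] at hparts
  rw [← hparts]
  congr 1 with t
  simp [adjointRHS]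

theorem adjoint_apply_linearizedState {p : C(Icc 0 T, E →L[ℝ] ℝ)} (hp : R.IsAdjoint p)
    (q : E × Lp C 2 (timeMeasure T)) :
    p ⟨T, R.nonneg, le_rfl⟩ (R.linearizedState q ⟨T, R.nonneg, le_rfl⟩) -
        p ⟨0, le_rfl, R.nonneg⟩ q.1 =
      ∫ t, IccExtend R.nonneg p t (fderiv ℝ R.F (R.pt t) (0, q.2 t)) ∂timeMeasure T := by
  have hsplit : (fun t => fderiv ℝ R.F (R.pt t)
      (IccExtend R.nonneg (R.linearizedState q) t, q.2 t)) = fun t =>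
      fderiv ℝ R.F (R.pt t) (IccExtend R.nonneg (R.linearizedState q) t, 0) +
        fderiv ℝ R.F (R.pt t) (0, q.2 t) := by
    funext t
    rw [← map_add, Prod.mk_add_mk, add_zero, zero_add]
  have heq := R.linearizedState_eq q
  rw [hsplit] at heq
  rw [← R.adjoint_apply_sub_apply hp (R.integrable_forcing q.2) heq, linearizedState_zero]

theorem adjoint_apply_secondOrderState {p : C(Icc 0 T, E →L[ℝ] ℝ)} (hp : R.IsAdjoint p)
    (q : E × Lp C 2 (timeMeasure T)) :
    p ⟨T, R.nonneg, le_rfl⟩ (R.secondOrderState q ⟨T, R.nonneg, le_rfl⟩) =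
      ∫ t, IccExtend R.nonneg p t ((1 / 2 : ℝ) • fderiv ℝ (fderiv ℝ R.F) (R.pt t)
        (IccExtend R.nonneg (R.linearizedState q) t, q.2 t)
        (IccExtend R.nonneg (R.linearizedState q) t, q.2 t)) ∂timeMeasure T := by
  have heq := (R.secondOrderState_eq q).trans (zero_add _).symm
  rw [← R.adjoint_apply_sub_apply hp (ξ := 0) (R.integrable_quadraticTerm q) heq,
    secondOrderState_zero, map_zero, sub_zero]

theorem surjective_linearizedState_end :
    Function.Surjective fun ξ : E => R.linearizedState (ξ, 0) ⟨T, R.nonneg, le_rfl⟩ := by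
  let Ψ : E →ₗ[ℝ] E := ((ContinuousMap.evalCLM ℝ (⟨T, R.nonneg, le_rfl⟩ : Icc 0 T)) ∘L
    R.linearizedState ∘L ContinuousLinearMap.inl ℝ E (Lp C 2 (timeMeasure T))).toLinearMap
  -- In finite dimension injectivity suffices; it follows by duality, because every functional is
  -- the initial value of an adjoint state.
  refine (LinearMap.injective_iff_surjective (f := Ψ)).1
    (LinearMap.ker_eq_bot.1 (LinearMap.ker_eq_bot'.2 fun ξ hξ => ?_))
  change R.linearizedState (ξ, 0) ⟨T, R.nonneg, le_rfl⟩ = 0 at hξ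
  refine SeparatingDual.eq_zero_of_forall_dual_eq_zero (R := ℝ) fun π => ?_
  obtain ⟨p, hp, hp0⟩ := R.exists_isAdjoint π
  have hpair := R.adjoint_apply_linearizedState hp (ξ, 0)
  rwa [R.integral_adjoint_control_zero, hp0, hξ, map_zero, zero_sub, neg_eq_zero] at hpair

theorem ae_forall_adjoint_control_eq_zero {p : C(Icc 0 T, E →L[ℝ] ℝ)}
    (h : ∀ c : Lp C 2 (timeMeasure T),
      ∫ t, IccExtend R.nonneg p t (fderiv ℝ R.F (R.pt t) (0, c t)) ∂timeMeasure T = 0) :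
    ∀ᵐ t ∂timeMeasure T, ∀ c, IccExtend R.nonneg p t (fderiv ℝ R.F (R.pt t) (0, c)) = 0 := by
  have hintegrable : Integrable (fun t => IccExtend R.nonneg p t ∘L
      (fderiv ℝ R.F (R.pt t)).comp (ContinuousLinearMap.inr ℝ E C)) (timeMeasure T) :=
    ((ContinuousLinearMap.compL ℝ C E ℝ).memLp_of_bilin ⊤ (memLp_IccExtend R.nonneg p ⊤)
      (R.memLp_fderiv_comp _ ⊤)).integrable le_top
  filter_upwards [ae_eq_zero_of_forall_integral_apply_eq_zero hintegrable h] with t ht c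
  exact DFunLike.congr_fun ht c

theorem exists_costate {d₀ d₁ : E →L[ℝ] ℝ}
    (hd : ∀ q, d₀ q.1 + d₁ (R.linearizedState q ⟨T, R.nonneg, le_rfl⟩) = 0) :
    ∃ p, R.IsAdjoint p ∧ p ⟨0, le_rfl, R.nonneg⟩ = -d₀ ∧ p ⟨T, R.nonneg, le_rfl⟩ = d₁ ∧
      ∀ᵐ t ∂timeMeasure T, ∀ c, IccExtend R.nonneg p t (fderiv ℝ R.F (R.pt t) (0, c)) = 0 := by
  obtain ⟨p, hp, hp0⟩ := R.exists_isAdjoint (-d₀)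
  have hpair : ∀ q, p ⟨T, R.nonneg, le_rfl⟩ (R.linearizedState q ⟨T, R.nonneg, le_rfl⟩) -
      d₁ (R.linearizedState q ⟨T, R.nonneg, le_rfl⟩) =
      ∫ t, IccExtend R.nonneg p t (fderiv ℝ R.F (R.pt t) (0, q.2 t)) ∂timeMeasure T := fun q => by
    rw [← R.adjoint_apply_linearizedState hp, hp0, neg_apply]
    linarith [hd q]
  have hpT : p ⟨T, R.nonneg, le_rfl⟩ = d₁ := by
    ext y
    obtain ⟨ξ, rfl⟩ := R.surjective_linearizedState_end y
    exact sub_eq_zero.1 ((hpair (ξ, 0)).trans (R.integral_adjoint_control_zero p))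
  refine ⟨p, hp, hp0, hpT, R.ae_forall_adjoint_control_eq_zero fun c => ?_⟩
  rw [← hpair (0, c), hpT, sub_self]

end ReferenceTrajectory

section Sobolev

variable {E : Type*} [NormedAddCommGroup E] {T : ℝ} {x : ℝ → E}

/-- The restriction of a function to `[0, T]` as a continuous function. -/
def restrictIcc (hx : ContinuousOn x (Icc 0 T)) : C(Icc 0 T, E) :=
  ⟨fun t => x t, continuousOn_iff_continuous_domRestrict.1 hx⟩

theorem restrictIcc_apply (hx : ContinuousOn x (Icc 0 T)) (t : Icc 0 T) :
    restrictIcc hx t = x t := rfl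

theorem IccExtend_restrictIcc (hT : 0 ≤ T) (hx : ContinuousOn x (Icc 0 T)) {t : ℝ}
    (ht : t ∈ Icc 0 T) : IccExtend hT (restrictIcc hx) t = x t :=
  IccExtend_apply_of_mem hT _ ht

variable [NormedSpace ℝ E]

theorem MemW1.continuousOn {p : ENNReal} (hp : 1 ≤ p) (hx : MemW1 p T x) :
    ContinuousOn x (Icc 0 T) := by
  obtain ⟨g, hg, hxg⟩ := hx
  exact continuousOn_of_eq_integral (hg.integrable hp) hxg

theorem restrictIcc_eq_primitive {g : ℝ → E} (hx : ContinuousOn x (Icc 0 T))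
    (hg : Integrable g (timeMeasure T))
    (hxg : ∀ t ∈ Icc 0 T, x t = x 0 + ∫ s in (0 : ℝ)..t, g s) :
    restrictIcc hx = ContinuousMap.const _ (x 0) + primitive T g := by
  ext t
  rw [ContinuousMap.add_apply, primitive_apply hg]
  exact hxg t t.2

variable [CompleteSpace E]

theorem ae_hasDerivAt_of_eq_integral {g : ℝ → E} (hg : Integrable g (timeMeasure T))
    (hx : ∀ t ∈ Icc 0 T, x t = x 0 + ∫ s in (0 : ℝ)..t, g s) :
    ∀ᵐ t ∂timeMeasure T, HasDerivAt x (g t) t := by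
  rcases le_or_gt 0 T with hT | hT
  · have hne : ∀ r : ℝ, ∀ᵐ t ∂timeMeasure T, t ≠ r := fun r =>
      ae_restrict_of_ae (compl_mem_ae_iff.2 (measure_singleton r))
    filter_upwards [ae_restrict_of_ae
      ((intervalIntegrable_iff_timeMeasure hT).2 hg).ae_hasDerivAt_integral,
      hne 0, hne T, ae_timeMeasure_mem T] with t hderiv ht0 htT ht
    rw [uIcc_of_le hT] at hderiv
    refine ((hderiv ht 0 ⟨le_rfl, hT⟩).const_add (x 0)).congr_of_eventuallyEq ?_
    filter_upwards [Icc_mem_nhds (ht.1.lt_of_ne' ht0) (ht.2.lt_of_ne htT)] with s hs using hx s hs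
  · rw [timeMeasure, Icc_eq_empty (not_le.2 hT), Measure.restrict_empty, ae_zero]
    exact eventually_bot

theorem MemW1.memLp_and_eq_integral {p : ENNReal} (hp : 1 ≤ p) {g : ℝ → E} (hx : MemW1 p T x)
    (hg : ∀ᵐ t ∂timeMeasure T, HasDerivAt x (g t) t) :
    MemLp g p (timeMeasure T) ∧ ∀ t ∈ Icc 0 T, x t = x 0 + ∫ s in (0 : ℝ)..t, g s := by
  obtain ⟨g₀, hg₀, hxg₀⟩ := hx
  have hae : g₀ =ᵐ[timeMeasure T] g := by
    filter_upwards [ae_hasDerivAt_of_eq_integral (hg₀.integrable hp) hxg₀, hg] with t ht₀ ht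
    exact ht₀.unique ht
  refine ⟨(memLp_congr_ae hae).1 hg₀, fun t ht => ?_⟩
  rw [← intervalIntegral_congr_timeMeasure hae ht]
  exact hxg₀ t ht

theorem MemW1.restrictIcc_eq_primitive {p : ENNReal} (hp : 1 ≤ p) {g : ℝ → E} (hx : MemW1 p T x)
    (hg : ∀ᵐ t ∂timeMeasure T, HasDerivAt x (g t) t) :
    restrictIcc (hx.continuousOn hp) = ContinuousMap.const _ (x 0) + primitive T g :=
  have ⟨hgLp, hxg⟩ := hx.memLp_and_eq_integral hp hg
  _root_.restrictIcc_eq_primitive _ (hgLp.integrable hp) hxg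

end Sobolev

theorem exists_ae_norm_le_of_memLp_top {α F : Type*} [MeasurableSpace α] {μ : Measure α}
    [NormedAddCommGroup F] {f : α → F} (hf : MemLp f ⊤ μ) : ∃ M : ℝ, ∀ᵐ a ∂μ, ‖f a‖ ≤ M := by
  refine ⟨‖hf.toLp‖, ?_⟩
  filter_upwards [ae_norm_le_norm_Lp_top hf.toLp, hf.coeFn_toLp] with a hnorm hcoe
  rwa [← hcoe]

theorem Triple.MemW.memLp_controls {n l m : ℕ} {p : ENNReal} {T : ℝ} {w : Triple n l m}
    (hw : w.MemW p T) : MemLp (fun t => (w.u t, w.v t)) p (timeMeasure T) :=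
  memLp_prod_iff.2 ⟨hw.2.1, hw.2.2⟩

theorem fderiv_clm_comp_fderiv_comp_apply {W X X' Y Z : Type*} [NormedAddCommGroup W]
    [NormedSpace ℝ W] [NormedAddCommGroup X] [NormedSpace ℝ X] [NormedAddCommGroup X']
    [NormedSpace ℝ X'] [NormedAddCommGroup Y] [NormedSpace ℝ Y] [NormedAddCommGroup Z]
    [NormedSpace ℝ Z] {F : W → Y} (hF : ContDiff ℝ 2 F) (π : Y →L[ℝ] Z) {j : X → W}
    {J : X →L[ℝ] W} {x : X} (hj : HasFDerivAt j J x) (K : X' →L[ℝ] W) (a : X) (b : X') :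
    fderiv ℝ (fun y => π.comp ((fderiv ℝ F (j y)).comp K)) x a b =
      π (fderiv ℝ (fderiv ℝ F) (j x) (J a) (K b)) := by
  have hF' : HasFDerivAt (fderiv ℝ F) (fderiv ℝ (fderiv ℝ F) (j x)) (j x) :=
    ((hF.fderiv_right (m := 1) (by norm_num)).differentiable (by norm_num) _).hasFDerivAt
  have hcomp := (ContinuousLinearMap.compL ℝ X' Y Z π).hasFDerivAt.comp x
    (((ContinuousLinearMap.compL ℝ X' W Y).flip K).hasFDerivAt.comp x (hF'.comp x hj))
  exact congr($(hcomp.fderiv) a b)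

namespace ControlProblem

variable {n l m dφ dη : ℕ} (P : ControlProblem n l m dφ dη)

/-- All data functions are twice continuously differentiable. -/
def IsC2 : Prop :=
  (∀ i, ContDiff ℝ 2 (P.f i)) ∧ (∀ i, ContDiff ℝ 2 (P.φ i)) ∧ ∀ j, ContDiff ℝ 2 (P.η j)

/-- The dynamics as a function of the pair of state and controls. -/
def dyn (w : Vec n × (Vec l × Vec m)) : Vec n := P.F w.1 w.2.1 w.2.2

/-- The cost and the functions of the inequality constraints, as one vector-valued map. -/
def Φ (z : Vec n × Vec n) (i : Fin (dφ + 1)) : ℝ := P.φ i z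

/-- The functions of the equality constraints, as one vector-valued map. -/
def eqs (z : Vec n × Vec n) (j : Fin dη) : ℝ := P.η j z

/-- The embedding of the state directions. -/
abbrev inX (n l m : ℕ) : Vec n →L[ℝ] Vec n × (Vec l × Vec m) := ContinuousLinearMap.inl ℝ _ _

/-- The embedding of the directions of the nonlinear controls. -/
abbrev inU (n l m : ℕ) : Vec l →L[ℝ] Vec n × (Vec l × Vec m) :=
  (ContinuousLinearMap.inr ℝ _ _).comp (ContinuousLinearMap.inl ℝ _ _)

/-- The embedding of the directions of the affine controls. -/
abbrev inV (n l m : ℕ) : Vec m →L[ℝ] Vec n × (Vec l × Vec m) :=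
  (ContinuousLinearMap.inr ℝ _ _).comp (ContinuousLinearMap.inr ℝ _ _)

theorem hasFDerivAt_inX (x : Vec n) (u : Vec l) (v : Vec m) :
    HasFDerivAt (fun y => (y, (u, v))) (inX n l m) x :=
  hasFDerivAt_prodMk_left x (u, v)

theorem hasFDerivAt_inU (x : Vec n) (u : Vec l) (v : Vec m) :
    HasFDerivAt (fun y => (x, (y, v))) (inU n l m) u :=
  (hasFDerivAt_prodMk_right x (u, v)).comp u (hasFDerivAt_prodMk_left u v)

theorem hasFDerivAt_inV (x : Vec n) (u : Vec l) (v : Vec m) :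
    HasFDerivAt (fun y => (x, (u, y))) (inV n l m) v :=
  (hasFDerivAt_prodMk_right x (u, v)).comp v (hasFDerivAt_prodMk_right u v)

variable {P}

theorem IsRegular.isC2 (h : P.IsRegular) : P.IsC2 :=
  ⟨fun i => (h.1 i).1, fun i => (h.2.1 i).1, fun j => (h.2.2 j).1⟩

namespace IsC2

variable (hP : P.IsC2)

include hP

theorem contDiff_dyn : ContDiff ℝ 2 P.dyn := by
  have hf : ∀ i, ContDiff ℝ 2 fun w : Vec n × (Vec l × Vec m) => P.f i (w.1, w.2.1) := fun i =>
    (hP.1 i).comp (contDiff_fst.prodMk (contDiff_fst.comp contDiff_snd))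
  have hv : ∀ i, ContDiff ℝ 2 fun w : Vec n × (Vec l × Vec m) => w.2.2 i := fun i =>
    (EuclideanSpace.proj (𝕜 := ℝ) i : Vec m →L[ℝ] ℝ).contDiff.comp
      (contDiff_snd.comp contDiff_snd)
  exact (hf 0).add (ContDiff.sum fun i _ => (hv i).smul (hf i.succ))

theorem contDiff_Φ : ContDiff ℝ 2 P.Φ := contDiff_pi.2 hP.2.1

theorem contDiff_eqs : ContDiff ℝ 2 P.eqs := contDiff_pi.2 hP.2.2

theorem fderiv_Φ_apply (z e : Vec n × Vec n) (i : Fin (dφ + 1)) :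
    fderiv ℝ P.Φ z e i = fderiv ℝ (P.φ i) z e :=
  congr($(fderiv_apply (hP.contDiff_Φ.differentiable two_ne_zero z) i) e).symm

theorem fderiv_eqs_apply (z e : Vec n × Vec n) (j : Fin dη) :
    fderiv ℝ P.eqs z e j = fderiv ℝ (P.η j) z e :=
  congr($(fderiv_apply (hP.contDiff_eqs.differentiable two_ne_zero z) j) e).symm

theorem hasFDerivAt_dyn (w : Vec n × (Vec l × Vec m)) :
    HasFDerivAt P.dyn (fderiv ℝ P.dyn w) w :=
  (hP.contDiff_dyn.differentiable two_ne_zero w).hasFDerivAt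

variable (x : Vec n) (u : Vec l) (v : Vec m)

theorem hasFDerivAt_x : HasFDerivAt (fun y => P.F y u v)
    ((fderiv ℝ P.dyn (x, (u, v))).comp (inX n l m)) x :=
  HasFDerivAt.comp (g := P.dyn) x (hP.hasFDerivAt_dyn _) (hasFDerivAt_inX x u v)

theorem hasFDerivAt_u : HasFDerivAt (fun y => P.F x y v)
    ((fderiv ℝ P.dyn (x, (u, v))).comp (inU n l m)) u :=
  HasFDerivAt.comp (g := P.dyn) u (hP.hasFDerivAt_dyn _) (hasFDerivAt_inU x u v)

theorem hasFDerivAt_v : HasFDerivAt (fun y => P.F x u y)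
    ((fderiv ℝ P.dyn (x, (u, v))).comp (inV n l m)) v :=
  HasFDerivAt.comp (g := P.dyn) v (hP.hasFDerivAt_dyn _) (hasFDerivAt_inV x u v)

theorem linearizedRHS_eq (wh w : Triple n l m) (t : ℝ) :
    P.linearizedRHS wh w t =
      fderiv ℝ P.dyn (wh.x t, (wh.u t, wh.v t)) (w.x t, (w.u t, w.v t)) := by
  rw [linearizedRHS, (hP.hasFDerivAt_x _ _ _).fderiv, (hP.hasFDerivAt_u _ _ _).fderiv,
    (hP.hasFDerivAt_v _ _ _).fderiv]
  simp only [ContinuousLinearMap.comp_apply, ← map_add]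
  simp

variable (μ : Multiplier n dφ dη) (t : ℝ)

theorem Hx_eq : P.Hx μ x u v t = (μ.p t).comp ((fderiv ℝ P.dyn (x, (u, v))).comp (inX n l m)) :=
  ((μ.p t).hasFDerivAt.comp x (hP.hasFDerivAt_x x u v)).fderiv

theorem Hu_eq : P.Hu μ x u v t = (μ.p t).comp ((fderiv ℝ P.dyn (x, (u, v))).comp (inU n l m)) :=
  ((μ.p t).hasFDerivAt.comp u (hP.hasFDerivAt_u x u v)).fderiv

theorem Hv_eq : P.Hv μ x u v t = (μ.p t).comp ((fderiv ℝ P.dyn (x, (u, v))).comp (inV n l m)) :=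
  ((μ.p t).hasFDerivAt.comp v (hP.hasFDerivAt_v x u v)).fderiv

theorem Hu_eq_zero_and_Hv_eq_zero_iff :
    P.Hu μ x u v t = 0 ∧ P.Hv μ x u v t = 0 ↔
      ∀ c : Vec l × Vec m, μ.p t (fderiv ℝ P.dyn (x, (u, v)) (0, c)) = 0 := by
  rw [hP.Hu_eq, hP.Hv_eq]
  refine ⟨fun ⟨hu, hv⟩ c => ?_, fun h => ⟨?_, ?_⟩⟩
  · have hc : ((0, c) : Vec n × (Vec l × Vec m)) = inU n l m c.1 + inV n l m c.2 := by simp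
    rw [hc, map_add, map_add]
    exact (congrArg₂ (· + ·) congr($hu c.1) congr($hv c.2)).trans (add_zero 0)
  · ext a
    exact h (a, 0)
  · ext b
    exact h (0, b)

theorem fderiv_fderiv_dyn_inV (b b' : Vec m) :
    fderiv ℝ (fderiv ℝ P.dyn) (x, (u, v)) (inV n l m b) (inV n l m b') = 0 := by
  have hcomp := fderiv_clm_comp_fderiv_comp_apply hP.contDiff_dyn
    (ContinuousLinearMap.id ℝ (Vec n)) (hasFDerivAt_inV x u v) (inV n l m) b b'
  have hconst : ∀ y, (fderiv ℝ P.dyn (x, (u, y))).comp (inV n l m) =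
      ∑ i : Fin m, (EuclideanSpace.proj (𝕜 := ℝ) i : Vec m →L[ℝ] ℝ).smulRight
        (P.f i.succ (x, u)) := fun y =>
    (hP.hasFDerivAt_v x u y).unique ((HasFDerivAt.fun_sum fun i _ =>
      ((EuclideanSpace.proj (𝕜 := ℝ) i : Vec m →L[ℝ] ℝ).smulRight
        (P.f i.succ (x, u))).hasFDerivAt).const_add (P.f 0 (x, u)))
  simp_rw [hconst] at hcomp
  simpa using hcomp.symm

theorem secondVariationIntegrand_eq (wh w : Triple n l m) :
    P.secondVariationIntegrand wh μ w t = μ.p t ((1 / 2 : ℝ) •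
      fderiv ℝ (fderiv ℝ P.dyn) (wh.x t, (wh.u t, wh.v t)) (w.x t, (w.u t, w.v t))
        (w.x t, (w.u t, w.v t))) := by
  have hw : (w.x t, (w.u t, w.v t)) =
    inX n l m (w.x t) + inU n l m (w.u t) + inV n l m (w.v t) := by simp
  have hvv := hP.fderiv_fderiv_dyn_inV (wh.x t) (wh.u t) (wh.v t) (w.v t) (w.v t)
  simp only [secondVariationIntegrand, hP.Hx_eq, hP.Hu_eq, hP.Hv_eq]
  rw [fderiv_clm_comp_fderiv_comp_apply hP.contDiff_dyn _ (hasFDerivAt_inX _ _ _),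
    fderiv_clm_comp_fderiv_comp_apply hP.contDiff_dyn _ (hasFDerivAt_inX _ _ _),
    fderiv_clm_comp_fderiv_comp_apply hP.contDiff_dyn _ (hasFDerivAt_inX _ _ _),
    fderiv_clm_comp_fderiv_comp_apply hP.contDiff_dyn _ (hasFDerivAt_inU _ _ _),
    fderiv_clm_comp_fderiv_comp_apply hP.contDiff_dyn _ (hasFDerivAt_inU _ _ _), hw]
  set D := fderiv ℝ (fderiv ℝ P.dyn) (wh.x t, (wh.u t, wh.v t))
  have hsymm : ∀ a b, D a b = D b a := fun a b =>
    (hP.contDiff_dyn.contDiffAt.isSymmSndFDerivAt (by simp)) a b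
  simp only [map_add, add_apply, map_smul, smul_eq_mul, hvv]
  rw [hsymm (inU n l m (w.u t)) (inX n l m (w.x t)), hsymm (inV n l m (w.v t)) (inX n l m (w.x t)),
    hsymm (inV n l m (w.v t)) (inU n l m (w.u t)), map_zero]
  ring

end IsC2

end ControlProblem

/-- The pairing with a fixed multiplier, as a continuous linear functional. -/
def pairingL {ι κ : Type*} [Fintype ι] [Fintype κ] (ab : (ι → ℝ) × (κ → ℝ)) :
    (ι → ℝ) × (κ → ℝ) →L[ℝ] ℝ where
  toFun := pairing ab
  map_add' k k' := by
    simp only [pairing, Prod.fst_add, Prod.snd_add, dotProduct_add]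
    ring
  map_smul' r k := by
    simp only [pairing, Prod.smul_fst, Prod.smul_snd, dotProduct_smul, ← smul_add,
      RingHom.id_apply]
  cont := continuous_pairing.comp (continuous_const.prodMk continuous_id)

namespace ControlProblem

variable {n l m dφ dη : ℕ} {P : ControlProblem n l m dφ dη}

theorem endpointLagrangian_eq_comp (μ : Multiplier n dφ dη) :
    P.endpointLagrangian μ = pairingL (μ.α, μ.β) ∘ fun z => (P.Φ z, P.eqs z) := rfl

namespace IsC2

variable (hP : P.IsC2) (μ : Multiplier n dφ dη)

include hP

theorem hasFDerivAt_endpointLagrangian (z : Vec n × Vec n) :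
    HasFDerivAt (P.endpointLagrangian μ)
      (pairingL (μ.α, μ.β) ∘L (fderiv ℝ P.Φ z).prod (fderiv ℝ P.eqs z)) z :=
  (pairingL (μ.α, μ.β)).hasFDerivAt.comp z
    ((hP.contDiff_Φ.differentiable two_ne_zero z).hasFDerivAt.prodMk
      (hP.contDiff_eqs.differentiable two_ne_zero z).hasFDerivAt)

theorem fderiv_endpointLagrangian_apply (z e : Vec n × Vec n) :
    fderiv ℝ (P.endpointLagrangian μ) z e =
      pairing (μ.α, μ.β) (fderiv ℝ P.Φ z e, fderiv ℝ P.eqs z e) :=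
  congr($((hP.hasFDerivAt_endpointLagrangian μ z).fderiv) e)

theorem iteratedFDeriv_two_endpointLagrangian_apply (z e : Vec n × Vec n) :
    iteratedFDeriv ℝ 2 (P.endpointLagrangian μ) z (fun _ => e) = pairing (μ.α, μ.β)
      (fderiv ℝ (fderiv ℝ P.Φ) z e e, fderiv ℝ (fderiv ℝ P.eqs) z e e) := by
  rw [endpointLagrangian_eq_comp, ContinuousLinearMap.iteratedFDeriv_comp_left _
      (hP.contDiff_Φ.prodMk hP.contDiff_eqs).contDiffAt le_rfl,
    iteratedFDeriv_prodMk hP.contDiff_Φ.contDiffAt hP.contDiff_eqs.contDiffAt le_rfl]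
  change pairing _ (iteratedFDeriv ℝ 2 P.Φ z _, iteratedFDeriv ℝ 2 P.eqs z _) = _
  rw [iteratedFDeriv_two_apply, iteratedFDeriv_two_apply]

theorem fderiv_endpointLagrangian_left (a b : Vec n) :
    fderiv ℝ (fun y => P.endpointLagrangian μ (y, b)) a =
      fderiv ℝ (P.endpointLagrangian μ) (a, b) ∘L ContinuousLinearMap.inl ℝ _ _ := by
  rw [(hP.hasFDerivAt_endpointLagrangian μ (a, b)).fderiv]
  exact (HasFDerivAt.comp (g := P.endpointLagrangian μ) (f := fun y => (y, b)) a
    (hP.hasFDerivAt_endpointLagrangian μ (a, b)) (hasFDerivAt_prodMk_left a b)).fderiv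

theorem fderiv_endpointLagrangian_right (a b : Vec n) :
    fderiv ℝ (fun y => P.endpointLagrangian μ (a, y)) b =
      fderiv ℝ (P.endpointLagrangian μ) (a, b) ∘L ContinuousLinearMap.inr ℝ _ _ := by
  rw [(hP.hasFDerivAt_endpointLagrangian μ (a, b)).fderiv]
  exact (HasFDerivAt.comp (g := P.endpointLagrangian μ) (f := fun y => (a, y)) b
    (hP.hasFDerivAt_endpointLagrangian μ (a, b)) (hasFDerivAt_prodMk_right a b)).fderiv

end IsC2

variable {wh : Triple n l m}

theorem IsTrajectory.continuousOn (hw : P.IsTrajectory wh) : ContinuousOn wh.x (Icc 0 P.T) :=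
  hw.1.1.continuousOn le_top

/-- A trajectory of the control problem as a reference trajectory of the system `ẋ = F (x, c)`
with the single control `c = (u, v)`. -/
def reference (hT : 0 ≤ P.T) (hP : P.IsC2) (hw : P.IsTrajectory wh) :
    ReferenceTrajectory (Vec n) (Vec l × Vec m) P.T where
  nonneg := hT
  F := P.dyn
  contDiff := hP.contDiff_dyn
  x := restrictIcc hw.continuousOn
  c := fun t => (wh.u t, wh.v t)
  measurable_c := hw.1.memLp_controls.1
  bounded_c := exists_ae_norm_le_of_memLp_top hw.1.memLp_controls
  x_eq := by
    refine (hw.1.1.restrictIcc_eq_primitive le_top hw.2).trans ?_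
    rw [restrictIcc_apply]
    congr 1
    refine primitive_congr ?_
    filter_upwards [ae_timeMeasure_mem P.T] with t ht
    rw [IccExtend_restrictIcc hT _ ht]
    rfl

/-- The direction of the linearized system given by an element of `𝒲₂`. -/
def direction {w : Triple n l m} (h : w.MemW 2 P.T) :
    Vec n × Lp (Vec l × Vec m) 2 (timeMeasure P.T) :=
  (w.x 0, h.memLp_controls.toLp)

theorem coeFn_direction {w : Triple n l m} (h : w.MemW 2 P.T) :
    (direction h).2 =ᵐ[timeMeasure P.T] fun t => (w.u t, w.v t) :=
  h.memLp_controls.coeFn_toLp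

section Bridge

variable (hT : 0 ≤ P.T) (hP : P.IsC2) (hw : P.IsTrajectory wh)

theorem reference_pt {t : ℝ} (ht : t ∈ Icc 0 P.T) :
    (reference hT hP hw).pt t = (wh.x t, (wh.u t, wh.v t)) :=
  Prod.ext (IccExtend_restrictIcc hT hw.continuousOn ht) rfl

theorem linearizedState_direction {w : Triple n l m} (h : w.MemW 2 P.T)
    (hlin : ∀ᵐ t ∂timeMeasure P.T, HasDerivAt w.x (P.linearizedRHS wh w t) t) :
    (reference hT hP hw).linearizedState (direction h) =
      restrictIcc (h.1.continuousOn one_le_two) := by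
  refine ((reference hT hP hw).eq_linearizedState ?_).symm
  refine (h.1.restrictIcc_eq_primitive one_le_two hlin).trans ?_
  congr 1
  refine primitive_congr ?_
  filter_upwards [ae_timeMeasure_mem P.T, h.memLp_controls.coeFn_toLp] with t ht hc
  rw [hP.linearizedRHS_eq, IccExtend_restrictIcc _ _ ht, reference_pt hT hP hw ht, hc]
  rfl

theorem endpointsL_linearizedState_direction {w : Triple n l m} (h : w.MemW 2 P.T)
    (hlin : ∀ᵐ t ∂timeMeasure P.T, HasDerivAt w.x (P.linearizedRHS wh w t) t) :
    endpointsL hT (Vec n) ((reference hT hP hw).linearizedState (direction h)) =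
      P.endpoints w := by
  rw [linearizedState_direction hT hP hw h hlin]
  rfl

theorem pairing_linearization (μ : Multiplier n dφ dη)
    (q : Vec n × Lp (Vec l × Vec m) 2 (timeMeasure P.T)) :
    pairing (μ.α, μ.β) ((reference hT hP hw).linearization P.Φ q,
        (reference hT hP hw).linearization P.eqs q) =
      fderiv ℝ (fun y => P.endpointLagrangian μ (y, wh.x P.T)) (wh.x 0) q.1 +
        fderiv ℝ (fun y => P.endpointLagrangian μ (wh.x 0, y)) (wh.x P.T)
          ((reference hT hP hw).linearizedState q ⟨P.T, hT, le_rfl⟩) := by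
  set R := reference hT hP hw
  have hend : endpointsL hT (Vec n) (R.linearizedState q) =
      ContinuousLinearMap.inl ℝ _ _ q.1 +
        ContinuousLinearMap.inr ℝ _ _ (R.linearizedState q ⟨P.T, hT, le_rfl⟩) :=
    Prod.ext ((R.linearizedState_zero q).trans (add_zero _).symm) (zero_add _).symm
  rw [hP.fderiv_endpointLagrangian_left, hP.fderiv_endpointLagrangian_right,
    ContinuousLinearMap.comp_apply, ContinuousLinearMap.comp_apply, ← map_add, ← hend,
    hP.fderiv_endpointLagrangian_apply]
  rfl

section Multiplier

variable {μ : Multiplier n dφ dη} (hμ : μ ∈ P.multipliers wh)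

theorem isAdjoint_of_mem_multipliers :
    (reference hT hP hw).IsAdjoint (restrictIcc (hμ.1.continuousOn le_top)) := by
  refine (hμ.1.restrictIcc_eq_primitive le_top hμ.2.2.2.1).trans ?_
  rw [restrictIcc_apply]
  congr 1
  refine primitive_congr ?_
  filter_upwards [ae_timeMeasure_mem P.T] with t ht
  rw [hP.Hx_eq, ReferenceTrajectory.adjointRHS, IccExtend_restrictIcc _ _ ht,
    reference_pt hT hP hw ht]
  rfl

include hμ

theorem mem_normalizedMultipliers_of_mem_multipliers :
    (μ.α, μ.β) ∈ normalizedMultipliers fun q => ((reference hT hP hw).linearization P.Φ q,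
      (reference hT hP hw).linearization P.eqs q) := by
  have hadjoint := isAdjoint_of_mem_multipliers hT hP hw hμ
  obtain ⟨hW, hnorm, hpos, -, hp0, hpT, hstat⟩ := id hμ
  refine ⟨hnorm, hpos, fun q => ?_⟩
  have hzero : ∫ t, IccExtend hT (restrictIcc (hW.continuousOn le_top)) t
      (fderiv ℝ P.dyn ((reference hT hP hw).pt t) (0, q.2 t)) ∂timeMeasure P.T = 0 := by
    refine integral_eq_zero_of_ae ?_
    filter_upwards [ae_timeMeasure_mem P.T, hstat] with t ht hc
    rw [IccExtend_restrictIcc _ _ ht, reference_pt hT hP hw ht]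
    exact (hP.Hu_eq_zero_and_Hv_eq_zero_iff _ _ _ _ _).1 hc _
  have hparts := ((reference hT hP hw).adjoint_apply_linearizedState hadjoint q).trans hzero
  rw [restrictIcc_apply, restrictIcc_apply, hp0, hpT, neg_apply] at hparts
  rw [pairing_linearization hT hP hw]
  linarith

theorem fderiv_endpointLagrangian_secondOrderState {w : Triple n l m} (h : w.MemW 2 P.T)
    (hlin : ∀ᵐ t ∂timeMeasure P.T, HasDerivAt w.x (P.linearizedRHS wh w t) t) :
    fderiv ℝ (P.endpointLagrangian μ) (P.endpoints wh)
        (endpointsL hT (Vec n) ((reference hT hP hw).secondOrderState (direction h))) =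
      ∫ t in (0 : ℝ)..P.T, P.secondVariationIntegrand wh μ w t := by
  obtain ⟨-, -, -, -, -, hpT, -⟩ := id hμ
  have hend : fderiv ℝ (P.endpointLagrangian μ) (P.endpoints wh)
      (endpointsL hT (Vec n) ((reference hT hP hw).secondOrderState (direction h))) =
        μ.p P.T ((reference hT hP hw).secondOrderState (direction h) ⟨P.T, hT, le_rfl⟩) := by
    rw [hpT, hP.fderiv_endpointLagrangian_right, endpointsL_apply,
      (reference hT hP hw).secondOrderState_zero]
    rfl
  rw [hend, intervalIntegral_eq_timeMeasure hT]
  refine ((reference hT hP hw).adjoint_apply_secondOrderState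
    (isAdjoint_of_mem_multipliers hT hP hw hμ) (direction h)).trans (integral_congr_ae ?_)
  filter_upwards [ae_timeMeasure_mem P.T, coeFn_direction h] with t ht hc
  rw [hP.secondVariationIntegrand_eq, IccExtend_restrictIcc _ _ ht,
    linearizedState_direction hT hP hw h hlin, IccExtend_restrictIcc _ _ ht,
    reference_pt hT hP hw ht, hc]
  rfl

theorem secondVariation_eq_pairing {w : Triple n l m} (h : w.MemW 2 P.T)
    (hlin : ∀ᵐ t ∂timeMeasure P.T, HasDerivAt w.x (P.linearizedRHS wh w t) t) :
    P.secondVariation wh μ w =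
      pairing (μ.α, μ.β) ((reference hT hP hw).curvature P.Φ (direction h),
        (reference hT hP hw).curvature P.eqs (direction h)) := by
  rw [secondVariation, hP.iteratedFDeriv_two_endpointLagrangian_apply,
    ← fderiv_endpointLagrangian_secondOrderState hT hP hw hμ h hlin,
    hP.fderiv_endpointLagrangian_apply, add_comm,
    ← endpointsL_linearizedState_direction hT hP hw h hlin]
  exact ((map_add (pairingL (μ.α, μ.β)) _ _).trans
    (congrArg _ (map_smul (pairingL (μ.α, μ.β)) _ _))).symm

end Multiplier

theorem exists_mem_multipliers {ab : (Fin (dφ + 1) → ℝ) × (Fin dη → ℝ)}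
    (hab : ab ∈ normalizedMultipliers fun q => ((reference hT hP hw).linearization P.Φ q,
      (reference hT hP hw).linearization P.eqs q)) :
    ∃ μ ∈ P.multipliers wh, (μ.α, μ.β) = ab := by
  set R := reference hT hP hw
  let μ₀ : Multiplier n dφ dη := ⟨ab.1, ab.2, 0⟩
  obtain ⟨p, hp, hp0, hpT, hstat⟩ := R.exists_costate
    (d₀ := fderiv ℝ (fun y => P.endpointLagrangian μ₀ (y, wh.x P.T)) (wh.x 0))
    (d₁ := fderiv ℝ (fun y => P.endpointLagrangian μ₀ (wh.x 0, y)) (wh.x P.T))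
    (fun q => (pairing_linearization hT hP hw μ₀ q).symm.trans (hab.2.2 q))
  have hp_eq := IccExtend_eq_integral hT (R.integrable_adjointRHS p) hp
  refine ⟨⟨ab.1, ab.2, IccExtend hT p⟩, ⟨⟨_, R.memLp_adjointRHS p, hp_eq⟩, hab.1, hab.2.1, ?_,
    (IccExtend_apply_of_mem hT p ⟨le_rfl, hT⟩).trans hp0,
    (IccExtend_apply_of_mem hT p ⟨hT, le_rfl⟩).trans hpT, ?_⟩, rfl⟩
  · filter_upwards [ae_timeMeasure_mem P.T,
      ae_hasDerivAt_of_eq_integral (R.integrable_adjointRHS p) hp_eq] with t ht hderiv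
    rw [ReferenceTrajectory.adjointRHS, reference_pt hT hP hw ht] at hderiv
    rw [hP.Hx_eq]
    exact hderiv
  · filter_upwards [ae_timeMeasure_mem P.T, hstat] with t ht hs
    rw [reference_pt hT hP hw ht] at hs
    exact (hP.Hu_eq_zero_and_Hv_eq_zero_iff _ _ _ _ _).2 hs

theorem image_secondVariation_multipliers {w : Triple n l m} (h : w.MemW 2 P.T)
    (hlin : ∀ᵐ t ∂timeMeasure P.T, HasDerivAt w.x (P.linearizedRHS wh w t) t) :
    (fun μ => P.secondVariation wh μ w) '' P.multipliers wh =
      (fun ab => pairing ab ((reference hT hP hw).curvature P.Φ (direction h),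
        (reference hT hP hw).curvature P.eqs (direction h))) ''
        normalizedMultipliers fun q => ((reference hT hP hw).linearization P.Φ q,
          (reference hT hP hw).linearization P.eqs q) := by
  refine Subset.antisymm ?_ ?_
  · rintro _ ⟨μ, hμ, rfl⟩
    exact ⟨(μ.α, μ.β), mem_normalizedMultipliers_of_mem_multipliers hT hP hw hμ,
      (secondVariation_eq_pairing hT hP hw hμ h hlin).symm⟩
  · rintro _ ⟨ab, hab, rfl⟩
    obtain ⟨μ, hμ, rfl⟩ := exists_mem_multipliers hT hP hw hab
    exact ⟨μ, hμ, secondVariation_eq_pairing hT hP hw hμ h hlin⟩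

end Bridge

end ControlProblem

theorem eLpNorm_top_lt_ofReal_of_ae_norm_le {α F : Type*} [MeasurableSpace α] {μ : Measure α}
    [NormedAddCommGroup F] {f : α → F} {r ε : ℝ} (hε : 0 < ε) (hr : r < ε)
    (hf : ∀ᵐ a ∂μ, ‖f a‖ ≤ r) : eLpNorm f ⊤ μ < ENNReal.ofReal ε := by
  rw [eLpNorm_exponent_top]
  exact (eLpNormEssSup_le_of_ae_bound hf).trans_lt ((ENNReal.ofReal_lt_ofReal_iff hε).2 hr)

namespace ReferenceTrajectory.IsNearbyTrajectory

variable {E C : Type*} [NormedAddCommGroup E] [NormedSpace ℝ E] [NormedAddCommGroup C]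
  [NormedSpace ℝ C] {T : ℝ} {R : ReferenceTrajectory E C T} {ε : ℝ} {x : C(Icc 0 T, E)}
  {c : ℝ → C} (h : R.IsNearbyTrajectory ε x c)

include h

theorem memLp_control : MemLp c ⊤ (timeMeasure T) := by
  obtain ⟨M, hM⟩ := R.bounded_c
  refine memLp_top_of_bound h.1 (M + ε) ?_
  filter_upwards [hM, h.2.2.2] with t hRc hc
  exact (norm_le_norm_add_norm_sub' (c t) (R.c t)).trans (add_le_add hRc hc)

theorem memLp_rate [FiniteDimensional ℝ E] [FiniteDimensional ℝ C] :
    MemLp (fun t => R.F (IccExtend R.nonneg x t, c t)) ⊤ (timeMeasure T) :=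
  R.memLp_dynamics x h.1 h.2.2.2 ⊤

end ReferenceTrajectory.IsNearbyTrajectory

namespace ControlProblem

variable {n l m dφ dη : ℕ} {P : ControlProblem n l m dφ dη} {wh : Triple n l m}

theorem ControlsAwayFromBoundary.exists_forall_norm_sub_le (h : P.ControlsAwayFromBoundary wh) :
    ∃ ρ > 0, ∀ᵐ t ∂timeMeasure P.T, ∀ c : Vec l × Vec m,
      ‖c - (wh.u t, wh.v t)‖ ≤ ρ → c.1 ∈ P.U ∧ c.2 ∈ P.V := by
  obtain ⟨δ, hδ, hball⟩ := h
  refine ⟨δ / 2, half_pos hδ, ?_⟩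
  filter_upwards [hball] with t ht c hc
  have hsum : ‖c.1 - wh.u t‖ ^ 2 + ‖c.2 - wh.v t‖ ^ 2 ≤ δ ^ 2 :=
    calc ‖c.1 - wh.u t‖ ^ 2 + ‖c.2 - wh.v t‖ ^ 2
      _ ≤ (δ / 2) ^ 2 + (δ / 2) ^ 2 := by
        gcongr
        exacts [(norm_fst_le _).trans hc, (norm_snd_le _).trans hc]
      _ ≤ δ ^ 2 := by linarith [sq_nonneg δ]
  simpa only [add_sub_cancel] using ht _ _ hsum

section WeakMin

variable (hT : 0 ≤ P.T) (hP : P.IsC2)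

/-- The triple with state `x`, extended by constants outside `[0, T]`, and control
`c = (u, v)`. -/
def tripleOfCurve (x : C(Icc 0 P.T, Vec n)) (c : ℝ → Vec l × Vec m) : Triple n l m :=
  ⟨IccExtend hT x, fun t => (c t).1, fun t => (c t).2⟩

theorem endpoints_tripleOfCurve (x : C(Icc 0 P.T, Vec n)) (c : ℝ → Vec l × Vec m) :
    P.endpoints (tripleOfCurve hT x c) = endpointsL hT (Vec n) x :=
  Prod.ext (IccExtend_apply_of_mem hT x ⟨le_rfl, hT⟩) (IccExtend_apply_of_mem hT x ⟨hT, le_rfl⟩)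

section Nearby

variable (hw : P.IsTrajectory wh) {ε : ℝ} {x : C(Icc 0 P.T, Vec n)} {c : ℝ → Vec l × Vec m}
  (h : (reference hT hP hw).IsNearbyTrajectory ε x c)

include h

theorem isTrajectory_tripleOfCurve : P.IsTrajectory (tripleOfCurve hT x c) := by
  have hrate : Integrable (fun t => P.dyn (IccExtend hT x t, c t)) (timeMeasure P.T) :=
    h.memLp_rate.integrable le_top
  have hx := IccExtend_eq_integral hT hrate h.2.1
  exact ⟨⟨⟨_, h.memLp_rate, hx⟩, h.memLp_control.fst, h.memLp_control.snd⟩,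
    ae_hasDerivAt_of_eq_integral hrate hx⟩

theorem ae_norm_tripleOfCurve_sub_le :
    ∀ᵐ t ∂timeMeasure P.T, ‖(tripleOfCurve hT x c).x t - wh.x t‖ ≤ ε := by
  filter_upwards [ae_timeMeasure_mem P.T] with t ht
  rw [← IccExtend_restrictIcc hT hw.continuousOn ht]
  exact (norm_IccExtend_le hT (x - (reference hT hP hw).x) t).trans h.2.2.1

end Nearby

theorem IsWeakMin.isWeakParetoMin (hbd : P.ControlsAwayFromBoundary wh)
    (hact : ∀ i : Fin dφ, P.φ i.succ (P.endpoints wh) = 0) (hmin : P.IsWeakMin wh) :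
    ∃ ε > 0, (reference hT hP hmin.1.1).IsWeakParetoMin P.Φ P.eqs ε := by
  obtain ⟨⟨hw, hη, -, -⟩, ε, hε, hopt⟩ := id hmin
  obtain ⟨ρ, hρ, hball⟩ := hbd.exists_forall_norm_sub_le
  refine ⟨min (ε / 2) ρ, by positivity, fun x c h hH hΦ => ?_⟩
  have hr : min (ε / 2) ρ < ε := (min_le_left _ _).trans_lt (half_lt_self hε)
  have hends := endpoints_tripleOfCurve hT x c
  have hfeas : P.IsFeasible (tripleOfCurve hT x c) := by
    refine ⟨isTrajectory_tripleOfCurve hT hP hw h, fun j => ?_, fun i => ?_, ?_⟩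
    · rw [hends]
      exact (congrFun hH j).trans (hη j)
    · rw [hends]
      exact (hΦ i.succ).le.trans (hact i).le
    · filter_upwards [hball, h.2.2.2] with t ht hc
      exact ht (c t) (hc.trans (min_le_right _ _))
  have hle := hopt _ hfeas
    (eLpNorm_top_lt_ofReal_of_ae_norm_le hε hr (ae_norm_tripleOfCurve_sub_le hT hP hw h))
    (eLpNorm_top_lt_ofReal_of_ae_norm_le hε hr (h.2.2.2.mono fun t => (norm_fst_le _).trans))
    (eLpNorm_top_lt_ofReal_of_ae_norm_le hε hr (h.2.2.2.mono fun t => (norm_snd_le _).trans))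
  rw [hends] at hle
  exact (hΦ 0).not_ge hle

end WeakMin

end ControlProblem

end

theorem theorem3p2_general {n l m dφ dη : ℕ} (P : ControlProblem n l m dφ dη) (wh : Triple n l m)
    (hT : 0 ≤ P.T) (hP : P.IsC2) (hbd : P.ControlsAwayFromBoundary wh)
    (hact : ∀ i : Fin dφ, P.φ i.succ (P.endpoints wh) = 0) (hmin : P.IsWeakMin wh) :
    ∀ w ∈ P.criticalConeL2 wh, ∃ M : ℝ,
      IsGreatest ((fun μ => P.secondVariation wh μ w) '' P.multipliers wh) M ∧ 0 ≤ M := by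
  rintro w ⟨hw, hlin, hη, hφ⟩
  obtain ⟨ε, hε, hpareto⟩ := hmin.isWeakParetoMin hT hP hbd hact
  have hends := ControlProblem.endpointsL_linearizedState_direction hT hP hmin.1.1 hw hlin
  obtain ⟨ab, hab, hpos⟩ := ReferenceTrajectory.exists_multiplier _ hP.contDiff_Φ
    hP.contDiff_eqs hε hpareto (q := ControlProblem.direction hw)
    (funext fun j => (hP.fderiv_eqs_apply _ _ j).trans (hends ▸ hη j))
    (fun i => (hP.fderiv_Φ_apply _ _ i).trans_le (hends ▸ hφ i))
  rw [ControlProblem.image_secondVariation_multipliers hT hP hmin.1.1 hw hlin]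
  obtain ⟨M, hM⟩ := exists_isGreatest_pairing ⟨ab, hab⟩ _
  exact ⟨M, hM, hpos.trans (hM.2 ⟨ab, hab, rfl⟩)⟩

/-- Second order necessary condition for a weak minimum: the maximum over the set of Lagrange
multipliers of the second variation exists and is nonnegative, on the critical cone `𝒞` in the
`L^∞` setting and on the critical cone `𝒞₂` in the `L²` setting. -/
theorem theorem3p2 {n l m dφ dη : ℕ} (P : ControlProblem n l m dφ dη) (wh : Triple n l m)
    (hT : 0 < P.T) (hU : IsOpen P.U) (hV : IsOpen P.V) (hreg : P.IsRegular)
    (hbd : P.ControlsAwayFromBoundary wh)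
    (hact : ∀ i : Fin dφ, P.φ i.succ (P.endpoints wh) = 0)
    (hmin : P.IsWeakMin wh) :
    (∀ w ∈ P.criticalCone wh, ∃ M : ℝ,
      IsGreatest ((fun μ => P.secondVariation wh μ w) '' P.multipliers wh) M ∧ 0 ≤ M) ∧
    (∀ w ∈ P.criticalConeL2 wh, ∃ M : ℝ,
      IsGreatest ((fun μ => P.secondVariation wh μ w) '' P.multipliers wh) M ∧ 0 ≤ M) := by
  have h := theorem3p2_general P wh hT.le hreg.isC2 hbd hact hmin
  exact ⟨fun w hw => h w hw.1, h⟩
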